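/- **Setting.** Let $b>1$ be an integer and let $\mathbb T_b$ be the $b$-nary rooted tree with root $\varnothing$; $m(\sigma)$ denotes the mother of a site $\sigma\neq\varnothing$. For a configuration $(X_\sigma)_{\sigma\in\mathbb T_b}$ and a real $v$, put $X^{(v)}_\varnothing(0)=X_\varnothing+v$ and $X^{(v)}_\sigma(0)=X_\sigma$ for $\sigma\ne\varnothing$, and $$X^{(v)}_\sigma(t+1)=\begin{cases}X^{(v)}_\sigma(t)+\tfrac1bX^{(v)}_{m(\sigma)}(t)&\text{if }\sigma\ne\varnothing\text{ and }X^{(v)}_{m(\sigma)}(t)\ge1,\\ 0&\text{otherwise, if }X^{(v)}_\sigma(t)\ge1,\\ X^{(v)}_\sigma(t)&\text{otherwise.}\end{cases}$$ Let $\mathscr A^{(v)}$ be the set of sites $\sigma$ such that $X^{(v)}_\sigma(t)=0$ and $X_\sigma^{(v)}(s)\neq0$ for some $s<t$. For $\theta>0$ let $\mathscr B^{(\theta)}$ be the avalanche started with value $\theta$ at the root, together with its boundary: $\mathscr B^{(\theta)}=\{\varnothing\}\cup\{\sigma\ne\varnothing:\ m(\sigma)\in\mathscr A^{(\theta-X_\varnothing)}\}$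 if $\theta\ge1$, and $\mathscr B^{(\theta)}=\{\varnothing\}$ if $\theta<1$. Let $\rho$ be a probability measure on $[0,1]$ that is absolutely continuous with bounded density and satisfies $\rho([1-\frac1b,1])>0$. For $\lambda\in[0,1]$ let the $X_\sigma$ be i.i.d. with law $\rho$ and, independently, let each site be green with probability $\lambda$, independently of the other sites; let $\mathscr G$ be the set of green sites and $$B_\infty(\theta,\lambda)=\mathbb P_{\rho,\lambda}\bigl(\mathscr B^{(\theta)}\cap\mathscr G\neq\emptyset\bigr).$$ With $X,X_1,X_2,\dots$ i.i.d. of law $\rho$, let $Q^{(\theta)}_0=\theta$, $Q^{(\theta)}_n=X_n+\frac1bQ^{(\theta)}_{n-1}$ and $Z_n(\theta)=\mathbb P(Q^{(\theta)}_k\ge1,\ k=0,\dots,n)$. Let $\mathfrak z(\rho)=\lim_{n\to\infty}Z_n(1)^{1/n}$ and $\psi_\rho(\theta)=\lim_{n\to\infty}Z_n(\theta)\,\mathfrak z(\rho)^{-n}$. With $Y_1,Y_2,\dots$ i.i.d. of law $\rho$ let $Q_{n,k}^{(\theta)}=Y_k+\frac1bY_{k+1}+\dots+\frac1{b^{n-k}}Y_n+\frac{\theta}{b^{n-k+1}}$,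 let $\mathbb P_n^{(\theta)}$ be the law of $(Y_j)_{j\ge1}$ conditioned on $Q^{(\theta)}_{n,\ell}\ge1$ for $\ell=2,\dots,n$, and let $\widehat{\mathbb P}$ be the probability measure on sequences such that $\mathbb P_n^{(\theta)}(A)\to\widehat{\mathbb P}(A)$ as $n\to\infty$ for all $\theta\ge1$ and all measurable events $A$ depending on finitely many coordinates. Under $\widehat{\mathbb P}$ let $Q_\infty=\sum_{k\ge1}Y_kb^{-(k-1)}$. Let $c_\rho$ be the positive number with $$\frac1{c_\rho^2}=\frac{b-1}2\,\widehat{\mathbb E}\Bigl(\bigl[\mathbb E\,\psi_\rho\bigl(X+\tfrac{Q_\infty}b\bigr)\bigr]^2\,\Big|\,Q_\infty\ge1\Bigr),$$ where $\mathbb E$ is the expectation over $X$, which has law $\rho$ and is independent of $Q_\infty$. **Proposition 4.2.** Suppose that $\rho$ is critical, i.e. $\mathfrak z(\rho)=\frac1b$. Then the objects above are well defined: $Z_n(\theta)^{1/n}\to\mathfrak z(\rho)$ for every $\theta\ge1$, the limit defining $\psi_\rho(\theta)$ exists in $\mathbb R$ for every $\theta\ge0$, the limit law $\widehat{\mathbb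 P}$ exists, and $c_\rho\in(0,\infty)$. Moreover, for each $\theta\in(0,\infty)$, $$\lim_{\lambda\downarrow0}\frac{B_\infty(\theta,\lambda)}{\sqrt\lambda}=c_\rho\,\psi_\rho(\theta).$$ -/

import Mathlib

open Filter Topology MeasureTheory ProbabilityTheory

noncomputable section

namespace Avalanche

/-! ### The tree, the toppling dynamics and the avalanche sets -/

/-- The sites of the `b`-nary rooted tree.  A site is the list of the labels met on the path from
the root to it, the most recent label first: `[]` is the root, the sites `i :: σ` are the
daughters of `σ`, and `σ` is the mother of `i :: σ`. -/
abbrev Site (b : ℕ) : Type := List (Fin b)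

/-- One (parallel) step of the toppling rule. If the mother of a site is at least one, the site
receives the fraction `1 / b` of the value of its mother; otherwise, if the site itself is at least
one, it is emptied; otherwise it keeps its value. The root has no mother. -/
def topple (b : ℕ) (X : Site b → ℝ) : Site b → ℝ
  | [] => if 1 ≤ X [] then 0 else X []
  | i :: σ =>
      if 1 ≤ X σ then X (i :: σ) + X σ / b
      else if 1 ≤ X (i :: σ) then 0 else X (i :: σ)

/-- The configuration at time `t`, started from `x` with the amount `v` added at the root. -/
def process (b : ℕ) (x : Site b → ℝ) (v : ℝ) : ℕ → Site b → ℝ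
  | 0 => fun σ => if σ = [] then x [] + v else x σ
  | t + 1 => topple b (process b x v t)

/-- The set of the sites that have avalanched by time `t`. -/
def avalancheBy (b : ℕ) (x : Site b → ℝ) (v : ℝ) (t : ℕ) : Set (Site b) :=
  {σ | process b x v t σ = 0 ∧ ∃ s < t, process b x v s σ ≠ 0}

/-- The set of the sites that ever avalanche. -/
def avalanche (b : ℕ) (x : Site b → ℝ) (v : ℝ) : Set (Site b) :=
  ⋃ t, avalancheBy b x v t

open Classical in
/-- The avalanche when the value at the root (after the addition) is `θ`; it is empty, by
convention, if `θ < 1`. -/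
def rootedAvalanche (b : ℕ) (x : Site b → ℝ) (θ : ℝ) : Set (Site b) :=
  if 1 ≤ θ then avalanche b x (θ - x []) else ∅

/-- The avalanche together with its boundary: the root, and all daughters of avalanched sites. -/
def spilled (b : ℕ) (x : Site b → ℝ) (θ : ℝ) : Set (Site b) :=
  {[]} ∪ {σ | ∃ i τ, σ = i :: τ ∧ τ ∈ rootedAvalanche b x θ}

/-- The joint law of the i.i.d. initial values, with law `ρ`, and of the independent colours of the
sites, each of which is green (`true`) with probability `l`, independently of the others. -/
def jointLaw (b : ℕ) (ρ : Measure ℝ) (l : unitInterval) :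
    Measure ((Site b → ℝ) × (Site b → Bool)) :=
  (Measure.infinitePi fun _ : Site b => ρ).prod
    (Measure.infinitePi fun _ : Site b => bernoulliMeasure true false l)

/-- The probability that the avalanche with its boundary contains a green site. -/
def hitProb (b : ℕ) (ρ : Measure ℝ) (θ : ℝ) (l : unitInterval) : ℝ :=
  (jointLaw b ρ l).real {p | (spilled b p.1 θ ∩ {σ | p.2 σ = true}).Nonempty}

/-! ### The one-site laws -/

/-- The admissible laws: probability measures on `[0, 1]` with a bounded density with respect to
Lebesgue measure on `[0, 1]` that give positive mass to `[1 - 1 / b, 1]`. -/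
structure Admissible (b : ℕ) (ρ : Measure ℝ) : Prop where
  isProb : IsProbabilityMeasure ρ
  absCont : ρ ≪ volume.restrict (Set.Icc 0 1)
  bounded : ∃ C : NNReal, ∀ᵐ x ∂(volume.restrict (Set.Icc (0 : ℝ) 1)),
    ρ.rnDeriv (volume.restrict (Set.Icc 0 1)) x ≤ C
  mass_pos : 0 < ρ (Set.Icc (1 - 1 / (b : ℝ)) 1)

/-! ### Survival along one path -/

/-- The value accumulated along a path: `Q₀ = θ` and `Qₙ = Xₙ + Qₙ₋₁ / b`, that is,
`Qₙ = Xₙ + Xₙ₋₁ / b + ⋯ + X₁ / b ^ (n - 1) + θ / b ^ n`. Here `x k` stands for `X_{k+1}`. -/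
def pathQ (b : ℕ) (θ : ℝ) (x : ℕ → ℝ) : ℕ → ℝ
  | 0 => θ
  | n + 1 => x n + pathQ b θ x n / b

/-- `Zₙ(θ) = ℙ(Q₀ ≥ 1, …, Qₙ ≥ 1)`. -/
def survival (b : ℕ) (ρ : Measure ℝ) (n : ℕ) (θ : ℝ) : ℝ :=
  (Measure.infinitePi fun _ : ℕ => ρ).real {x | ∀ k ≤ n, 1 ≤ pathQ b θ x k}

/-- The rate `𝔷(ρ) = lim Zₙ(θ) ^ (1 / n)`, whose value is the same for all `θ ≥ 1`; it is read off
at `θ = 1`. -/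
def rate (b : ℕ) (ρ : Measure ℝ) : ℝ :=
  limUnder atTop fun n : ℕ => survival b ρ n 1 ^ (1 / (n : ℝ))

/-- `ψ_ρ(θ) = lim Zₙ(θ) 𝔷(ρ) ^ (-n)`. -/
def psi (b : ℕ) (ρ : Measure ℝ) (θ : ℝ) : ℝ :=
  limUnder atTop fun n : ℕ => survival b ρ n θ / rate b ρ ^ n

/-! ### The limiting law of the reversed path, and the constant -/

/-- The reversed sums
`Y_{k+1} + Y_{k+2} / b + ⋯ + Yₙ / b ^ (n - k - 1) + θ / b ^ (n - k)` for `k ≤ n`, where `y j` stands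
for `Y_{j+1}`. -/
def revQ (b : ℕ) (θ : ℝ) (n k : ℕ) (y : ℕ → ℝ) : ℝ :=
  ∑ j ∈ Finset.Ico k n, y j / (b : ℝ) ^ (j - k) + θ / (b : ℝ) ^ (n - k)

/-- The law of an i.i.d. sequence `Y₁, Y₂, …` with law `ρ`, conditioned on all the reversed sums
that start from `Y₂, …, Yₙ` being at least one (`Y₁` is not constrained). -/
def condPathLaw (b : ℕ) (ρ : Measure ℝ) (n : ℕ) (θ : ℝ) : Measure (ℕ → ℝ) :=
  cond (Measure.infinitePi fun _ : ℕ => ρ) {y | ∀ k, 1 ≤ k → k < n → 1 ≤ revQ b θ n k y}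

/-- `μ` is the limit of the conditioned laws, for every `θ ≥ 1`, on all events that depend on
finitely many coordinates. There is at most one such `μ`. -/
def IsLimitLaw (b : ℕ) (ρ : Measure ℝ) (μ : Measure (ℕ → ℝ)) : Prop :=
  IsProbabilityMeasure μ ∧
    ∀ θ : ℝ, 1 ≤ θ → ∀ (k : ℕ) (A : Set (Fin k → ℝ)), MeasurableSet A →
      Tendsto (fun n => condPathLaw b ρ n θ {y | (fun i : Fin k => y i) ∈ A}) atTop
        (𝓝 (μ {y | (fun i : Fin k => y i) ∈ A}))

/-- The limit of the conditioned laws. -/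
def limitLaw (b : ℕ) (ρ : Measure ℝ) : Measure (ℕ → ℝ) :=
  Classical.epsilon (IsLimitLaw b ρ)

/-- `Q_∞ = ∑_{k ≥ 1} Y_k / b ^ (k - 1)`. -/
def qInf (b : ℕ) (y : ℕ → ℝ) : ℝ := ∑' k, y k / (b : ℝ) ^ k

/-- The number `(b - 1) / 2 * Ê([𝔼 ψ_ρ(X + Q_∞ / b)]² | Q_∞ ≥ 1)`, where `X` has law `ρ` and is
independent of `Q_∞`, which is taken under the limit law. -/
def invSqConst (b : ℕ) (ρ : Measure ℝ) : ℝ :=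
  ((b : ℝ) - 1) / 2 *
    ∫ y, (∫ x, psi b ρ (x + qInf b y / b) ∂ρ) ^ 2 ∂(cond (limitLaw b ρ) {y | 1 ≤ qInf b y})

/-- The constant `c_ρ`, given by `1 / c_ρ ^ 2 = invSqConst b ρ` and `c_ρ > 0`. -/
def cConst (b : ℕ) (ρ : Measure ℝ) : ℝ := (√(invSqConst b ρ))⁻¹

end Avalanche

end

namespace Avalanche

/-! ### Translations of an absolutely continuous law -/

/-! The values along one branch form a Markov chain, and survival is governed by its transition
operator `T` killed below one (`step`). Capping the argument at some `M ≥ 2` changes nothing for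
starting values up to `M`, because `1 + M / 2 ≤ M`, and it makes the state space compact. Absolute
continuity of `ρ` makes `T` smoothing: the images of all functions bounded by one share a modulus of
continuity (`exists_step_modulus`).

From this comes a Perron–Frobenius theorem. Normalised sums of `z ^ (-n) Tⁿ 1` are almost invariant
and, by Arzelà–Ascoli, have a limit `φ` with `T φ = z φ` (`exists_isEigen`). A last-zero argument
gives `φ > 0` on `[1, ∞)` (`IsEigen.one_pos`). Two paths driven by the same increments approach each
other by the factor `b` per step, so a fixed number of steps contracts the enclosure of a function
between multiples of `φ` (`IsEigen.exists_contraction`). Hence `z ^ (-n) Tⁿ f → ℓ(f) φ`, uniformly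
over starting points and over functions bounded by one that vanish below one (`HasGap`), and `ℓ` is
a positive functional with `ℓ(T f) = z ℓ(f)`, given by a finite measure.

All objects of the statement are read off from `φ` and `ℓ`: the rate is `z`, `ψ = ℓ(1) φ` with `1`
the indicator of `[1, ∞)`, the conditioned reversed paths converge because reversal turns them into
paths of the chain, and the law of `Q_∞` is one free step from the normalised left eigenmeasure
(`HasGap.map_qInf`). This gives `1 / c² = (b - 1) / 2 · z² ℓ(1) ℓ(φ²)` (`HasGap.invSqConst_eq`).

For the hitting probability, independence of the `b` subtrees gives, for `θ ≥ 1`, the equation `F =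
1 - (1 - l)(1 - u) ^ b`, where `u = l (1 - T 1) + T F` (`isHit_hit`). Expanding, `F = l + b u - b (b
- 1) / 2 · u² + ⋯`. When `z = 1 / b`, applying `ℓ` cancels the terms linear in `F`, so `l` is
balanced against `ℓ(u²)`. This yields first `F = O(√l)` (`HasGap.exists_isHit_le`); then the
spectral gap gives `F ≈ ℓ(F) φ` (`HasGap.exists_isHit_sub_le`); finally, inserting `u ≈ ℓ(F) φ / b`
in the balance determines the limit of `ℓ(F) / √l` (`HasGap.tendsto_limFunctional_isHit`). -/

theorem tendsto_integral_abs_sub_translate {r : ℝ → ℝ} (hr : Integrable r) :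
    Tendsto (fun h : ℝ => ∫ x, |r (x - h) - r x|) (𝓝 0) (𝓝 0) := by
  set g : ℝ → C(ℝ, ℝ) := fun h => ⟨fun x => x - h, by fun_prop⟩ with hg
  have hgc : Continuous g := by
    apply ContinuousMap.continuous_of_continuous_uncurry
    change Continuous fun p : ℝ × ℝ => p.2 - p.1
    fun_prop
  have hgm : ∀ h, MeasurePreserving (g h) volume volume := fun h =>
    measurePreserving_sub_right volume h
  set F : Lp ℝ 1 (volume : Measure ℝ) := hr.toL1 r
  have hF : ∀ h, ⇑(Lp.compMeasurePreserving (g h) (hgm h) F) =ᵐ[volume] fun x => r (x - h) := by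
    intro h
    refine (Lp.coeFn_compMeasurePreserving F (hgm h)).trans ?_
    exact (hgm h).quasiMeasurePreserving.ae_eq_comp (Integrable.coeFn_toL1 hr)
  have hc : Continuous fun h => Lp.compMeasurePreserving (g h) (hgm h) F :=
    Continuous.compMeasurePreservingLp continuous_const hgc hgm (by simp)
  have h0 : Tendsto (fun h => ‖Lp.compMeasurePreserving (g h) (hgm h) F -
      Lp.compMeasurePreserving (g 0) (hgm 0) F‖) (𝓝 0) (𝓝 0) := by
    have := ((hc.sub continuous_const).norm.tendsto 0 :
      Tendsto (fun h => ‖Lp.compMeasurePreserving (g h) (hgm h) F -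
      Lp.compMeasurePreserving (g 0) (hgm 0) F‖) (𝓝 0) _)
    simpa using this
  refine h0.congr fun h => ?_
  rw [L1.norm_eq_integral_norm]
  apply integral_congr_ae
  filter_upwards [Lp.coeFn_sub (Lp.compMeasurePreserving (g h) (hgm h) F)
      (Lp.compMeasurePreserving (g 0) (hgm 0) F), hF h, hF 0] with x h1 h2 h3
  rw [h1, Pi.sub_apply, h2, h3, Real.norm_eq_abs, sub_zero]

/-- Moving the shift from `f` to the density of `ρ` leaves only the supremum of `f` in the bound.
The uniformity over `f` is what makes the killed operator compact. -/
theorem exists_translate_modulus (ρ : Measure ℝ) [IsProbabilityMeasure ρ] (hac : ρ ≪ volume)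
    {ε : ℝ} (hε : 0 < ε) :
    ∃ δ > 0, ∀ s t : ℝ, |s - t| ≤ δ → ∀ (f : ℝ → ℝ) (C : ℝ), Measurable f → (∀ x, |f x| ≤ C) →
      |∫ x, f (x + s) ∂ρ - ∫ x, f (x + t) ∂ρ| ≤ C * ε := by
  set r : ℝ → ℝ := fun x => (ρ.rnDeriv volume x).toReal with hr_def
  have hr : Integrable r := Measure.integrable_toReal_rnDeriv
  obtain ⟨δ, hδ, h⟩ := Metric.eventually_nhds_iff.1
    ((tendsto_integral_abs_sub_translate hr).eventually (gt_mem_nhds hε))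
  refine ⟨δ / 2, by positivity, fun s t hst f C hf hC => ?_⟩
  have key : ∀ s, ∫ x, f (x + s) ∂ρ = ∫ x, r (x - s) * f x := by
    intro s
    rw [← integral_rnDeriv_smul hac, ← integral_sub_right_eq_self _ s]
    simp [hr_def]
  have hint : ∀ s, Integrable fun x => r (x - s) := fun s => hr.comp_sub_right s
  have hint' : ∀ s, Integrable fun x => r (x - s) * f x := fun s =>
    (hint s).mul_bdd (c := C) hf.aestronglyMeasurable (ae_of_all _ fun x => by simpa using hC x)
  rw [key, key, ← integral_sub (hint' s) (hint' t)]
  have hδ' := (h (y := s - t) (by rw [Real.dist_eq, sub_zero]; linarith)).le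
  have hC0 : 0 ≤ C := (abs_nonneg _).trans (hC 0)
  calc |∫ x, (r (x - s) * f x - r (x - t) * f x)|
      ≤ ∫ x, |r (x - s) * f x - r (x - t) * f x| := abs_integral_le_integral_abs
    _ ≤ ∫ x, C * |r (x - s) - r (x - t)| := by
        refine integral_mono ((hint' s).sub (hint' t)).abs
          (((hint s).sub (hint t)).abs.const_mul C) fun x => ?_
        simp only
        rw [← sub_mul, abs_mul, mul_comm]
        exact mul_le_mul_of_nonneg_right (hC x) (abs_nonneg _)
    _ = C * ∫ x, |r (x - (s - t)) - r x| := by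
        rw [integral_const_mul]
        congr 1
        rw [← integral_sub_right_eq_self (fun x => |r (x - (s - t)) - r x|) t]
        congr 1; ext x; congr 2; ring_nf
    _ ≤ C * ε := mul_le_mul_of_nonneg_left hδ' hC0

/-! ### The killed transition operator -/

/-- The transition operator of the path values, killed below one. The argument is capped at `M`,
which has no effect on `[1, M]`. -/
noncomputable def step (b : ℕ) (ρ : Measure ℝ) (M : ℝ) (f : ℝ → ℝ) (θ : ℝ) : ℝ :=
  if 1 ≤ θ then ∫ x, f (x + min θ M / b) ∂ρ else 0

/-- The indicator function of `[1, ∞)`. -/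
noncomputable def alive (θ : ℝ) : ℝ := if 1 ≤ θ then 1 else 0

/-- Measurable functions with absolute value at most `C`. -/
structure IsBdd (C : ℝ) (f : ℝ → ℝ) : Prop where
  meas : Measurable f
  bdd : ∀ x, |f x| ≤ C

theorem IsBdd.nonneg {C : ℝ} {f : ℝ → ℝ} (hf : IsBdd C f) : 0 ≤ C :=
  (abs_nonneg _).trans (hf.bdd 0)

theorem IsBdd.add {C D : ℝ} {f g : ℝ → ℝ} (hf : IsBdd C f) (hg : IsBdd D g) :
    IsBdd (C + D) (fun x => f x + g x) :=
  ⟨hf.meas.add hg.meas, fun x => (abs_add_le _ _).trans (add_le_add (hf.bdd x) (hg.bdd x))⟩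

theorem IsBdd.const_mul {C : ℝ} {f : ℝ → ℝ} (hf : IsBdd C f) (a : ℝ) :
    IsBdd (|a| * C) (fun x => a * f x) :=
  ⟨hf.meas.const_mul a, fun x => by
    rw [abs_mul]; exact mul_le_mul_of_nonneg_left (hf.bdd x) (abs_nonneg _)⟩

theorem IsBdd.sub {C D : ℝ} {f g : ℝ → ℝ} (hf : IsBdd C f) (hg : IsBdd D g) :
    IsBdd (C + D) (fun x => f x - g x) :=
  ⟨hf.meas.sub hg.meas, fun x => (abs_sub _ _).trans (add_le_add (hf.bdd x) (hg.bdd x))⟩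

theorem measurable_alive : Measurable alive :=
  Measurable.ite measurableSet_Ici measurable_const measurable_const

theorem alive_nonneg (x : ℝ) : 0 ≤ alive x := by unfold alive; split_ifs <;> norm_num

theorem alive_le_one (x : ℝ) : alive x ≤ 1 := by unfold alive; split_ifs <;> norm_num

theorem alive_of_le {x : ℝ} (h : 1 ≤ x) : alive x = 1 := if_pos h

theorem alive_of_lt {x : ℝ} (h : x < 1) : alive x = 0 := if_neg h.not_ge

theorem isBdd_alive : IsBdd 1 alive :=
  ⟨measurable_alive, fun x => by rw [abs_of_nonneg (alive_nonneg x)]; exact alive_le_one x⟩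

section Step

variable {b : ℕ} {ρ : Measure ℝ} {M : ℝ}

theorem step_of_le {f : ℝ → ℝ} {θ : ℝ} (h : 1 ≤ θ) :
    step b ρ M f θ = ∫ x, f (x + min θ M / b) ∂ρ := if_pos h

theorem step_of_lt {f : ℝ → ℝ} {θ : ℝ} (h : θ < 1) : step b ρ M f θ = 0 := if_neg h.not_ge

theorem IsBdd.integrable [IsProbabilityMeasure ρ] {C : ℝ} {f : ℝ → ℝ} (hf : IsBdd C f) (s : ℝ) :
    Integrable (fun x => f (x + s)) ρ :=
  Integrable.of_bound (hf.meas.comp (measurable_id.add_const s)).aestronglyMeasurable C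
    (ae_of_all _ fun _ => hf.bdd _)

theorem measurable_step [IsProbabilityMeasure ρ] {f : ℝ → ℝ} (hf : Measurable f) :
    Measurable (step b ρ M f) := by
  refine Measurable.ite measurableSet_Ici ?_ measurable_const
  have h : Measurable fun p : ℝ × ℝ => f (p.2 + min p.1 M / b) := by fun_prop
  exact h.stronglyMeasurable.integral_prod_right'.measurable

theorem IsBdd.step [IsProbabilityMeasure ρ] {C : ℝ} {f : ℝ → ℝ} (hf : IsBdd C f) :
    IsBdd C (step b ρ M f) := by
  refine ⟨measurable_step hf.meas, fun θ => ?_⟩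
  rcases le_or_gt 1 θ with h | h
  · rw [step_of_le h]
    have := norm_integral_le_of_norm_le_const (μ := ρ) (f := fun x => f (x + min θ M / b)) (C := C)
      (ae_of_all _ fun _ => hf.bdd _)
    simpa using this
  · rw [step_of_lt h, abs_zero]; exact hf.nonneg

theorem step_mono [IsProbabilityMeasure ρ] {C D : ℝ} {f g : ℝ → ℝ} (hf : IsBdd C f)
    (hg : IsBdd D g) (h : ∀ x, f x ≤ g x) (θ : ℝ) : step b ρ M f θ ≤ step b ρ M g θ := by
  rcases le_or_gt 1 θ with h1 | h1
  · rw [step_of_le h1, step_of_le h1]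
    exact integral_mono (hf.integrable _) (hg.integrable _) fun x => h _
  · rw [step_of_lt h1, step_of_lt h1]

theorem step_nonneg {f : ℝ → ℝ} (h : ∀ x, 0 ≤ f x) (θ : ℝ) : 0 ≤ step b ρ M f θ := by
  unfold Avalanche.step
  split_ifs
  exacts [integral_nonneg fun x => h _, le_rfl]

theorem step_add [IsProbabilityMeasure ρ] {C D : ℝ} {f g : ℝ → ℝ} (hf : IsBdd C f)
    (hg : IsBdd D g) :
    step b ρ M (fun x => f x + g x) = fun θ => step b ρ M f θ + step b ρ M g θ := by
  ext θ
  unfold Avalanche.step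
  split_ifs
  · exact integral_add (hf.integrable _) (hg.integrable _)
  · simp

theorem step_sub [IsProbabilityMeasure ρ] {C D : ℝ} {f g : ℝ → ℝ} (hf : IsBdd C f)
    (hg : IsBdd D g) :
    step b ρ M (fun x => f x - g x) = fun θ => step b ρ M f θ - step b ρ M g θ := by
  ext θ
  unfold Avalanche.step
  split_ifs
  · exact integral_sub (hf.integrable _) (hg.integrable _)
  · simp

theorem step_const_mul (a : ℝ) (f : ℝ → ℝ) :
    step b ρ M (fun x => a * f x) = fun θ => a * step b ρ M f θ := by
  ext θ
  unfold Avalanche.step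
  split_ifs
  · exact integral_const_mul _ _
  · simp

theorem step_cap {f : ℝ → ℝ} {θ : ℝ} (hM : 1 ≤ M) (h : M ≤ θ) :
    step b ρ M f θ = step b ρ M f M := by
  rw [step_of_le (hM.trans h), step_of_le hM, min_eq_right h, min_self]

theorem step_monotone [IsProbabilityMeasure ρ] {C : ℝ} {f : ℝ → ℝ} (hf : IsBdd C f)
    (hm : Monotone f) (h0 : ∀ x, 0 ≤ f x) : Monotone (step b ρ M f) := by
  intro s t hst
  rcases le_or_gt 1 s with h1 | h1
  · rw [step_of_le h1, step_of_le (h1.trans hst)]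
    refine integral_mono (hf.integrable _) (hf.integrable _) fun x => hm ?_
    gcongr
  · rw [step_of_lt h1]; exact step_nonneg h0 t

theorem abs_min_sub_min_le (s t M : ℝ) : |min s M - min t M| ≤ |s - t| :=
  by simpa using abs_min_sub_min_le_max s M t M

/-- `step` maps bounded functions to functions with a common modulus of continuity on `[1, ∞)`. -/
theorem exists_step_modulus [IsProbabilityMeasure ρ] (hb : 1 < b) (hac : ρ ≪ volume) {ε : ℝ}
    (hε : 0 < ε) :
    ∃ δ > 0, ∀ s t : ℝ, 1 ≤ s → 1 ≤ t → |s - t| ≤ δ → ∀ (f : ℝ → ℝ) (C : ℝ), IsBdd C f →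
      |step b ρ M f s - step b ρ M f t| ≤ C * ε := by
  obtain ⟨δ, hδ, h⟩ := exists_translate_modulus ρ hac hε
  refine ⟨δ, hδ, fun s t hs ht hst f C hf => ?_⟩
  rw [step_of_le hs, step_of_le ht]
  refine h _ _ ?_ f C hf.meas hf.bdd
  have hb' : (1 : ℝ) ≤ b := by exact_mod_cast hb.le
  rw [← sub_div, abs_div, abs_of_pos (by linarith : (0 : ℝ) < b)]
  exact (div_le_self (abs_nonneg _) hb').trans ((abs_min_sub_min_le _ _ _).trans hst)

theorem step_continuousOn [IsProbabilityMeasure ρ] (hb : 1 < b) (hac : ρ ≪ volume) {C : ℝ}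
    {f : ℝ → ℝ} (hf : IsBdd C f) : ContinuousOn (step b ρ M f) (Set.Ici 1) := by
  rw [Metric.continuousOn_iff]
  intro s hs ε hε
  have hC := hf.nonneg
  obtain ⟨δ, hδ, h⟩ := exists_step_modulus (M := M) hb hac (ε := ε / (C + 1)) (by positivity)
  refine ⟨δ, hδ, fun t ht hst => ?_⟩
  refine (h t s ht hs hst.le f C hf).trans_lt ?_
  rw [mul_div_assoc', div_lt_iff₀ (by positivity)]
  nlinarith

/-! ### Iterates -/

theorem iterate_isBdd [IsProbabilityMeasure ρ] {C : ℝ} {f : ℝ → ℝ} (hf : IsBdd C f) (n : ℕ) :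
    IsBdd C ((step b ρ M)^[n] f) := by
  induction n with
  | zero => exact hf
  | succ n ih => rw [Function.iterate_succ_apply']; exact ih.step

theorem iterate_nonneg {f : ℝ → ℝ} (h : ∀ x, 0 ≤ f x) (n : ℕ) (θ : ℝ) :
    0 ≤ (step b ρ M)^[n] f θ := by
  induction n generalizing θ with
  | zero => exact h θ
  | succ n ih => rw [Function.iterate_succ_apply']; exact step_nonneg ih θ

theorem iterate_mono [IsProbabilityMeasure ρ] {C D : ℝ} {f g : ℝ → ℝ} (hf : IsBdd C f)
    (hg : IsBdd D g) (h : ∀ x, f x ≤ g x) (n : ℕ) (θ : ℝ) :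
    (step b ρ M)^[n] f θ ≤ (step b ρ M)^[n] g θ := by
  induction n generalizing θ with
  | zero => exact h θ
  | succ n ih =>
    rw [Function.iterate_succ_apply', Function.iterate_succ_apply']
    exact step_mono (iterate_isBdd hf n) (iterate_isBdd hg n) ih θ

theorem iterate_add [IsProbabilityMeasure ρ] {C D : ℝ} {f g : ℝ → ℝ} (hf : IsBdd C f)
    (hg : IsBdd D g) (n : ℕ) :
    (step b ρ M)^[n] (fun x => f x + g x) =
      fun θ => (step b ρ M)^[n] f θ + (step b ρ M)^[n] g θ := by
  induction n with
  | zero => rfl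
  | succ n ih =>
    simp only [Function.iterate_succ_apply', ih]
    exact step_add (iterate_isBdd hf n) (iterate_isBdd hg n)

theorem iterate_const_mul (a : ℝ) (f : ℝ → ℝ) (n : ℕ) :
    (step b ρ M)^[n] (fun x => a * f x) = fun θ => a * (step b ρ M)^[n] f θ := by
  induction n with
  | zero => rfl
  | succ n ih =>
    simp only [Function.iterate_succ_apply', ih]
    exact step_const_mul _ _

theorem iterate_sub [IsProbabilityMeasure ρ] {C D : ℝ} {f g : ℝ → ℝ} (hf : IsBdd C f)
    (hg : IsBdd D g) (n : ℕ) :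
    (step b ρ M)^[n] (fun x => f x - g x) =
      fun θ => (step b ρ M)^[n] f θ - (step b ρ M)^[n] g θ := by
  induction n with
  | zero => rfl
  | succ n ih =>
    simp only [Function.iterate_succ_apply', ih]
    exact step_sub (iterate_isBdd hf n) (iterate_isBdd hg n)

theorem iterate_of_lt {f : ℝ → ℝ} (h : ∀ x < 1, f x = 0) (n : ℕ) {θ : ℝ} (hθ : θ < 1) :
    (step b ρ M)^[n] f θ = 0 := by
  cases n with
  | zero => exact h θ hθ
  | succ n => rw [Function.iterate_succ_apply']; exact step_of_lt hθ

theorem iterate_cap {f : ℝ → ℝ} (h : ∀ x, M ≤ x → f x = f M) (hM : 1 ≤ M) (n : ℕ) {θ : ℝ}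
    (hθ : M ≤ θ) : (step b ρ M)^[n] f θ = (step b ρ M)^[n] f M := by
  cases n with
  | zero => exact h θ hθ
  | succ n => rw [Function.iterate_succ_apply']; exact step_cap hM hθ

theorem alive_monotone : Monotone alive := by
  intro s t hst
  rcases le_or_gt 1 s with h | h
  · rw [alive_of_le h, alive_of_le (h.trans hst)]
  · rw [alive_of_lt h]; exact alive_nonneg t

theorem alive_cap (hM : 1 ≤ M) {x : ℝ} (h : M ≤ x) : alive x = alive M := by
  rw [alive_of_le hM, alive_of_le (hM.trans h)]

theorem iterate_monotone [IsProbabilityMeasure ρ] {C : ℝ} {f : ℝ → ℝ} (hf : IsBdd C f)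
    (hm : Monotone f) (h0 : ∀ x, 0 ≤ f x) (n : ℕ) : Monotone ((step b ρ M)^[n] f) := by
  induction n with
  | zero => exact hm
  | succ n ih =>
    rw [Function.iterate_succ_apply']
    exact step_monotone (iterate_isBdd hf n) ih (iterate_nonneg h0 n)

end Step

/-! ### Growth of submultiplicative sequences -/

/-- Fekete's lemma for `log D`: the limit is an infimum, whence `z ^ n ≤ D n`, and the geometric
lower bound keeps it finite, whence `z > 0`. -/
theorem exists_rate_of_submultiplicative {D : ℕ → ℝ} {p : ℝ} (hp : 0 < p)
    (hD : ∀ n, p ^ n ≤ D n) (hsub : ∀ m n, D (m + n) ≤ D m * D n) :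
    ∃ z > 0, (∀ n, z ^ n ≤ D n) ∧ ∀ c > z, ∀ᶠ n in atTop, D n ≤ c ^ n := by
  have hpos : ∀ n, 0 < D n := fun n => (pow_pos hp n).trans_le (hD n)
  have hs : Subadditive fun n => Real.log (D n) := fun m n => by
    rw [← Real.log_mul (hpos m).ne' (hpos n).ne']
    exact Real.log_le_log (hpos _) (hsub m n)
  have hlow : ∀ n : ℕ, n ≠ 0 → Real.log p ≤ Real.log (D n) / n := fun n hn => by
    rw [le_div_iff₀ (by positivity), mul_comm, ← Real.log_pow]
    exact Real.log_le_log (by positivity) (hD n)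
  have hbdd : BddBelow (Set.range fun n : ℕ => Real.log (D n) / n) := by
    refine ⟨min (Real.log p) 0, ?_⟩
    rintro _ ⟨n, rfl⟩
    rcases eq_or_ne n 0 with rfl | hn
    · simp
    · exact (min_le_left _ _).trans (hlow n hn)
  refine ⟨Real.exp hs.lim, Real.exp_pos _, fun n => ?_, fun c hc => ?_⟩
  · rcases eq_or_ne n 0 with rfl | hn
    · simpa using hD 0
    · have := hs.lim_le_div hbdd hn
      rw [le_div_iff₀ (by positivity)] at this
      rw [← Real.exp_nat_mul, ← Real.exp_log (hpos n)]
      exact Real.exp_le_exp.2 (by linarith)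
  · have hc0 : 0 < c := (Real.exp_pos _).trans hc
    have h1 : hs.lim < Real.log c := (Real.lt_log_iff_exp_lt hc0).2 hc
    filter_upwards [(hs.tendsto_lim hbdd).eventually (gt_mem_nhds h1), eventually_gt_atTop 0]
      with n hn hn0
    rw [div_lt_iff₀ (by exact_mod_cast hn0)] at hn
    rw [← Real.exp_log (hpos n), ← Real.exp_log (pow_pos hc0 n), Real.log_pow]
    exact Real.exp_le_exp.2 (by linarith)

/-- A sequence that is at least one and grows subexponentially is infinitely often small in
comparison with its partial sums. -/
theorem exists_le_mul_sum {u : ℕ → ℝ} (h1 : ∀ n, 1 ≤ u n)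
    (hu : ∀ c > 1, ∀ᶠ n in atTop, u n ≤ c ^ n) {ε : ℝ} (hε : 0 < ε) (N₀ : ℕ) :
    ∃ N ≥ N₀, u (N + 1) ≤ ε * ∑ n ∈ Finset.range (N + 1), u n := by
  by_contra! hcon
  set S : ℕ → ℝ := fun N => ∑ n ∈ Finset.range (N + 1), u n with hS
  have hS1 : ∀ N, 1 ≤ S N := fun N =>
    (h1 0).trans (Finset.single_le_sum (f := u) (fun i _ => zero_le_one.trans (h1 i))
      (Finset.mem_range.2 N.succ_pos))
  -- If the claim failed from `N₀` on, every new term would multiply the partial sum by at least `1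
  -- + ε`. Then `u` itself would grow at the rate `1 + ε`, against the hypothesis with `c = 1 + ε /
  -- 2`.
  have hgrow : ∀ k, (1 + ε) ^ k ≤ S (N₀ + k) := by
    intro k
    induction k with
    | zero => simpa using hS1 N₀
    | succ k ih =>
      have h2 : S (N₀ + (k + 1)) = S (N₀ + k) + u (N₀ + k + 1) := Finset.sum_range_succ _ _
      have := hcon (N₀ + k) (by omega)
      rw [h2, pow_succ]
      have h3 : ε * (1 + ε) ^ k ≤ ε * S (N₀ + k) := mul_le_mul_of_nonneg_left ih hε.le
      change ε * S (N₀ + k) < _ at this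
      nlinarith
  have hlow : ∀ k, ε * (1 + ε) ^ k ≤ u (N₀ + k + 1) := fun k =>
    (mul_le_mul_of_nonneg_left (hgrow k) hε.le).trans (hcon (N₀ + k) (by omega)).le
  have hq : 1 < (1 + ε) / (1 + ε / 2) := by
    rw [lt_div_iff₀ (by positivity)]; linarith
  have hlim := tendsto_pow_atTop_atTop_of_one_lt hq
  have hev : ∀ᶠ k : ℕ in atTop, u (N₀ + k + 1) ≤ (1 + ε / 2) ^ (N₀ + k + 1) :=
    (tendsto_atTop_mono (fun k => by simp only [id]; omega) tendsto_id :
      Tendsto (fun k : ℕ => N₀ + k + 1) atTop atTop).eventually (hu _ (by linarith))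
  obtain ⟨k, hk1, hk2⟩ := (hev.and (hlim.eventually
    (eventually_gt_atTop ((1 + ε / 2) ^ (N₀ + 1) / ε)))).exists
  have h3 := (hlow k).trans hk1
  rw [div_pow, div_lt_div_iff₀ hε (by positivity), ← pow_add] at hk2
  rw [show N₀ + k + 1 = N₀ + 1 + k by ring] at h3
  linarith

/-! ### The principal eigenfunction -/

/-- A nonnegative increasing eigenfunction of `step`, normalised at `M`. -/
structure IsEigen (b : ℕ) (ρ : Measure ℝ) (M z : ℝ) (φ : ℝ → ℝ) : Prop where
  pos : 0 < z
  bdd : IsBdd 1 φ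
  mono : Monotone φ
  nonneg : ∀ θ, 0 ≤ φ θ
  dead : ∀ θ < 1, φ θ = 0
  top : ∀ θ, M ≤ θ → φ θ = 1
  eq : step b ρ M φ = fun θ => z * φ θ

section

variable {b : ℕ} {ρ : Measure ℝ} {M : ℝ}

/-- An increment of at least `1 - 1 / b` keeps a path alive whatever its current value in `[1, ∞)`;
the left side is the probability that all `n` increments are of this kind. -/
theorem pow_le_iterate_alive [IsProbabilityMeasure ρ] (hM : 1 ≤ M) (n : ℕ)
    {θ : ℝ} (hθ : 1 ≤ θ) :
    (ρ.real (Set.Icc (1 - 1 / (b : ℝ)) 1)) ^ n ≤ (step b ρ M)^[n] alive θ := by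
  induction n generalizing θ with
  | zero => simp [alive_of_le hθ]
  | succ n ih =>
    rw [Function.iterate_succ_apply', step_of_le hθ, pow_succ]
    set p := ρ.real (Set.Icc (1 - 1 / (b : ℝ)) 1)
    have : p ^ n * p = ∫ x, (Set.Icc (1 - 1 / (b : ℝ)) 1).indicator (fun _ => p ^ n) x ∂ρ := by
      rw [integral_indicator_const _ measurableSet_Icc, smul_eq_mul, mul_comm]
    rw [this]
    refine integral_mono ((integrable_const _).indicator measurableSet_Icc)
      ((iterate_isBdd isBdd_alive n).integrable _) fun x => ?_
    refine Set.indicator_apply_le' (fun hx => ih ?_) fun _ => iterate_nonneg alive_nonneg _ _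
    have h1 : 1 / (b : ℝ) ≤ min θ M / b := by
      gcongr; exact le_min hθ hM
    linarith [hx.1]

/-- Survival increases with the starting value and is constant above the cap, so `M` is the best
start. Restarting there at an intermediate time gives submultiplicativity. -/
theorem iterate_alive_le [IsProbabilityMeasure ρ] (hM : 1 ≤ M) (m : ℕ) (θ : ℝ) :
    (step b ρ M)^[m] alive θ ≤ (step b ρ M)^[m] alive M * alive θ := by
  rcases lt_or_ge θ 1 with h | h
  · rw [iterate_of_lt (fun x => alive_of_lt) m h, alive_of_lt h, mul_zero]
  · rw [alive_of_le h, mul_one]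
    rcases le_total θ M with h2 | h2
    · exact iterate_monotone isBdd_alive alive_monotone alive_nonneg m h2
    · rw [iterate_cap (fun x => alive_cap hM) hM m h2]

theorem iterate_alive_submul [IsProbabilityMeasure ρ] (hM : 1 ≤ M) (n m : ℕ) :
    (step b ρ M)^[n + m] alive M ≤ (step b ρ M)^[n] alive M * (step b ρ M)^[m] alive M := by
  rw [Function.iterate_add_apply]
  refine (iterate_mono (iterate_isBdd isBdd_alive m) (isBdd_alive.const_mul _)
    (iterate_alive_le hM m) n M).trans ?_
  rw [iterate_const_mul, mul_comm]

/-- The normalised weighted sums of the survival functions. -/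
noncomputable def ergSum (b : ℕ) (ρ : Measure ℝ) (M z : ℝ) (N : ℕ) (θ : ℝ) : ℝ :=
  ∑ n ∈ Finset.range (N + 1), (z ^ n)⁻¹ * (step b ρ M)^[n] alive θ

theorem exists_isBdd_ergSum [IsProbabilityMeasure ρ] (z : ℝ) (N : ℕ) :
    ∃ C, IsBdd C (ergSum b ρ M z N) := by
  induction N with
  | zero =>
    have : ergSum b ρ M z 0 = alive := by ext; simp [ergSum]
    exact ⟨1, this ▸ isBdd_alive⟩
  | succ N ih =>
    obtain ⟨C, hC⟩ := ih
    have := hC.add ((iterate_isBdd (b := b) (ρ := ρ) (M := M) isBdd_alive (N + 1)).const_mul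
      (z ^ (N + 1))⁻¹)
    have h : ergSum b ρ M z (N + 1) = fun θ => ergSum b ρ M z N θ +
        (z ^ (N + 1))⁻¹ * (step b ρ M)^[N + 1] alive θ := by
      ext θ; exact Finset.sum_range_succ _ (N + 1)
    rw [h]
    exact ⟨_, this⟩

/-- Telescoping: up to the factor `z`, the operator shifts the sum by one index, so the sum fails to
be an eigenfunction only through its first and last terms. -/
theorem step_ergSum [IsProbabilityMeasure ρ] {z : ℝ} (hz : 0 < z) (N : ℕ) (θ : ℝ) :
    step b ρ M (ergSum b ρ M z N) θ =
      z * (ergSum b ρ M z N θ - alive θ + (z ^ (N + 1))⁻¹ * (step b ρ M)^[N + 1] alive θ) := by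
  induction N with
  | zero =>
    have : ergSum b ρ M z 0 = alive := by ext; simp [ergSum]
    rw [this]
    simp [hz.ne']
  | succ N ih =>
    obtain ⟨C, hC⟩ := exists_isBdd_ergSum (b := b) (ρ := ρ) (M := M) z N
    have h1 : ergSum b ρ M z (N + 1) = fun θ => ergSum b ρ M z N θ +
        (z ^ (N + 1))⁻¹ * (step b ρ M)^[N + 1] alive θ := by
      ext θ; exact Finset.sum_range_succ _ (N + 1)
    rw [h1, step_add hC ((iterate_isBdd isBdd_alive (N + 1)).const_mul _), step_const_mul]
    simp only [ih]
    rw [← Function.iterate_succ_apply' (step b ρ M) (N + 1)]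
    field_simp
    ring

theorem ergSum_nonneg {z : ℝ} (hz : 0 < z) (N : ℕ) (θ : ℝ) : 0 ≤ ergSum b ρ M z N θ :=
  Finset.sum_nonneg fun n _ => mul_nonneg (by positivity) (iterate_nonneg alive_nonneg _ _)

theorem ergSum_monotone [IsProbabilityMeasure ρ] {z : ℝ} (hz : 0 < z) (N : ℕ) :
    Monotone (ergSum b ρ M z N) := fun _ _ h =>
  Finset.sum_le_sum fun n _ => mul_le_mul_of_nonneg_left
    (iterate_monotone isBdd_alive alive_monotone alive_nonneg n h) (by positivity)

theorem ergSum_cap (hM : 1 ≤ M) (z : ℝ) (N : ℕ) {θ : ℝ} (h : M ≤ θ) :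
    ergSum b ρ M z N θ = ergSum b ρ M z N M :=
  Finset.sum_congr rfl fun n _ => by rw [iterate_cap (fun x => alive_cap hM) hM n h]

theorem ergSum_of_lt (z : ℝ) (N : ℕ) {θ : ℝ} (h : θ < 1) : ergSum b ρ M z N θ = 0 :=
  Finset.sum_eq_zero fun n _ => by rw [iterate_of_lt (fun x => alive_of_lt) n h, mul_zero]

/-- Images under `step` of functions bounded by one have a uniformly convergent subsequence. -/
theorem exists_subseq_step [IsProbabilityMeasure ρ] (hb : 1 < b) (hac : ρ ≪ volume) (hM : 1 ≤ M)
    {g : ℕ → ℝ → ℝ} (hg : ∀ n, IsBdd 1 (g n)) :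
    ∃ σ : ℕ → ℕ, StrictMono σ ∧ ∃ h : ℝ → ℝ, ∀ ε > 0, ∀ᶠ j in atTop, ∀ θ,
      |step b ρ M (g (σ j)) θ - h θ| ≤ ε := by
  let K := Set.Icc (1 : ℝ) M
  have hK : ∀ θ : ℝ, 1 ≤ θ → min θ M ∈ K := fun θ h => ⟨le_min h hM, min_le_right _ _⟩
  have hc : ∀ n, Continuous fun x : K => step b ρ M (g n) x := fun n =>
    ((step_continuousOn hb hac (hg n)).mono fun x hx => hx.1).domRestrict
  let F : ℕ → BoundedContinuousFunction K ℝ := fun n =>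
    BoundedContinuousFunction.mkOfCompact ⟨_, hc n⟩
  have hcomp : IsCompact (closure (Set.range F)) := by
    refine BoundedContinuousFunction.arzela_ascoli (Set.Icc (-1) 1) isCompact_Icc _ ?_ ?_
    · rintro _ x ⟨n, rfl⟩
      exact abs_le.1 ((hg n).step.bdd x)
    · intro x
      rw [Metric.equicontinuousAt_iff]
      intro ε hε
      obtain ⟨δ, hδ, h⟩ := exists_step_modulus (M := M) hb hac (half_pos hε)
      refine ⟨δ, hδ, ?_⟩
      rintro y hy ⟨_, n, rfl⟩
      rw [dist_comm] at hy
      have := h x y x.2.1 y.2.1 (by simpa [Subtype.dist_eq, Real.dist_eq, abs_sub_comm] using hy.le)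
        (g n) 1 (hg n)
      rw [Real.dist_eq]
      exact (this.trans (by linarith [half_lt_self hε] : 1 * (ε / 2) ≤ ε / 2)).trans_lt
        (half_lt_self hε)
  obtain ⟨H, -, σ, hσ, hlim⟩ := hcomp.tendsto_subseq
    (fun n => subset_closure (Set.mem_range_self n) : ∀ n, F n ∈ closure (Set.range F))
  refine ⟨σ, hσ, fun θ => if h : 1 ≤ θ then H ⟨_, hK θ h⟩ else 0, fun ε hε => ?_⟩
  filter_upwards [(tendsto_iff_dist_tendsto_zero.1 hlim).eventually (gt_mem_nhds hε)] with j hj θ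
  by_cases h : 1 ≤ θ
  · have h1 : step b ρ M (g (σ j)) θ = F (σ j) ⟨_, hK θ h⟩ := by
      change _ = step b ρ M (g (σ j)) (min θ M)
      rcases le_total θ M with h2 | h2
      · rw [min_eq_left h2]
      · rw [min_eq_right h2, step_cap hM h2]
    rw [dif_pos h, h1, ← Real.dist_eq]
    exact (BoundedContinuousFunction.dist_coe_le_dist _).trans hj.le
  · rw [dif_neg h, step_of_lt (not_le.1 h)]
    simpa using hε.le

theorem abs_step_sub_le [IsProbabilityMeasure ρ] {C D ε : ℝ} {f g : ℝ → ℝ} (hf : IsBdd C f)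
    (hg : IsBdd D g) (h : ∀ x, |f x - g x| ≤ ε) (θ : ℝ) :
    |step b ρ M f θ - step b ρ M g θ| ≤ ε := by
  have h1 : IsBdd ε (fun x => f x - g x) := ⟨hf.meas.sub hg.meas, h⟩
  have := (h1.step (b := b) (ρ := ρ) (M := M)).bdd θ
  rwa [step_sub hf hg] at this

/-- The sums `ergSum`, normalised at `M`, are approximate eigenfunctions along indices where the
next term is small compared with the sum. Their images under the operator have a uniform limit by
compactness. The normalisation at `M` survives in the limit, so the eigenfunction is not zero. -/
theorem exists_isEigen [IsProbabilityMeasure ρ] (hb : 1 < b) (hac : ρ ≪ volume) (hM : 1 ≤ M)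
    (hp : 0 < ρ.real (Set.Icc (1 - 1 / (b : ℝ)) 1)) : ∃ z φ, IsEigen b ρ M z φ := by
  set D : ℕ → ℝ := fun n => (step b ρ M)^[n] alive M with hD
  obtain ⟨z, hz, hlow, hup⟩ : ∃ z > 0, (∀ n, z ^ n ≤ D n) ∧ ∀ c > z, ∀ᶠ n in atTop, D n ≤ c ^ n :=
    exists_rate_of_submultiplicative hp (fun n => pow_le_iterate_alive hM n hM)
      fun m n => iterate_alive_submul hM m n
  set u : ℕ → ℝ := fun n => (z ^ n)⁻¹ * D n with hu
  have hu1 : ∀ n, 1 ≤ u n := fun n => by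
    have := hlow n
    rw [hu]; simp only
    rw [inv_mul_eq_div, le_div_iff₀ (by positivity)]; linarith
  have hu2 : ∀ c > 1, ∀ᶠ n in atTop, u n ≤ c ^ n := fun c hc => by
    filter_upwards [hup (c * z) (by nlinarith)] with n hn
    rw [hu]; simp only
    rw [inv_mul_eq_div, div_le_iff₀ (by positivity), ← mul_pow]; exact hn
  have hex : ∀ j : ℕ, ∃ N ≥ j, u (N + 1) ≤ 1 / ((j : ℝ) + 1) * ∑ n ∈ Finset.range (N + 1), u n :=
    fun j => exists_le_mul_sum hu1 hu2 (by positivity) j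
  choose N hNj hN using hex
  set S : ℕ → ℝ := fun j => ergSum b ρ M z (N j) M with hS
  have hSu : ∀ j, S j = ∑ n ∈ Finset.range (N j + 1), u n := fun j => rfl
  -- Every term is at least one, so the sums tend to infinity and the first term of the telescoping
  -- error is negligible too.
  have hSj : ∀ j : ℕ, (j : ℝ) + 1 ≤ S j := fun j => by
    rw [hSu]
    have h1 : ((N j + 1 : ℕ) : ℝ) ≤ ∑ n ∈ Finset.range (N j + 1), u n := by
      simpa using Finset.card_nsmul_le_sum (Finset.range (N j + 1)) u 1 fun n _ => hu1 n
    have h2 : (j : ℝ) ≤ N j := by exact_mod_cast hNj j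
    push_cast at h1; linarith
  have hS0 : ∀ j, 0 < S j := fun j => lt_of_lt_of_le (by positivity) (hSj j)
  set g : ℕ → ℝ → ℝ := fun j θ => (S j)⁻¹ * ergSum b ρ M z (N j) θ with hg
  have hg0 : ∀ j θ, 0 ≤ g j θ := fun j θ =>
    mul_nonneg (inv_nonneg.2 (hS0 j).le) (ergSum_nonneg hz _ _)
  have hgm : ∀ j, Monotone (g j) := fun j _ _ h =>
    mul_le_mul_of_nonneg_left (ergSum_monotone hz _ h) (inv_nonneg.2 (hS0 j).le)
  have hgtop : ∀ j θ, M ≤ θ → g j θ = 1 := fun j θ h => by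
    simp only [hg]; rw [ergSum_cap hM z _ h, inv_mul_cancel₀ (hS0 j).ne']
  have hgb : ∀ j, IsBdd 1 (g j) := fun j => by
    refine ⟨(hgm j).measurable, fun θ => ?_⟩
    rw [abs_of_nonneg (hg0 j θ)]
    exact (hgm j (le_max_left θ M)).trans (hgtop j _ (le_max_right _ _)).le
  have happrox : ∀ j θ, |step b ρ M (g j) θ - z * g j θ| ≤ z * (2 / ((j : ℝ) + 1)) := by
    intro j θ
    simp only [hg]
    rw [step_const_mul]
    simp only
    rw [step_ergSum hz, show (S j)⁻¹ * (z * (ergSum b ρ M z (N j) θ - alive θ +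
      (z ^ (N j + 1))⁻¹ * (step b ρ M)^[N j + 1] alive θ)) - z * ((S j)⁻¹ * ergSum b ρ M z (N j) θ)
      = z * ((S j)⁻¹ * ((z ^ (N j + 1))⁻¹ * (step b ρ M)^[N j + 1] alive θ - alive θ)) by ring,
      abs_mul, abs_of_pos hz]
    refine mul_le_mul_of_nonneg_left ?_ hz.le
    rw [abs_mul, abs_of_pos (inv_pos.2 (hS0 j)), inv_mul_le_iff₀ (hS0 j)]
    have h1 : (z ^ (N j + 1))⁻¹ * (step b ρ M)^[N j + 1] alive θ ≤ u (N j + 1) := by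
      refine mul_le_mul_of_nonneg_left ?_ (by positivity)
      refine (iterate_alive_le hM _ θ).trans ?_
      exact mul_le_of_le_one_right (iterate_nonneg alive_nonneg _ _) (alive_le_one θ)
    have h2 : 0 ≤ (z ^ (N j + 1))⁻¹ * (step b ρ M)^[N j + 1] alive θ :=
      mul_nonneg (by positivity) (iterate_nonneg alive_nonneg _ _)
    have h3 := hN j
    rw [← hSu] at h3
    have h4 : 1 ≤ S j * (1 / ((j : ℝ) + 1)) := by
      rw [mul_one_div, le_div_iff₀ (by positivity)]; linarith [hSj j]
    have h5 : S j * (2 / ((j : ℝ) + 1)) = 2 * (S j * (1 / ((j : ℝ) + 1))) := by ring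
    rw [h5, abs_le]
    constructor <;> nlinarith [alive_nonneg θ, alive_le_one θ]
  obtain ⟨σ, hσ, h, hh⟩ := exists_subseq_step hb hac hM hgb
  set φ : ℝ → ℝ := fun θ => h θ / z with hφ
  -- Compactness gives convergence of the images only; since the images differ little from `z * g`,
  -- the functions themselves converge uniformly to `h / z`.
  have hlim1 : ∀ ε > 0, ∀ᶠ j in atTop, ∀ θ, |g (σ j) θ - φ θ| ≤ ε := by
    intro ε hε
    have h2 : Tendsto (fun j : ℕ => 2 / (((σ j : ℕ) : ℝ) + 1)) atTop (𝓝 0) :=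
      (tendsto_const_nhds.div_atTop (tendsto_atTop_add_const_right _ 1
        (tendsto_natCast_atTop_atTop (R := ℝ)))).comp hσ.tendsto_atTop
    filter_upwards [hh (z * (ε / 2)) (by positivity), h2.eventually (gt_mem_nhds (half_pos hε))]
      with j h3 h4 θ
    have h5 := happrox (σ j) θ
    have h6 := h3 θ
    have h7 : z * |g (σ j) θ - φ θ| ≤ z * ε := by
      rw [← abs_of_pos hz, ← abs_mul, abs_of_pos hz,
        show z * (g (σ j) θ - φ θ) = (step b ρ M (g (σ j)) θ - h θ) -
          (step b ρ M (g (σ j)) θ - z * g (σ j) θ) by rw [hφ]; field_simp; ring]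
      refine (abs_sub _ _).trans ?_
      nlinarith
    exact le_of_mul_le_mul_left h7 hz
  have hlim2 : ∀ θ, Tendsto (fun j => g (σ j) θ) atTop (𝓝 (φ θ)) := fun θ => by
    rw [Metric.tendsto_atTop']
    intro ε hε
    obtain ⟨J, hJ⟩ := eventually_atTop.1 (hlim1 (ε / 2) (half_pos hε))
    exact ⟨J, fun j hj => (hJ j hj.le θ).trans_lt (half_lt_self hε)⟩
  have hφb : IsBdd 1 φ := by
    refine ⟨measurable_of_tendsto_metrizable (fun j => (hgb (σ j)).meas)
      (tendsto_pi_nhds.2 hlim2), fun θ => ?_⟩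
    exact le_of_tendsto (hlim2 θ).abs (Eventually.of_forall fun j => (hgb (σ j)).bdd θ)
  refine ⟨z, φ, hz, hφb, fun s t hst => ?_, fun θ => ?_, fun θ hθ => ?_, fun θ hθ => ?_, ?_⟩
  · exact le_of_tendsto_of_tendsto' (hlim2 s) (hlim2 t) fun j => hgm _ hst
  · exact ge_of_tendsto' (hlim2 θ) fun j => hg0 _ _
  · refine tendsto_nhds_unique (hlim2 θ) ?_
    refine tendsto_const_nhds.congr fun j => ?_
    simp only [hg]; rw [ergSum_of_lt z _ hθ, mul_zero]
  · refine tendsto_nhds_unique (hlim2 θ) ?_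
    exact tendsto_const_nhds.congr fun j => (hgtop _ θ hθ).symm
  · ext θ
    rw [← sub_eq_zero, ← abs_eq_zero]
    refine le_antisymm (le_of_forall_pos_le_add fun ε hε => ?_) (abs_nonneg _)
    obtain ⟨j, hj1, hj2⟩ := ((hlim1 (ε / 2) (half_pos hε)).and (hh (ε / 2) (half_pos hε))).exists
    have h1 := abs_step_sub_le (b := b) (ρ := ρ) (M := M) (hgb (σ j)) hφb hj1 θ
    have h2 := hj2 θ
    have h3 : z * φ θ = h θ := by rw [hφ]; field_simp
    rw [h3, show step b ρ M φ θ - h θ = (step b ρ M (g (σ j)) θ - h θ) -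
      (step b ρ M (g (σ j)) θ - step b ρ M φ θ) by ring]
    refine (abs_sub _ _).trans ?_
    linarith

theorem IsEigen.continuousOn [IsProbabilityMeasure ρ] {z : ℝ} {φ : ℝ → ℝ}
    (h : IsEigen b ρ M z φ) (hb : 1 < b) (hac : ρ ≪ volume) : ContinuousOn φ (Set.Ici 1) := by
  have h1 : φ = fun θ => step b ρ M φ θ / z := by
    rw [h.eq]; ext θ; field_simp [h.pos.ne']
  rw [h1]
  exact (step_continuousOn hb hac h.bdd).div_const z

/-- The eigenfunction is positive on `[1, ∞)`. -/
theorem IsEigen.one_pos [IsProbabilityMeasure ρ] {z : ℝ} {φ : ℝ → ℝ}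
    (h : IsEigen b ρ M z φ) (hb : 1 < b) (hac : ρ ≪ volume) (hM : 1 ≤ M) : 0 < φ 1 := by
  by_contra hcon
  have h1 : φ 1 = 0 := le_antisymm (not_lt.1 hcon) (h.nonneg 1)
  have hb2 : (2 : ℝ) ≤ b := by exact_mod_cast hb
  have hbp : (0 : ℝ) < b := by linarith
  have hcont := (h.continuousOn hb hac).mono (fun x hx => hx.1 : Set.Icc 1 M ⊆ Set.Ici 1)
  have hcl : IsClosed (Set.Icc 1 M ∩ φ ⁻¹' {0}) :=
    hcont.preimage_isClosed_of_isClosed isClosed_Icc isClosed_singleton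
  have hcpt : IsCompact (Set.Icc 1 M ∩ φ ⁻¹' {0}) :=
    isCompact_Icc.of_isClosed_subset hcl Set.inter_subset_left
  -- `β` is the last zero of the eigenfunction; it lies below `M`, where the eigenfunction is one.
  obtain ⟨β, ⟨⟨hβ1, hβM⟩, hβ0⟩, hβ⟩ := hcpt.exists_isGreatest ⟨1, ⟨le_rfl, by linarith⟩, h1⟩
  have hβ0 : φ β = 0 := hβ0
  have hβM' : β < M := lt_of_le_of_ne hβM fun he => by
    have := h.top β he.ge
    rw [hβ0] at this; exact zero_ne_one this
  have hpos : ∀ t, β < t → 0 < φ t := fun t ht => by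
    by_contra hn
    have h2 : φ (min t M) = 0 := le_antisymm
      ((h.mono (min_le_left _ _)).trans (not_lt.1 hn)) (h.nonneg _)
    have h3 := hβ ⟨⟨le_min (hβ1.trans ht.le) (by linarith), min_le_right _ _⟩, h2⟩
    exact absurd h3 (not_le.2 (lt_min ht hβM'))
  -- The eigenvalue equation at `β` says that a nonnegative function has mean zero, so almost surely
  -- no step from `β` leads above `β`.
  have hae : ∀ᵐ x ∂ρ, x + β / b ≤ β := by
    have h2 : ∫ x, φ (x + β / b) ∂ρ = 0 := by
      have := congrFun h.eq β
      rw [step_of_le hβ1, min_eq_left hβM] at this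
      rw [this, hβ0, mul_zero]
    have h3 := (integral_eq_zero_iff_of_nonneg (fun x => h.nonneg _) (h.bdd.integrable _)).1 h2
    filter_upwards [h3] with x hx
    by_contra hn
    exact (hpos _ (not_le.1 hn)).ne' hx
  -- From `β + δ` a step ends at most at `β + δ / b`, and it ends above `β` only if its increment
  -- exceeds `β - β / b - δ`. The eigenvalue equation at `β + δ` then bounds `z` by the mass of such
  -- increments.
  have hz : ∀ δ ∈ Set.Ioc 0 (M - β), z ≤ ρ.real (Set.Ioi (β - β / b - δ)) := by
    intro δ hδ
    have hδ0 := hδ.1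
    have h2 := congrFun h.eq (β + δ)
    rw [step_of_le (by linarith), min_eq_left (by linarith [hδ.2])] at h2
    have h3 : ∫ x, φ (x + (β + δ) / b) ∂ρ ≤
        ∫ x, (Set.Ioi (β - β / b - δ)).indicator (fun _ => φ (β + δ)) x ∂ρ := by
      refine integral_mono_ae (h.bdd.integrable _)
        ((integrable_const _).indicator measurableSet_Ioi) ?_
      filter_upwards [hae] with x hx
      have hd : δ / b ≤ δ := div_le_self hδ0.le (by linarith)
      have hs : (β + δ) / b = β / b + δ / b := add_div _ _ _
      by_cases hxm : x ∈ Set.Ioi (β - β / b - δ)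
      · rw [Set.indicator_of_mem hxm]
        exact h.mono (by linarith)
      · rw [Set.indicator_of_notMem hxm]
        have : x ≤ β - β / b - δ := not_lt.1 hxm
        calc φ (x + (β + δ) / b) ≤ φ β := h.mono (by linarith)
          _ = 0 := hβ0
    rw [integral_indicator_const _ measurableSet_Ioi, smul_eq_mul, h2] at h3
    exact le_of_mul_le_mul_right h3 (hpos _ (by linarith))
  -- The endpoint has no mass since `ρ` has no atoms. Letting `δ` tend to zero gives `z ≤ 0`, a
  -- contradiction.
  have hna : ρ (Set.Ici (β - β / b)) = 0 := by
    have h2 : ρ (Set.Ioi (β - β / b)) = 0 := by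
      refine measure_mono_null (fun x hx => ?_) (ae_iff.1 hae)
      have : β - β / b < x := hx
      simp only [Set.mem_ofPred_eq, not_le]; linarith
    rw [← Set.Ioi_union_left]
    exact measure_union_null h2 (hac (by simp))
  have hlim : Tendsto (fun n : ℕ => ρ (Set.Ioi (β - β / b - (M - β) / ((n : ℝ) + 1)))) atTop
      (𝓝 (ρ (⋂ n : ℕ, Set.Ioi (β - β / b - (M - β) / ((n : ℝ) + 1))))) := by
    refine tendsto_measure_iInter_atTop (fun n => measurableSet_Ioi.nullMeasurableSet) ?_
      ⟨0, measure_ne_top _ _⟩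
    intro m n hmn
    refine Set.Ioi_subset_Ioi ?_
    have : (m : ℝ) ≤ n := by exact_mod_cast hmn
    have h3 : (0 : ℝ) ≤ M - β := by linarith
    have : (M - β) / ((n : ℝ) + 1) ≤ (M - β) / ((m : ℝ) + 1) := by gcongr
    linarith
  have hinter : (⋂ n : ℕ, Set.Ioi (β - β / b - (M - β) / ((n : ℝ) + 1))) ⊆
      Set.Ici (β - β / b) := by
    intro x hx
    have h3 : Tendsto (fun n : ℕ => β - β / b - (M - β) / ((n : ℝ) + 1)) atTop
        (𝓝 (β - β / b - 0)) := tendsto_const_nhds.sub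
      (tendsto_const_nhds.div_atTop (tendsto_atTop_add_const_right _ 1
        (tendsto_natCast_atTop_atTop (R := ℝ))))
    rw [sub_zero] at h3
    exact le_of_tendsto' h3 fun n => (Set.mem_iInter.1 hx n).le
  rw [measure_mono_null hinter hna] at hlim
  have hlim' := (ENNReal.tendsto_toReal ENNReal.zero_ne_top).comp hlim
  have := ge_of_tendsto' hlim' (b := z) fun n => hz _ ⟨by
    have : 0 < M - β := by linarith
    positivity, div_le_self (by linarith) (by linarith [(Nat.cast_nonneg n : (0 : ℝ) ≤ n)])⟩
  simp only [ENNReal.toReal_zero] at this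
  exact absurd this (not_le.2 h.pos)

end

/-! ### Contraction of the normalised iterates -/

section

variable {b : ℕ} {ρ : Measure ℝ} {M z : ℝ} {φ : ℝ → ℝ}

/-- Iterates of a function that loses at most `η` over distances `d` lose, over distances
`d * b ^ k`, at most `η` times the survival function. -/
theorem le_iterate_of_near [IsProbabilityMeasure ρ] (hb : 1 < b) {g : ℝ → ℝ}
    {C η d : ℝ} (hg : IsBdd C g) (h0 : ∀ x, 0 ≤ g x) (hdead : ∀ x < 1, g x = 0)
    (h : ∀ s t, 1 ≤ s → s ≤ t → t ≤ s + d → g s - η ≤ g t) (k : ℕ) {s t : ℝ} (hs : 1 ≤ s)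
    (hst : s ≤ t) (ht : t ≤ s + d * (b : ℝ) ^ k) :
    (step b ρ M)^[k] g s - η * (step b ρ M)^[k] alive s ≤ (step b ρ M)^[k] g t := by
  induction k generalizing s t with
  | zero => simpa [alive_of_le hs] using h s t hs hst (by simpa using ht)
  | succ k ih =>
    have hbp : (0 : ℝ) < b := by exact_mod_cast (zero_lt_one.trans hb)
    simp only [Function.iterate_succ_apply']
    rw [step_of_le hs, step_of_le hs, step_of_le (hs.trans hst), ← integral_const_mul,
      ← integral_sub ((iterate_isBdd hg k).integrable _)
        (((iterate_isBdd isBdd_alive k).integrable _).const_mul _)]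
    refine integral_mono (((iterate_isBdd hg k).integrable _).sub
        (((iterate_isBdd isBdd_alive k).integrable _).const_mul _))
        ((iterate_isBdd hg k).integrable _) fun x => ?_
    simp only
    -- Both paths use the same increment. If the lower one dies, nothing is lost because `g ≥ 0`, so
    -- the error carries the survival function of the lower path. Otherwise their distance has been
    -- divided by `b`, and the induction hypothesis applies.
    rcases lt_or_ge (x + min s M / b) 1 with hx | hx
    · rw [iterate_of_lt hdead k hx, iterate_of_lt (fun x => alive_of_lt) k hx, mul_zero, sub_zero]
      exact iterate_nonneg h0 _ _
    · refine ih hx (by gcongr) ?_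
      have h1 : min t M ≤ min s M + d * (b : ℝ) ^ (k + 1) := by
        have := le_abs_self (min t M - min s M)
        have h2 := abs_min_sub_min_le t s M
        rw [abs_of_nonneg (by linarith : 0 ≤ t - s)] at h2
        linarith
      have h2 : min t M / b ≤ (min s M + d * (b : ℝ) ^ (k + 1)) / b := by gcongr
      rw [add_div, pow_succ, ← mul_assoc, mul_div_assoc _ (b : ℝ) (b : ℝ), div_self hbp.ne',
        mul_one] at h2
      linarith

theorem IsEigen.iterate (h : IsEigen b ρ M z φ) (n : ℕ) :
    (step b ρ M)^[n] φ = fun θ => z ^ n * φ θ := by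
  induction n with
  | zero => simp
  | succ n ih =>
    rw [Function.iterate_succ_apply', ih, step_const_mul, h.eq]
    ext θ; ring

theorem IsEigen.le_one (h : IsEigen b ρ M z φ) (θ : ℝ) : φ θ ≤ 1 :=
  (le_abs_self _).trans (h.bdd.bdd θ)

theorem IsEigen.le_alive (h : IsEigen b ρ M z φ) (θ : ℝ) : φ θ ≤ alive θ := by
  rcases lt_or_ge θ 1 with h1 | h1
  · rw [h.dead θ h1]; exact alive_nonneg θ
  · rw [alive_of_le h1]; exact h.le_one θ

theorem IsEigen.one_mul_alive_le (h : IsEigen b ρ M z φ) (θ : ℝ) : φ 1 * alive θ ≤ φ θ := by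
  rcases lt_or_ge θ 1 with h1 | h1
  · rw [alive_of_lt h1, mul_zero]; exact h.nonneg θ
  · rw [alive_of_le h1, mul_one]; exact h.mono h1

theorem IsEigen.one_mul_iterate_alive_le [IsProbabilityMeasure ρ] (h : IsEigen b ρ M z φ) (n : ℕ)
    (θ : ℝ) : φ 1 * (step b ρ M)^[n] alive θ ≤ z ^ n * φ θ := by
  have := iterate_mono (b := b) (ρ := ρ) (M := M) (isBdd_alive.const_mul (φ 1)) h.bdd
    h.one_mul_alive_le n θ
  rwa [iterate_const_mul, h.iterate] at this

/-- One round of the contraction: the multiples of the eigenfunction that enclose a function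
approach one another. -/
theorem IsEigen.exists_contraction [IsProbabilityMeasure ρ] (h : IsEigen b ρ M z φ) (hb : 1 < b)
    (hac : ρ ≪ volume) (hM : 1 ≤ M) (h1 : 0 < φ 1) :
    ∃ m > 0, ∀ (f : ℝ → ℝ) (C a A : ℝ), IsBdd C f → (∀ x, a * φ x ≤ f x) →
      (∀ x, f x ≤ A * φ x) → ∃ a' A' : ℝ, A' - a' ≤ (1 - φ 1 / 2) * (A - a) ∧
        (∀ x, a' * φ x ≤ (z ^ m)⁻¹ * (step b ρ M)^[m] f x) ∧
        ∀ x, (z ^ m)⁻¹ * (step b ρ M)^[m] f x ≤ A' * φ x := by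
  have hz := h.pos
  have hb1 : (1 : ℝ) < b := by exact_mod_cast hb
  obtain ⟨δ, hδ, hmod⟩ := exists_step_modulus (b := b) (M := M) hb hac
    (ε := z * (φ 1 / 4)) (by positivity)
  -- With `δ * b ^ k > M - 1` any two points of `[1, M]` can be compared after `k + 1` steps, the
  -- first of which supplies the modulus of continuity.
  obtain ⟨k, hk⟩ := pow_unbounded_of_one_lt ((M - 1) / δ) hb1
  rw [div_lt_iff₀ hδ] at hk
  refine ⟨k + 1, k.succ_pos, fun f C a A hf ha hA => ?_⟩
  have hW : 0 ≤ A - a := by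
    have := (ha 1).trans (hA 1)
    nlinarith
  set W := A - a with hWdef
  set η := W * (φ 1 / 4) with hη
  -- For a nonnegative function below `W * φ`, the normalised iterate at `1`, less `η`, is a lower
  -- bound on all of `[1, ∞)`. Since `φ ≤ 1`, it is also a lower bound by a multiple of `φ`.
  have main : ∀ f' : ℝ → ℝ, Measurable f' → (∀ x, 0 ≤ f' x) → (∀ x, f' x ≤ W * φ x) →
      ∀ x, max ((z ^ (k + 1))⁻¹ * (step b ρ M)^[k + 1] f' 1 - η) 0 * φ x ≤
        (z ^ (k + 1))⁻¹ * (step b ρ M)^[k + 1] f' x := by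
    intro f' hfm hf0 hfW x
    have hfb : IsBdd W f' := ⟨hfm, fun y => by
      rw [abs_of_nonneg (hf0 y)]
      exact (hfW y).trans (mul_le_of_le_one_right hW (h.le_one y))⟩
    have hx0 : 0 ≤ (z ^ (k + 1))⁻¹ * (step b ρ M)^[k + 1] f' x :=
      mul_nonneg (by positivity) (iterate_nonneg hf0 _ _)
    rcases lt_or_ge x 1 with hx | hx
    · rw [h.dead x hx, mul_zero]; exact hx0
    refine (mul_le_of_le_one_right (le_max_right _ _) (h.le_one x)).trans (max_le ?_ hx0)
    have hcap : (step b ρ M)^[k + 1] f' x = (step b ρ M)^[k + 1] f' (min x M) := by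
      rcases le_total x M with hxM | hxM
      · rw [min_eq_left hxM]
      · rw [min_eq_right hxM, Function.iterate_succ_apply', step_cap hM hxM]
    have hx1 : 1 ≤ min x M := le_min hx hM
    have hlow := le_iterate_of_near (b := b) (ρ := ρ) (M := M) hb (d := δ) (η := z * η)
      (hfb.step (b := b) (ρ := ρ) (M := M))
      (step_nonneg hf0) (fun x hx => step_of_lt hx) (fun s t hs hst htd => by
        have := hmod s t hs (hs.trans hst) (by rw [abs_sub_comm, abs_of_nonneg] <;> linarith) f' W hfb
        have := le_abs_self (step b ρ M f' s - step b ρ M f' t)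
        rw [hη]; nlinarith) k le_rfl hx1
      (by linarith [min_le_right x M, mul_comm δ ((b : ℝ) ^ k)])
    rw [← Function.iterate_succ_apply, Nat.succ_eq_add_one, ← hcap] at hlow
    have hZ : (step b ρ M)^[k] alive 1 ≤ z ^ k := by
      have := h.one_mul_iterate_alive_le k 1
      rw [mul_comm (z ^ k)] at this
      exact le_of_mul_le_mul_left this h1
    have hη0 : 0 ≤ η := by positivity
    have h2 : (step b ρ M)^[k + 1] f' 1 - z ^ (k + 1) * η ≤ (step b ρ M)^[k + 1] f' x := by
      have : z * η * (step b ρ M)^[k] alive 1 ≤ z * η * z ^ k :=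
        mul_le_mul_of_nonneg_left hZ (by positivity)
      rw [pow_succ]; linarith
    calc _ = (z ^ (k + 1))⁻¹ * ((step b ρ M)^[k + 1] f' 1 - z ^ (k + 1) * η) := by
          field_simp
      _ ≤ _ := mul_le_mul_of_nonneg_left h2 (by positivity)
  have hφb : ∀ c : ℝ, IsBdd (|c| * 1) (fun x => c * φ x) := fun c => h.bdd.const_mul c
  -- The bound is applied to the gaps below and above `f`. Their normalised iterates at `1` add up
  -- to `W * φ 1`, so the two bounds together move by at least `W * φ 1 - 2 * η`, which is half of
  -- it.
  have e0 := main (fun x => f x - a * φ x) (hf.sub (hφb a)).meas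
    (fun x => by linarith [ha x]) (fun x => by rw [hWdef]; linarith [hA x])
  have e1 := main (fun x => A * φ x - f x) ((hφb A).sub hf).meas
    (fun x => by linarith [hA x]) (fun x => by rw [hWdef]; linarith [ha x])
  rw [iterate_sub hf (hφb a), iterate_const_mul, h.iterate] at e0
  rw [iterate_sub (hφb A) hf, iterate_const_mul, h.iterate] at e1
  have hzk : (z ^ (k + 1))⁻¹ * z ^ (k + 1) = 1 := inv_mul_cancel₀ (by positivity)
  have r0 : ∀ x, (z ^ (k + 1))⁻¹ * ((step b ρ M)^[k + 1] f x - a * (z ^ (k + 1) * φ x)) =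
      (z ^ (k + 1))⁻¹ * (step b ρ M)^[k + 1] f x - a * φ x := fun x => by
    field_simp
  have r1 : ∀ x, (z ^ (k + 1))⁻¹ * (A * (z ^ (k + 1) * φ x) - (step b ρ M)^[k + 1] f x) =
      A * φ x - (z ^ (k + 1))⁻¹ * (step b ρ M)^[k + 1] f x := fun x => by
    field_simp
  simp only [r0] at e0
  simp only [r1] at e1
  set c0 := (z ^ (k + 1))⁻¹ * (step b ρ M)^[k + 1] f 1 - a * φ 1 - η
  set c1 := A * φ 1 - (z ^ (k + 1))⁻¹ * (step b ρ M)^[k + 1] f 1 - η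
  refine ⟨a + max c0 0, A - max c1 0, ?_, fun x => ?_, fun x => ?_⟩
  · have h3 : c0 + c1 = W * φ 1 - 2 * η := by simp only [c0, c1, hWdef]; ring
    have h4 := le_max_left c0 0
    have h5 := le_max_left c1 0
    have : (1 - φ 1 / 2) * W = W - (W * φ 1 - 2 * η) := by rw [hη]; ring
    rw [this]; linarith
  · linarith [e0 x]
  · linarith [e1 x]

/-- The limit of the normalised iterates at `M`. -/
noncomputable def limFunctional (b : ℕ) (ρ : Measure ℝ) (M z : ℝ) (f : ℝ → ℝ) : ℝ :=
  limUnder atTop fun n : ℕ => (z ^ n)⁻¹ * (step b ρ M)^[n] f M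

/-- Normalised iterates converge to a multiple of the eigenfunction, with the speed `ε`. -/
structure HasGap (b : ℕ) (ρ : Measure ℝ) (M z : ℝ) (φ : ℝ → ℝ) (ε : ℕ → ℝ) : Prop where
  eigen : IsEigen b ρ M z φ
  one_pos : 0 < φ 1
  lim : Tendsto ε atTop (𝓝 0)
  conv : ∀ (f : ℝ → ℝ) (C : ℝ), IsBdd C f → (∀ x < 1, f x = 0) → ∀ n θ,
    |(z ^ n)⁻¹ * (step b ρ M)^[n] f θ - limFunctional b ρ M z f * φ θ| ≤ C * ε n

theorem IsEigen.iterate_le [IsProbabilityMeasure ρ] (h : IsEigen b ρ M z φ) {f : ℝ → ℝ} {C A : ℝ}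
    (hf : IsBdd C f) (hA : ∀ x, f x ≤ A * φ x) (n : ℕ) (x : ℝ) :
    (z ^ n)⁻¹ * (step b ρ M)^[n] f x ≤ A * φ x := by
  have := iterate_mono (b := b) (ρ := ρ) (M := M) hf (h.bdd.const_mul A) hA n x
  rw [iterate_const_mul, h.iterate] at this
  rw [inv_mul_le_iff₀ (pow_pos h.pos n)]
  linarith

theorem IsEigen.le_iterate [IsProbabilityMeasure ρ] (h : IsEigen b ρ M z φ) {f : ℝ → ℝ} {C a : ℝ}
    (hf : IsBdd C f) (ha : ∀ x, a * φ x ≤ f x) (n : ℕ) (x : ℝ) :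
    a * φ x ≤ (z ^ n)⁻¹ * (step b ρ M)^[n] f x := by
  have := iterate_mono (b := b) (ρ := ρ) (M := M) (h.bdd.const_mul a) hf ha n x
  rw [iterate_const_mul, h.iterate] at this
  rw [le_inv_mul_iff₀ (pow_pos h.pos n)]
  linarith

/-- Repeating the contraction gives nested enclosures of geometrically decreasing width; positivity
of the operator preserves them at the times in between. The first enclosure comes from `|f| ≤ C / φ
1 * φ`, so the speed depends on `f` only through `C`. -/
theorem IsEigen.exists_gap [IsProbabilityMeasure ρ] (h : IsEigen b ρ M z φ) (hb : 1 < b)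
    (hac : ρ ≪ volume) (hM : 1 ≤ M) (h1 : 0 < φ 1) : ∃ ε, HasGap b ρ M z φ ε := by
  obtain ⟨m, hm, hcontr⟩ := h.exists_contraction hb hac hM h1
  set r := 1 - φ 1 / 2 with hr
  have hφ1 := h.le_one 1
  have hr0 : 0 ≤ r := by linarith
  have hr1 : r < 1 := by linarith
  have hz := h.pos
  have hlimr : Tendsto (fun n : ℕ => r ^ (n / m)) atTop (𝓝 0) :=
    (tendsto_pow_atTop_nhds_zero_of_lt_one hr0 hr1).comp (Nat.tendsto_div_const_atTop hm.ne')
  refine ⟨fun n => 2 / φ 1 * r ^ (n / m), h, h1, by simpa using hlimr.const_mul (2 / φ 1), ?_⟩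
  intro f C hf hdead
  set K := C * (2 / φ 1) with hK
  have hC := hf.nonneg
  have hnest : ∀ j : ℕ, ∃ a A : ℝ, A - a ≤ r ^ j * K ∧
      (∀ x, a * φ x ≤ (z ^ (m * j))⁻¹ * (step b ρ M)^[m * j] f x) ∧
        ∀ x, (z ^ (m * j))⁻¹ * (step b ρ M)^[m * j] f x ≤ A * φ x := by
    intro j
    induction j with
    | zero =>
      have hle : ∀ x, |f x| ≤ C / φ 1 * φ x := fun x => by
        rcases lt_or_ge x 1 with hx | hx
        · rw [hdead x hx, h.dead x hx]; simp
        · refine (hf.bdd x).trans ?_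
          rw [div_mul_eq_mul_div, le_div_iff₀ h1]
          exact mul_le_mul_of_nonneg_left (h.mono hx) hC
      refine ⟨-(C / φ 1), C / φ 1, le_of_eq (by rw [hK]; ring), fun x => ?_, fun x => ?_⟩
      · simpa using (abs_le.1 (hle x)).1
      · simpa using (abs_le.1 (hle x)).2
    | succ j ih =>
      obtain ⟨a, A, haA, ha, hA⟩ := ih
      obtain ⟨a', A', h2, h3, h4⟩ := hcontr _ _ a A
        ((iterate_isBdd (b := b) (ρ := ρ) (M := M) hf (m * j)).const_mul (z ^ (m * j))⁻¹) ha hA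
      have e : ∀ x, (z ^ m)⁻¹ * (step b ρ M)^[m]
          (fun x => (z ^ (m * j))⁻¹ * (step b ρ M)^[m * j] f x) x =
          (z ^ (m * (j + 1)))⁻¹ * (step b ρ M)^[m * (j + 1)] f x := fun x => by
        rw [iterate_const_mul, mul_add, mul_one, add_comm (m * j) m,
          Function.iterate_add_apply _ m, pow_add, mul_inv]
        ring
      simp only [e] at h3 h4
      refine ⟨a', A', h2.trans ?_, h3, h4⟩
      rw [pow_succ']
      rw [mul_assoc]
      exact mul_le_mul_of_nonneg_left haA hr0
  choose a A haA ha hA using hnest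
  have hall : ∀ j n, m * j ≤ n → ∀ x, a j * φ x ≤ (z ^ n)⁻¹ * (step b ρ M)^[n] f x ∧
      (z ^ n)⁻¹ * (step b ρ M)^[n] f x ≤ A j * φ x := by
    intro j n hjn x
    obtain ⟨l, rfl⟩ := Nat.exists_eq_add_of_le hjn
    have e : (z ^ l)⁻¹ * (step b ρ M)^[l]
          (fun x => (z ^ (m * j))⁻¹ * (step b ρ M)^[m * j] f x) x =
          (z ^ (m * j + l))⁻¹ * (step b ρ M)^[m * j + l] f x := by
      rw [iterate_const_mul, add_comm (m * j) l, Function.iterate_add_apply _ l, pow_add, mul_inv]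
      ring
    have hbd := (iterate_isBdd (b := b) (ρ := ρ) (M := M) hf (m * j)).const_mul (z ^ (m * j))⁻¹
    rw [← e]
    exact ⟨h.le_iterate hbd (ha j) l x, h.iterate_le hbd (hA j) l x⟩
  have hK0 : 0 ≤ K := by positivity
  have hcauchy : CauchySeq fun n : ℕ => (z ^ n)⁻¹ * (step b ρ M)^[n] f M := by
    refine cauchySeq_of_le_tendsto_0 (fun N => r ^ (N / m) * K) (fun n n' N hn hn' => ?_)
      (by simpa using hlimr.mul_const K)
    have hN : m * (N / m) ≤ N := Nat.mul_div_le N m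
    have h2 := hall (N / m) n (hN.trans hn) M
    have h3 := hall (N / m) n' (hN.trans hn') M
    have h4 := haA (N / m)
    rw [h.top M le_rfl] at h2 h3
    rw [Real.dist_eq, abs_le]
    constructor <;> linarith [h2.1, h2.2, h3.1, h3.2]
  have hlim : Tendsto (fun n : ℕ => (z ^ n)⁻¹ * (step b ρ M)^[n] f M) atTop
      (𝓝 (limFunctional b ρ M z f)) := hcauchy.tendsto_limUnder
  intro n θ
  have hN : m * (n / m) ≤ n := Nat.mul_div_le n m
  have hL : a (n / m) ≤ limFunctional b ρ M z f ∧ limFunctional b ρ M z f ≤ A (n / m) := by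
    have hev : ∀ n' ≥ n, a (n / m) ≤ (z ^ n')⁻¹ * (step b ρ M)^[n'] f M ∧
        (z ^ n')⁻¹ * (step b ρ M)^[n'] f M ≤ A (n / m) := fun n' hn' => by
      simpa [h.top M le_rfl] using hall (n / m) n' (hN.trans hn') M
    exact ⟨ge_of_tendsto hlim (eventually_atTop.2 ⟨n, fun n' hn' => (hev n' hn').1⟩),
      le_of_tendsto hlim (eventually_atTop.2 ⟨n, fun n' hn' => (hev n' hn').2⟩)⟩
  have h2 := hall (n / m) n hN θ
  have h3 := haA (n / m)
  have h4 := h.nonneg θ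
  have h5 := h.le_one θ
  have h6 : (A (n / m) - a (n / m)) * φ θ ≤ r ^ (n / m) * K := by
    have : 0 ≤ A (n / m) - a (n / m) := by linarith [hL.1, hL.2]
    exact (mul_le_of_le_one_right this h5).trans h3
  have h7 : C * (2 / φ 1 * r ^ (n / m)) = r ^ (n / m) * K := by rw [hK]; ring
  rw [h7, abs_le]
  constructor <;> nlinarith [h2.1, h2.2, hL.1, hL.2]

theorem exists_hasGap [IsProbabilityMeasure ρ] (hb : 1 < b) (hac : ρ ≪ volume) (hM : 1 ≤ M)
    (hp : 0 < ρ.real (Set.Icc (1 - 1 / (b : ℝ)) 1)) : ∃ z φ ε, HasGap b ρ M z φ ε := by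
  obtain ⟨z, φ, h⟩ := exists_isEigen hb hac hM hp
  obtain ⟨ε, hε⟩ := h.exists_gap hb hac hM (h.one_pos hb hac hM)
  exact ⟨z, φ, ε, hε⟩

end

/-! ### Splitting off one coordinate of a product measure -/

/-- A family indexed by `Option α` from its value at `none` and its values elsewhere. -/
def optionCons {α E : Type*} (p : E × (α → E)) : Option α → E := fun o => o.elim p.1 p.2

theorem measurable_optionCons {α E : Type*} [MeasurableSpace E] :
    Measurable (optionCons : E × (α → E) → Option α → E) := by
  refine measurable_pi_iff.2 fun o => ?_
  cases o with
  | none => exact measurable_fst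
  | some a => exact (measurable_pi_apply a).comp measurable_snd

theorem measurePreserving_optionCons {α E : Type*} [MeasurableSpace E] (ν : Measure E)
    [IsProbabilityMeasure ν] :
    MeasurePreserving (optionCons : E × (α → E) → Option α → E)
      (ν.prod (Measure.infinitePi fun _ : α => ν)) (Measure.infinitePi fun _ : Option α => ν) := by
  classical
  refine ⟨measurable_optionCons, Measure.eq_infinitePi _ fun s t ht => ?_⟩
  have hpre : (optionCons : E × (α → E) → Option α → E) ⁻¹' (Set.pi s t) =
      (if none ∈ s then t none else Set.univ) ×ˢ
        Set.pi (Finset.eraseNone s : Finset α) fun a => t (some a) := by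
    ext p
    simp only [Set.mem_preimage, Set.mem_pi, Set.mem_prod, SetLike.mem_coe, Finset.mem_eraseNone]
    refine ⟨fun h => ⟨?_, fun a ha => h (some a) ha⟩, fun h o ho => ?_⟩
    · split_ifs with hs
      exacts [h none hs, trivial]
    · cases o with
      | none => simpa [ho, optionCons] using h.1
      | some a => exact h.2 a ho
  rw [Measure.map_apply measurable_optionCons (.pi s.countable_toSet fun _ _ => ht _), hpre,
    Measure.prod_prod, Measure.infinitePi_pi _ fun a _ => ht _]
  by_cases hs : none ∈ s
  · rw [if_pos hs, ← Finset.mul_prod_erase s _ hs]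
    congr 1
    rw [← Finset.map_some_eraseNone, Finset.prod_map]
    rfl
  · rw [if_neg hs, measure_univ, one_mul, ← Finset.erase_eq_of_notMem hs,
      ← Finset.map_some_eraseNone, Finset.prod_map]
    simp [Finset.erase_eq_of_notMem hs]

theorem measurePreserving_reindex {α ι E : Type*} [MeasurableSpace E] (ν : Measure E)
    [IsProbabilityMeasure ν] (e : α ≃ ι) :
    MeasurePreserving (fun (x : α → E) (i : ι) => x (e.symm i))
      (Measure.infinitePi fun _ : α => ν) (Measure.infinitePi fun _ : ι => ν) := by
  refine ⟨by fun_prop, ?_⟩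
  have := Measure.infinitePi_map_piCongrLeft (fun _ : ι => ν) e
  convert! this using 2
  ext x i
  obtain ⟨a, rfl⟩ := e.surjective i
  rw [MeasurableEquiv.coe_piCongrLeft, Equiv.piCongrLeft_apply_apply]
  simp

/-- The sequence that starts with `p.1` and continues with `p.2`. -/
def seqCons {E : Type*} (p : E × (ℕ → E)) : ℕ → E
  | 0 => p.1
  | n + 1 => p.2 n

theorem measurePreserving_seqCons {E : Type*} [MeasurableSpace E] (ν : Measure E)
    [IsProbabilityMeasure ν] :
    MeasurePreserving (seqCons : E × (ℕ → E) → ℕ → E)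
      (ν.prod (Measure.infinitePi fun _ : ℕ => ν)) (Measure.infinitePi fun _ : ℕ => ν) := by
  let e : Option ℕ ≃ ℕ :=
    { toFun := fun o => o.elim 0 Nat.succ
      invFun := fun n => Nat.casesOn n none some
      left_inv := fun o => by cases o <;> rfl
      right_inv := fun n => by cases n <;> rfl }
  convert! (measurePreserving_reindex ν e).comp (measurePreserving_optionCons ν) using 1
  ext p n
  cases n <;> rfl

/-! ### Survival along a path in terms of the operator -/

section

variable {b : ℕ} {ρ : Measure ℝ} {M : ℝ}

theorem pathQ_seqCons (θ : ℝ) (p : ℝ × (ℕ → ℝ)) (n : ℕ) :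
    pathQ b θ (seqCons p) (n + 1) = pathQ b (p.1 + θ / b) p.2 n := by
  induction n with
  | zero => rfl
  | succ n ih => rw [pathQ, ih]; rfl

theorem pathQ_add (θ : ℝ) (x : ℕ → ℝ) (m n : ℕ) :
    pathQ b θ x (m + n) = pathQ b (pathQ b θ x m) (fun i => x (m + i)) n := by
  induction n with
  | zero => rfl
  | succ n ih => rw [← add_assoc, pathQ, ih]; rfl

theorem measurable_pathQ (n : ℕ) : Measurable fun p : ℝ × (ℕ → ℝ) => pathQ b p.1 p.2 n := by
  induction n with
  | zero => exact measurable_fst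
  | succ n ih => simp only [pathQ]; fun_prop

theorem measurable_pathQ_right (θ : ℝ) (n : ℕ) : Measurable fun x : ℕ → ℝ => pathQ b θ x n :=
  (measurable_pathQ n).comp (measurable_const.prodMk measurable_id)

theorem measurableSet_alive (n : ℕ) :
    MeasurableSet {p : ℝ × (ℕ → ℝ) | ∀ j < n, 1 ≤ pathQ b p.1 p.2 j} := by
  simp only [Set.ofPred_forall]
  exact .iInter fun j => .iInter fun _ => measurableSet_le measurable_const (measurable_pathQ j)

open Classical in
/-- The Markov property: survival for `m` steps followed by a functional of the current value and
of the remaining path. -/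
theorem integral_alive_path [IsProbabilityMeasure ρ] (hb : 1 < b) (hM : 2 ≤ M)
    (h01 : ∀ᵐ x ∂ρ, x ∈ Set.Icc (0 : ℝ) 1) {G : ℝ × (ℕ → ℝ) → ℝ} {C : ℝ} (hG : Measurable G)
    (hC : ∀ p, |G p| ≤ C) (m : ℕ) {θ : ℝ} (hθ : θ ≤ M) :
    ∫ x, (if ∀ j < m, 1 ≤ pathQ b θ x j then G (pathQ b θ x m, fun i => x (m + i)) else 0)
        ∂(Measure.infinitePi fun _ : ℕ => ρ) =
      (step b ρ M)^[m] (fun q => ∫ y, G (q, y) ∂(Measure.infinitePi fun _ : ℕ => ρ)) θ := by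
  set P := Measure.infinitePi fun _ : ℕ => ρ
  have hC0 : 0 ≤ C := (abs_nonneg _).trans (hC (0, 0))
  have hmeas : ∀ m, Measurable fun p : ℝ × (ℕ → ℝ) => if ∀ j < m, 1 ≤ pathQ b p.1 p.2 j then
      G (pathQ b p.1 p.2 m, fun i => p.2 (m + i)) else 0 := fun m =>
    Measurable.ite (measurableSet_alive m) (hG.comp ((measurable_pathQ m).prodMk (by fun_prop)))
      measurable_const
  induction m generalizing θ with
  | zero => simp [pathQ]
  | succ m ih =>
    have hPmap : (ρ.prod P).map seqCons = P := (measurePreserving_seqCons ρ).map_eq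
    rw [Function.iterate_succ_apply']
    have hm1 : Measurable fun x : ℕ → ℝ => if ∀ j < m + 1, 1 ≤ pathQ b θ x j then
        G (pathQ b θ x (m + 1), fun i => x (m + 1 + i)) else 0 :=
      (hmeas (m + 1)).comp (measurable_const.prodMk measurable_id)
    conv_lhs => rw [← hPmap]
    rw [integral_map (measurePreserving_seqCons ρ).measurable.aemeasurable
      hm1.aestronglyMeasurable]
    have hsplit : ∀ p : ℝ × (ℕ → ℝ), (if ∀ j < m + 1, 1 ≤ pathQ b θ (seqCons p) j then
        G (pathQ b θ (seqCons p) (m + 1), fun i => seqCons p (m + 1 + i)) else 0) =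
        if 1 ≤ θ then (if ∀ j < m, 1 ≤ pathQ b (p.1 + θ / b) p.2 j then
          G (pathQ b (p.1 + θ / b) p.2 m, fun i => p.2 (m + i)) else 0) else 0 := by
      intro p
      have h1 : (∀ j < m + 1, 1 ≤ pathQ b θ (seqCons p) j) ↔
          1 ≤ θ ∧ ∀ j < m, 1 ≤ pathQ b (p.1 + θ / b) p.2 j := by
        refine ⟨fun h => ⟨h 0 m.succ_pos, fun j hj => ?_⟩, fun h j hj => ?_⟩
        · rw [← pathQ_seqCons]; exact h _ (by omega)
        · cases j with
          | zero => exact h.1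
          | succ j => rw [pathQ_seqCons]; exact h.2 j (by omega)
      have h2 : (fun i => seqCons p (m + 1 + i)) = fun i => p.2 (m + i) := by
        ext i; rw [show m + 1 + i = (m + i) + 1 by ring]; rfl
      rw [pathQ_seqCons, h2]
      simp only [h1]
      split_ifs <;> first | rfl | (exfalso; tauto)
    simp only [hsplit]
    by_cases h1 : 1 ≤ θ
    · simp only [h1, if_true]
      have hm' : Measurable fun p : ℝ × (ℕ → ℝ) =>
          (if ∀ j < m, 1 ≤ pathQ b (p.1 + θ / b) p.2 j then
            G (pathQ b (p.1 + θ / b) p.2 m, fun i => p.2 (m + i)) else 0) :=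
        (hmeas m).comp ((measurable_fst.add_const _).prodMk measurable_snd)
      rw [integral_prod _ (Integrable.of_bound hm'.aestronglyMeasurable C (ae_of_all _ fun p => by
        rw [Real.norm_eq_abs]
        split_ifs
        exacts [hC _, by simpa using hC0])), step_of_le h1, min_eq_left hθ]
      refine integral_congr_ae ?_
      filter_upwards [h01] with x hx
      -- The next value is at most `1 + M / 2 ≤ M`: for `M ≥ 2` the cap never acts on paths started
      -- below it.
      refine ih ?_
      have hb2 : (2 : ℝ) ≤ b := by exact_mod_cast hb
      have : θ / b ≤ M / 2 := by
        have : θ / b ≤ M / b := by gcongr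
        exact this.trans (by gcongr)
      linarith [hx.2]
    · simp [h1, step_of_lt (not_le.1 h1)]

open Classical in
theorem survival_eq [IsProbabilityMeasure ρ] (hb : 1 < b) (hM : 2 ≤ M)
    (h01 : ∀ᵐ x ∂ρ, x ∈ Set.Icc (0 : ℝ) 1) (n : ℕ) {θ : ℝ} (hθ : θ ≤ M) :
    survival b ρ n θ = (step b ρ M)^[n] alive θ := by
  have h := integral_alive_path (b := b) (ρ := ρ) hb hM h01 (G := fun p => alive p.1) (C := 1)
    (measurable_alive.comp measurable_fst) (fun p => isBdd_alive.bdd _) n hθ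
  simp only [integral_const, probReal_univ, one_smul] at h
  refine Eq.trans ?_ h
  have hs : MeasurableSet {x : ℕ → ℝ | ∀ k ≤ n, 1 ≤ pathQ b θ x k} := by
    simp only [Set.ofPred_forall]
    exact .iInter fun j => .iInter fun _ =>
      measurableSet_le measurable_const (measurable_pathQ_right θ j)
  rw [survival, ← integral_indicator_one hs]
  refine integral_congr_ae (ae_of_all _ fun x => ?_)
  simp only [Set.indicator_apply, Set.mem_ofPred_eq, Pi.one_apply, alive]
  have : (∀ k ≤ n, 1 ≤ pathQ b θ x k) ↔ (∀ k < n, 1 ≤ pathQ b θ x k) ∧ 1 ≤ pathQ b θ x n :=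
    ⟨fun h => ⟨fun k hk => h k hk.le, h n le_rfl⟩, fun h k hk => by
      rcases hk.lt_or_eq with hk | rfl
      exacts [h.1 k hk, h.2]⟩
  simp only [this]
  split_ifs <;> first | rfl | (exfalso; tauto)

/-! ### Reversed paths -/

/-- Reversal of the first `n` coordinates. -/
def revEquiv (n : ℕ) : ℕ ≃ ℕ where
  toFun i := if i < n then n - 1 - i else i
  invFun i := if i < n then n - 1 - i else i
  left_inv i := by dsimp only; split_ifs <;> omega
  right_inv i := by dsimp only; split_ifs <;> omega

theorem revQ_self (θ : ℝ) (n : ℕ) (y : ℕ → ℝ) : revQ b θ n n y = θ := by simp [revQ]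

theorem revQ_of_lt (hb : 1 < b) (θ : ℝ) {n k : ℕ} (hk : k < n) (y : ℕ → ℝ) :
    revQ b θ n k y = y k + revQ b θ n (k + 1) y / b := by
  have hbp : (b : ℝ) ≠ 0 := by positivity
  have h2 : n - k = (n - (k + 1)) + 1 := by omega
  rw [revQ, revQ, Finset.sum_eq_sum_Ico_succ_bot hk, add_div, Finset.sum_div, h2, pow_succ,
    ← div_div]
  simp only [Nat.sub_self, pow_zero, div_one]
  rw [add_assoc]
  congr 2
  refine Finset.sum_congr rfl fun j hj => ?_
  have := (Finset.mem_Ico.1 hj).1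
  rw [show j - k = (j - (k + 1)) + 1 by omega, pow_succ, div_div]

/-- Reversing the first `n` increments turns the reversed sum over the last `m` of them into the
value of the path at time `m`. This carries questions on the conditioned laws over to the Markov
chain. -/
theorem revQ_reverse (hb : 1 < b) (θ : ℝ) (n : ℕ) (x : ℕ → ℝ) {m : ℕ} (hm : m ≤ n) :
    revQ b θ n (n - m) (fun i => x ((revEquiv n).symm i)) = pathQ b θ x m := by
  induction m with
  | zero => rw [Nat.sub_zero, revQ_self]; rfl
  | succ m ih =>
    rw [revQ_of_lt hb θ (by omega), show n - (m + 1) + 1 = n - m by omega, ih (by omega), pathQ]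
    congr 2
    simp only [revEquiv, Equiv.coe_fn_symm_mk]
    rw [if_pos (by omega)]
    omega

/-- The condition starts at index `1`, so it concerns the path at times `1` to `n - 1`. Time `0` is
covered by `1 ≤ θ`, and the value at time `n` is free. -/
theorem revAlive_reverse (hb : 1 < b) {θ : ℝ} (h1 : 1 ≤ θ) {n : ℕ} {x : ℕ → ℝ} :
    (∀ j, 1 ≤ j → j < n → 1 ≤ revQ b θ n j (fun i => x ((revEquiv n).symm i))) ↔
      ∀ j < n, 1 ≤ pathQ b θ x j := by
  refine ⟨fun h j hj => ?_, fun h j hj1 hj2 => ?_⟩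
  · rcases Nat.eq_zero_or_pos j with rfl | hj0
    · exact h1
    · rw [← revQ_reverse hb θ n x hj.le]
      exact h _ (by omega) (by omega)
  · have := revQ_reverse hb θ n x (m := n - j) (by omega)
    rw [show n - (n - j) = j by omega] at this
    rw [this]
    exact h _ (by omega)

/-- The probability that a path started from `q` survives for `k` steps and that its last `k`
increments, in reversed order, are in `A`. -/
noncomputable def tailProb (b : ℕ) (ρ : Measure ℝ) (k : ℕ) (A : Set (Fin k → ℝ)) (q : ℝ) : ℝ :=
  (Measure.infinitePi fun _ : ℕ => ρ).real
    {y | (∀ j < k, 1 ≤ pathQ b q y j) ∧ (fun i : Fin k => y (k - 1 - i)) ∈ A}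

theorem measurableSet_tail {k : ℕ} {A : Set (Fin k → ℝ)} (hA : MeasurableSet A) :
    MeasurableSet {p : ℝ × (ℕ → ℝ) | (∀ j < k, 1 ≤ pathQ b p.1 p.2 j) ∧
      (fun i : Fin k => p.2 (k - 1 - i)) ∈ A} :=
  (measurableSet_alive k).inter
    (hA.preimage (f := fun p : ℝ × (ℕ → ℝ) => fun i : Fin k => p.2 (k - 1 - i)) (by fun_prop))

theorem isBdd_tailProb [IsProbabilityMeasure ρ] {k : ℕ} {A : Set (Fin k → ℝ)}
    (hA : MeasurableSet A) : IsBdd 1 (tailProb b ρ k A) := by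
  refine ⟨?_, fun q => ?_⟩
  · exact (measurable_measure_prodMk_left (ν := Measure.infinitePi fun _ : ℕ => ρ)
      (measurableSet_tail (b := b) hA)).ennreal_toReal
  · rw [tailProb, abs_of_nonneg measureReal_nonneg]
    exact measureReal_le_one

theorem tailProb_of_lt {k : ℕ} (hk : 0 < k) (A : Set (Fin k → ℝ)) {q : ℝ} (hq : q < 1) :
    tailProb b ρ k A q = 0 := by
  have : {y : ℕ → ℝ | (∀ j < k, 1 ≤ pathQ b q y j) ∧ (fun i : Fin k => y (k - 1 - i)) ∈ A} = ∅ := by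
    ext y
    simp only [Set.mem_ofPred_eq, Set.mem_empty_iff_false, iff_false, not_and]
    intro h
    exact absurd (h 0 hk) (not_le.2 hq)
  rw [tailProb, this, measureReal_empty]

theorem measurable_revQ (θ : ℝ) (n k : ℕ) : Measurable fun y : ℕ → ℝ => revQ b θ n k y := by
  unfold revQ; fun_prop

theorem measurableSet_revAlive (θ : ℝ) (n : ℕ) :
    MeasurableSet {y : ℕ → ℝ | ∀ k, 1 ≤ k → k < n → 1 ≤ revQ b θ n k y} := by
  simp only [Set.ofPred_forall]
  exact .iInter fun j => .iInter fun _ => .iInter fun _ =>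
    measurableSet_le measurable_const (measurable_revQ θ n j)

theorem measurableSet_cylinder {k : ℕ} {A : Set (Fin k → ℝ)} (hA : MeasurableSet A) :
    MeasurableSet {y : ℕ → ℝ | (fun i : Fin k => y i) ∈ A} :=
  hA.preimage (f := fun y : ℕ → ℝ => fun i : Fin k => y i) (by fun_prop)

open Classical in
-- After reversal the first `k` coordinates are the last `k` increments. The Markov property at time
-- `m` puts all dependence on `A` into a bounded function, to which the spectral gap applies as `m`
-- grows.
theorem revAlive_inter_cylinder [IsProbabilityMeasure ρ] (hb : 1 < b) (hM : 2 ≤ M)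
    (h01 : ∀ᵐ x ∂ρ, x ∈ Set.Icc (0 : ℝ) 1) (m : ℕ) {k : ℕ} (hk : 0 < k) {A : Set (Fin k → ℝ)}
    (hA : MeasurableSet A) {θ : ℝ} (h1 : 1 ≤ θ) (hθ : θ ≤ M) :
    (Measure.infinitePi fun _ : ℕ => ρ).real
        ({y | ∀ j, 1 ≤ j → j < m + k → 1 ≤ revQ b θ (m + k) j y} ∩
          {y | (fun i : Fin k => y i) ∈ A}) =
      (step b ρ M)^[m] (tailProb b ρ k A) θ := by
  set P := Measure.infinitePi fun _ : ℕ => ρ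
  have hmp := measurePreserving_reindex ρ (revEquiv (m + k))
  rw [← hmp.measureReal_preimage
    ((measurableSet_revAlive θ (m + k)).inter (measurableSet_cylinder hA)).nullMeasurableSet]
  have hset : (fun (x : ℕ → ℝ) (i : ℕ) => x ((revEquiv (m + k)).symm i)) ⁻¹'
      ({y | ∀ j, 1 ≤ j → j < m + k → 1 ≤ revQ b θ (m + k) j y} ∩
          {y | (fun i : Fin k => y i) ∈ A}) =
      {x | (∀ j < m, 1 ≤ pathQ b θ x j) ∧ (pathQ b θ x m, fun i => x (m + i)) ∈
        {p : ℝ × (ℕ → ℝ) | (∀ j < k, 1 ≤ pathQ b p.1 p.2 j) ∧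
          (fun i : Fin k => p.2 (k - 1 - i)) ∈ A}} := by
    ext x
    have e1 : (∀ j, 1 ≤ j → j < m + k →
        1 ≤ revQ b θ (m + k) j (fun i => x ((revEquiv (m + k)).symm i))) ↔
        (∀ j < m, 1 ≤ pathQ b θ x j) ∧
          ∀ j < k, 1 ≤ pathQ b (pathQ b θ x m) (fun i => x (m + i)) j := by
      rw [revAlive_reverse hb h1]
      refine ⟨fun h => ⟨fun j hj => h j (by omega), fun j hj => ?_⟩, fun h j hj => ?_⟩
      · rw [← pathQ_add]; exact h _ (by omega)
      · rcases lt_or_ge j m with hjm | hjm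
        · exact h.1 j hjm
        · obtain ⟨l, rfl⟩ := Nat.exists_eq_add_of_le hjm
          rw [pathQ_add]; exact h.2 l (by omega)
    have e3 : (fun i : Fin k => x ((revEquiv (m + k)).symm i)) =
        fun i : Fin k => x (m + (k - 1 - i)) := by
      ext i
      have := i.2
      simp only [revEquiv, Equiv.coe_fn_symm_mk]
      rw [if_pos (by omega)]
      congr 1; omega
    simp only [Set.mem_preimage, Set.mem_inter_iff, Set.mem_ofPred_eq, e1, e3, and_assoc]
  rw [hset]
  have hT := measurableSet_tail (b := b) hA
  have h := integral_alive_path (b := b) (ρ := ρ) hb hM h01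
    (G := Set.indicator {p : ℝ × (ℕ → ℝ) | (∀ j < k, 1 ≤ pathQ b p.1 p.2 j) ∧
      (fun i : Fin k => p.2 (k - 1 - i)) ∈ A} fun _ => 1) (C := 1)
    (measurable_const.indicator hT)
    (fun p => by rw [Set.indicator_apply]; split_ifs <;> simp) m hθ
  have hq : (fun q => ∫ y, Set.indicator {p : ℝ × (ℕ → ℝ) | (∀ j < k, 1 ≤ pathQ b p.1 p.2 j) ∧
      (fun i : Fin k => p.2 (k - 1 - i)) ∈ A} (fun _ => (1 : ℝ)) (q, y) ∂P) = tailProb b ρ k A := by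
    ext q
    exact integral_indicator_one (hT.preimage (measurable_prodMk_left (x := q)))
  rw [hq] at h
  rw [← h, ← integral_indicator_one]
  · refine integral_congr_ae (ae_of_all _ fun x => ?_)
    simp only [Set.indicator_apply]
    split_ifs <;> first | rfl | (exfalso; simp_all)
  · refine MeasurableSet.inter ?_ (hT.preimage ((measurable_pathQ_right θ m).prodMk (by fun_prop)))
    exact (measurableSet_alive m).preimage (f := fun x : ℕ → ℝ => (θ, x)) measurable_prodMk_left

end

/-! ### The limit functional -/

section

variable {b : ℕ} {ρ : Measure ℝ} {M z : ℝ} {φ : ℝ → ℝ} {ε : ℕ → ℝ}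

theorem HasGap.tendsto (H : HasGap b ρ M z φ ε) {f : ℝ → ℝ} {C : ℝ} (hf : IsBdd C f)
    (hd : ∀ x < 1, f x = 0) (θ : ℝ) :
    Tendsto (fun n : ℕ => (z ^ n)⁻¹ * (step b ρ M)^[n] f θ) atTop
      (𝓝 (limFunctional b ρ M z f * φ θ)) := by
  rw [tendsto_iff_norm_sub_tendsto_zero]
  refine squeeze_zero (fun _ => norm_nonneg _) (fun n => H.conv f C hf hd n θ) ?_
  simpa using H.lim.const_mul C

theorem HasGap.tendsto_top (H : HasGap b ρ M z φ ε) {f : ℝ → ℝ} {C : ℝ} (hf : IsBdd C f)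
    (hd : ∀ x < 1, f x = 0) :
    Tendsto (fun n : ℕ => (z ^ n)⁻¹ * (step b ρ M)^[n] f M) atTop
      (𝓝 (limFunctional b ρ M z f)) := by
  simpa [H.eigen.top M le_rfl] using H.tendsto hf hd M

theorem HasGap.limFunctional_add [IsProbabilityMeasure ρ] (H : HasGap b ρ M z φ ε) {f g : ℝ → ℝ}
    {C D : ℝ} (hf : IsBdd C f) (hd : ∀ x < 1, f x = 0) (hg : IsBdd D g) (hd' : ∀ x < 1, g x = 0) :
    limFunctional b ρ M z (fun x => f x + g x) =
      limFunctional b ρ M z f + limFunctional b ρ M z g := by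
  refine tendsto_nhds_unique (H.tendsto_top (hf.add hg) fun x hx => by simp [hd x hx, hd' x hx]) ?_
  refine ((H.tendsto_top hf hd).add (H.tendsto_top hg hd')).congr fun n => ?_
  rw [iterate_add hf hg, mul_add]

theorem HasGap.limFunctional_sub [IsProbabilityMeasure ρ] (H : HasGap b ρ M z φ ε) {f g : ℝ → ℝ}
    {C D : ℝ} (hf : IsBdd C f) (hd : ∀ x < 1, f x = 0) (hg : IsBdd D g) (hd' : ∀ x < 1, g x = 0) :
    limFunctional b ρ M z (fun x => f x - g x) =
      limFunctional b ρ M z f - limFunctional b ρ M z g := by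
  refine tendsto_nhds_unique (H.tendsto_top (hf.sub hg) fun x hx => by simp [hd x hx, hd' x hx]) ?_
  refine ((H.tendsto_top hf hd).sub (H.tendsto_top hg hd')).congr fun n => ?_
  rw [iterate_sub hf hg, mul_sub]

theorem HasGap.limFunctional_const_mul (H : HasGap b ρ M z φ ε) {f : ℝ → ℝ}
    {C : ℝ} (hf : IsBdd C f) (hd : ∀ x < 1, f x = 0) (a : ℝ) :
    limFunctional b ρ M z (fun x => a * f x) = a * limFunctional b ρ M z f := by
  refine tendsto_nhds_unique (H.tendsto_top (hf.const_mul a) fun x hx => by simp [hd x hx]) ?_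
  refine ((H.tendsto_top hf hd).const_mul a).congr fun n => ?_
  rw [iterate_const_mul]; ring

theorem HasGap.limFunctional_mono [IsProbabilityMeasure ρ] (H : HasGap b ρ M z φ ε) {f g : ℝ → ℝ}
    {C D : ℝ} (hf : IsBdd C f) (hd : ∀ x < 1, f x = 0) (hg : IsBdd D g) (hd' : ∀ x < 1, g x = 0)
    (h : ∀ x, f x ≤ g x) : limFunctional b ρ M z f ≤ limFunctional b ρ M z g :=
  le_of_tendsto_of_tendsto' (H.tendsto_top hf hd) (H.tendsto_top hg hd') fun n =>
    mul_le_mul_of_nonneg_left (iterate_mono hf hg h n M) (by have := H.eigen.pos; positivity)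

theorem HasGap.limFunctional_nonneg (H : HasGap b ρ M z φ ε) {f : ℝ → ℝ}
    {C : ℝ} (hf : IsBdd C f) (hd : ∀ x < 1, f x = 0) (h : ∀ x, 0 ≤ f x) :
    0 ≤ limFunctional b ρ M z f :=
  ge_of_tendsto' (H.tendsto_top hf hd) fun n =>
    mul_nonneg (by have := H.eigen.pos; positivity) (iterate_nonneg h n M)

/-- The same limit read one step later: the functional is a left eigenvector. -/
theorem HasGap.limFunctional_step [IsProbabilityMeasure ρ] (H : HasGap b ρ M z φ ε) {f : ℝ → ℝ}
    {C : ℝ} (hf : IsBdd C f) (hd : ∀ x < 1, f x = 0) :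
    limFunctional b ρ M z (step b ρ M f) = z * limFunctional b ρ M z f := by
  refine tendsto_nhds_unique (H.tendsto_top hf.step fun x hx => step_of_lt hx) ?_
  refine (((H.tendsto_top hf hd).comp (tendsto_add_atTop_nat 1)).const_mul z).congr fun n => ?_
  have := H.eigen.pos
  simp only [Function.comp_apply]
  rw [Function.iterate_succ_apply, pow_succ]
  field_simp

theorem HasGap.limFunctional_eigen (H : HasGap b ρ M z φ ε) : limFunctional b ρ M z φ = 1 := by
  refine tendsto_nhds_unique (H.tendsto_top H.eigen.bdd H.eigen.dead) ?_
  refine tendsto_const_nhds.congr fun n => ?_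
  simp only [H.eigen.iterate]
  rw [H.eigen.top M le_rfl, mul_one, inv_mul_cancel₀ (pow_pos H.eigen.pos n).ne']

theorem HasGap.one_le_limFunctional_alive [IsProbabilityMeasure ρ] (H : HasGap b ρ M z φ ε) :
    1 ≤ limFunctional b ρ M z alive := by
  rw [← H.limFunctional_eigen]
  exact H.limFunctional_mono H.eigen.bdd H.eigen.dead isBdd_alive (fun _ => alive_of_lt)
    H.eigen.le_alive

theorem HasGap.pos_of_le (H : HasGap b ρ M z φ ε) {θ : ℝ} (h : 1 ≤ θ) : 0 < φ θ :=
  H.one_pos.trans_le (H.eigen.mono h)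

/-! ### Rate and limit of the survival probabilities -/

theorem HasGap.tendsto_survival [IsProbabilityMeasure ρ] (H : HasGap b ρ M z φ ε) (hb : 1 < b)
    (hM : 2 ≤ M) (h01 : ∀ᵐ x ∂ρ, x ∈ Set.Icc (0 : ℝ) 1) {θ : ℝ} (hθ : θ ≤ M) :
    Tendsto (fun n : ℕ => survival b ρ n θ / z ^ n) atTop
      (𝓝 (limFunctional b ρ M z alive * φ θ)) := by
  refine (H.tendsto isBdd_alive (fun _ => alive_of_lt) θ).congr fun n => ?_
  rw [survival_eq hb hM h01 n hθ, div_eq_inv_mul]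

/-- The normalised survival probabilities have a positive limit for `θ ≥ 1`, and the `n`-th root of
a positive limit disappears. -/
theorem HasGap.tendsto_survival_root [IsProbabilityMeasure ρ] (H : HasGap b ρ M z φ ε) (hb : 1 < b)
    (hM : 2 ≤ M) (h01 : ∀ᵐ x ∂ρ, x ∈ Set.Icc (0 : ℝ) 1) {θ : ℝ} (h1 : 1 ≤ θ) (hθ : θ ≤ M) :
    Tendsto (fun n : ℕ => survival b ρ n θ ^ (1 / (n : ℝ))) atTop (𝓝 z) := by
  have hz := H.eigen.pos
  have hL : 0 < limFunctional b ρ M z alive * φ θ :=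
    mul_pos (by linarith [H.one_le_limFunctional_alive]) (H.pos_of_le h1)
  have h2 := (H.tendsto_survival hb hM h01 hθ).rpow tendsto_one_div_atTop_nhds_zero_nat
    (Or.inl hL.ne')
  rw [Real.rpow_zero] at h2
  have h3 := h2.const_mul z
  rw [mul_one] at h3
  refine h3.congr' ?_
  filter_upwards [eventually_gt_atTop 0] with n hn
  have hn' : (n : ℝ) ≠ 0 := by exact_mod_cast hn.ne'
  have hs0 : 0 ≤ survival b ρ n θ := measureReal_nonneg
  rw [Real.div_rpow hs0 (pow_pos hz n).le, ← Real.rpow_natCast z n,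
    ← Real.rpow_mul hz.le, mul_one_div_cancel hn', Real.rpow_one]
  field_simp

/-- This identifies the eigenvalue with an object free of the cap, so all caps `M ≥ 2` share the
same eigenvalue. -/
theorem HasGap.rate_eq [IsProbabilityMeasure ρ] (H : HasGap b ρ M z φ ε) (hb : 1 < b)
    (hM : 2 ≤ M) (h01 : ∀ᵐ x ∂ρ, x ∈ Set.Icc (0 : ℝ) 1) : rate b ρ = z :=
  (H.tendsto_survival_root hb hM h01 le_rfl (by linarith)).limUnder_eq

theorem HasGap.psi_eq [IsProbabilityMeasure ρ] (H : HasGap b ρ M z φ ε) (hb : 1 < b)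
    (hM : 2 ≤ M) (h01 : ∀ᵐ x ∂ρ, x ∈ Set.Icc (0 : ℝ) 1) {θ : ℝ} (hθ : θ ≤ M) :
    psi b ρ θ = limFunctional b ρ M z alive * φ θ := by
  rw [psi, H.rate_eq hb hM h01]
  exact (H.tendsto_survival hb hM h01 hθ).limUnder_eq

end

/-! ### Setwise uniform limits of measures -/

/-- Finite additivity passes to any setwise limit. Uniformity over sets also lets countable
additivity pass: one `ν n` approximates all the partial unions and the whole union simultaneously.
-/
theorem exists_measure_of_uniform_limit {X : Type*} [MeasurableSpace X] {ν : ℕ → Measure X}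
    [∀ n, IsFiniteMeasure (ν n)] {c : Set X → ℝ} {ε : ℕ → ℝ} (hε : Tendsto ε atTop (𝓝 0))
    (h : ∀ n A, MeasurableSet A → |(ν n).real A - c A| ≤ ε n) :
    ∃ μ : Measure X, IsFiniteMeasure μ ∧ ∀ A, MeasurableSet A → μ.real A = c A := by
  have hlim : ∀ A, MeasurableSet A → Tendsto (fun n => (ν n).real A) atTop (𝓝 (c A)) := by
    intro A hA
    rw [tendsto_iff_norm_sub_tendsto_zero]
    exact squeeze_zero (fun _ => norm_nonneg _) (fun n => h n A hA) hε
  have h0 : ∀ A, MeasurableSet A → 0 ≤ c A := fun A hA =>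
    ge_of_tendsto' (hlim A hA) fun n => measureReal_nonneg
  have hsum : ∀ f : ℕ → Set X, (∀ i, MeasurableSet (f i)) → Pairwise (Function.onFun Disjoint f) →
      HasSum (fun i => c (f i)) (c (⋃ i, f i)) := by
    intro f hf hd
    rw [hasSum_iff_tendsto_nat_of_nonneg fun i => h0 _ (hf i)]
    have hU : MeasurableSet (⋃ i, f i) := .iUnion hf
    have hfin : ∀ N, ∑ i ∈ Finset.range N, c (f i) = c (⋃ i ∈ Finset.range N, f i) := by
      intro N
      refine tendsto_nhds_unique (tendsto_finsetSum _ fun i _ => hlim _ (hf i)) ?_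
      refine (hlim _ (Finset.measurableSet_biUnion _ fun i _ => hf i)).congr fun n => ?_
      exact measureReal_biUnion_finset (fun i _ j _ hij => hd hij) fun i _ => hf i
    simp only [hfin]
    rw [Metric.tendsto_atTop]
    intro e he
    obtain ⟨n, hn⟩ := (hε.eventually (gt_mem_nhds (show (0 : ℝ) < e / 3 by positivity))).exists
    have hνlim : Tendsto (fun N => (ν n).real (⋃ i ∈ Finset.range N, f i)) atTop
        (𝓝 ((ν n).real (⋃ i, f i))) := by
      have hs : HasSum (fun i => (ν n).real (f i)) ((ν n).real (⋃ i, f i)) := by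
        have := measure_iUnion (μ := ν n) hd hf
        have h3 := (ENNReal.hasSum_toReal (f := fun i => ν n (f i))
          (by rw [← this]; exact measure_ne_top _ _))
        rw [measureReal_def, this, ENNReal.tsum_toReal_eq fun i => measure_ne_top _ _]
        simpa [measureReal_def] using h3
      refine hs.tendsto_sum_nat.congr fun N => ?_
      exact (measureReal_biUnion_finset (fun i _ j _ hij => hd hij) fun i _ => hf i).symm
    obtain ⟨N₀, hN₀⟩ := Metric.tendsto_atTop.1 hνlim (e / 3) (by positivity)
    refine ⟨N₀, fun N hN => ?_⟩
    have h1 := abs_le.1 (h n _ (Finset.measurableSet_biUnion (Finset.range N) fun i _ => hf i))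
    have h2 := abs_le.1 (h n _ hU)
    have h3 := abs_lt.1 (by simpa [Real.dist_eq] using hN₀ N hN :
      |(ν n).real (⋃ i ∈ Finset.range N, f i) - (ν n).real (⋃ i, f i)| < e / 3)
    rw [Real.dist_eq, abs_lt]
    constructor <;> linarith [h1.1, h1.2, h2.1, h2.2, h3.1, h3.2]
  have hempty : c ∅ = 0 := tendsto_nhds_unique (hlim ∅ .empty) (by simp)
  refine ⟨Measure.ofMeasurable (fun A _ => ENNReal.ofReal (c A)) (by simp [hempty])
    fun f hf hd => ?_, ⟨?_⟩, fun A hA => ?_⟩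
  · rw [← ENNReal.ofReal_tsum_of_nonneg (fun i => h0 _ (hf i)) (hsum f hf hd).summable,
      (hsum f hf hd).tsum_eq]
  · rw [Measure.ofMeasurable_apply _ .univ]; exact ENNReal.ofReal_lt_top
  · rw [measureReal_def, Measure.ofMeasurable_apply _ hA, ENNReal.toReal_ofReal (h0 A hA)]

/-- Layer-cake formula: the integrals differ by the integral over levels in `(0, C]` of differences
of measures of superlevel sets. -/
theorem abs_integral_sub_le_of_real {X : Type*} [MeasurableSpace X] {μ ν : Measure X}
    [IsFiniteMeasure μ] [IsFiniteMeasure ν] {e : ℝ}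
    (h : ∀ A, MeasurableSet A → |μ.real A - ν.real A| ≤ e) {f : X → ℝ} {C : ℝ}
    (hf : Measurable f) (h0 : ∀ x, 0 ≤ f x) (hC0 : 0 ≤ C) (hC : ∀ x, f x ≤ C) :
    |∫ x, f x ∂μ - ∫ x, f x ∂ν| ≤ C * e := by
  have hint : ∀ (κ : Measure X) [IsFiniteMeasure κ], Integrable f κ := fun κ _ =>
    Integrable.of_bound hf.aestronglyMeasurable C (ae_of_all _ fun x => by
      rw [Real.norm_eq_abs, abs_of_nonneg (h0 x)]; exact hC x)
  have hlay : ∀ (κ : Measure X) [IsFiniteMeasure κ],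
      ∫ x, f x ∂κ = ∫ t in Set.Ioc 0 C, κ.real {a | t ≤ f a} := fun κ _ =>
    (hint κ).integral_eq_integral_Ioc_meas_le (ae_of_all _ h0) (ae_of_all _ hC)
  have hint' : ∀ (κ : Measure X) [IsFiniteMeasure κ],
      IntegrableOn (fun t => κ.real {a | t ≤ f a}) (Set.Ioc 0 C) := fun κ _ => by
    have hm : Antitone fun t => κ.real {a | t ≤ f a} := fun s t hst =>
      measureReal_mono fun a (ha : t ≤ f a) => hst.trans ha
    refine Measure.integrableOn_of_bounded (M := κ.real Set.univ) (by simp)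
      hm.measurable.aestronglyMeasurable (ae_of_all _ fun t => ?_)
    rw [Real.norm_eq_abs, abs_of_nonneg measureReal_nonneg]
    exact measureReal_mono (Set.subset_univ _)
  rw [hlay μ, hlay ν, ← integral_sub (hint' μ) (hint' ν)]
  have := norm_setIntegral_le_of_norm_le_const (μ := volume) (s := Set.Ioc 0 C) (C := e)
    (f := fun t => μ.real {a | t ≤ f a} - ν.real {a | t ≤ f a}) (by simp)
    (fun t _ => h _ (measurableSet_le measurable_const hf))
  rw [Real.norm_eq_abs] at this
  refine this.trans (le_of_eq ?_)
  rw [Real.volume_real_Ioc_of_le hC0, sub_zero, mul_comm]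

/-! ### The left eigenmeasure -/

section

variable {b : ℕ} {ρ : Measure ℝ} {M z : ℝ} {φ : ℝ → ℝ} {ε : ℕ → ℝ}

/-- The limit functional is the integral with respect to a finite measure. -/
theorem HasGap.exists_measure [IsProbabilityMeasure ρ] (H : HasGap b ρ M z φ ε) (hb : 1 < b)
    (hM : 2 ≤ M) (h01 : ∀ᵐ x ∂ρ, x ∈ Set.Icc (0 : ℝ) 1) :
    ∃ π : Measure ℝ, IsFiniteMeasure π ∧ ∀ (f : ℝ → ℝ) (C : ℝ), IsBdd C f → (∀ x < 1, f x = 0) →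
      (∀ x, 0 ≤ f x) → ∫ x, f x ∂π = limFunctional b ρ M z f := by
  classical
  have hz := H.eigen.pos
  set P := Measure.infinitePi fun _ : ℕ => ρ
  have hSm : ∀ n, MeasurableSet {x : ℕ → ℝ | ∀ j < n, 1 ≤ pathQ b M x j} := fun n =>
    (measurableSet_alive n).preimage (f := fun x : ℕ → ℝ => (M, x)) measurable_prodMk_left
  -- The law on `[1, ∞)` of the path from `M` at time `n`, on the event of survival so far, divided
  -- by `z ^ n`. The gap, applied to indicator functions, makes these measures converge uniformly
  -- over sets.
  set ν : ℕ → Measure ℝ := fun n => ENNReal.ofReal (z ^ n)⁻¹ •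
    ((P.restrict {x | ∀ j < n, 1 ≤ pathQ b M x j}).map fun x => pathQ b M x n).restrict
      (Set.Ici 1) with hν
  have hfin : ∀ n, IsFiniteMeasure (ν n) := fun n => by
    have : IsFiniteMeasure ((P.restrict {x | ∀ j < n, 1 ≤ pathQ b M x j}).map
      fun x => pathQ b M x n) := Measure.isFiniteMeasure_map _ _
    exact Measure.smul_finite _ ENNReal.ofReal_ne_top
  have hνint : ∀ (n : ℕ) (f : ℝ → ℝ) (C : ℝ), IsBdd C f → (∀ x < 1, f x = 0) →
      ∫ x, f x ∂(ν n) = (z ^ n)⁻¹ * (step b ρ M)^[n] f M := by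
    intro n f C hf hd
    have hpath := integral_alive_path (b := b) (ρ := ρ) hb hM h01 (G := fun p => f p.1) (C := C)
      (hf.meas.comp measurable_fst) (fun p => hf.bdd _) n le_rfl
    simp only [integral_const, probReal_univ, one_smul] at hpath
    rw [hν]
    simp only
    rw [integral_smul_measure, ENNReal.toReal_ofReal (by positivity), smul_eq_mul, ← hpath]
    congr 1
    rw [setIntegral_eq_integral_of_forall_compl_eq_zero (s := Set.Ici 1)
        fun x hx => hd x (not_le.1 hx),
      integral_map (measurable_pathQ_right M n).aemeasurable hf.meas.aestronglyMeasurable,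
      ← integral_indicator (hSm n)]
    refine integral_congr_ae (ae_of_all _ fun x => ?_)
    simp only [Set.indicator_apply, Set.mem_ofPred_eq]
  set c : Set ℝ → ℝ := fun A => limFunctional b ρ M z ((A ∩ Set.Ici 1).indicator fun _ => 1) with hc
  have hind : ∀ A, MeasurableSet A → IsBdd 1 ((A ∩ Set.Ici 1).indicator fun _ => (1 : ℝ)) :=
    fun A hA => ⟨measurable_const.indicator (hA.inter measurableSet_Ici), fun x => by
      rw [Set.indicator_apply]; split_ifs <;> simp⟩
  have hindd : ∀ A : Set ℝ, ∀ x < 1, (A ∩ Set.Ici 1).indicator (fun _ => (1 : ℝ)) x = 0 :=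
    fun A x hx => Set.indicator_of_notMem (fun h => absurd h.2 (not_le.2 hx)) _
  have hunif : ∀ n A, MeasurableSet A → |(ν n).real A - c A| ≤ ε n := by
    intro n A hA
    have h1 := H.conv _ 1 (hind A hA) (hindd A) n M
    rw [← hνint n _ 1 (hind A hA) (hindd A), H.eigen.top M le_rfl, mul_one, one_mul,
      integral_indicator_const _ (hA.inter measurableSet_Ici)] at h1
    have h2 : (ν n).real (A ∩ Set.Ici 1) = (ν n).real A := by
      simp only [hν, measureReal_def, Measure.smul_apply, Measure.restrict_apply hA,
        Measure.restrict_apply (hA.inter measurableSet_Ici), Set.inter_assoc, Set.inter_self]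
    rw [h2] at h1
    simpa using h1
  obtain ⟨π, hπ, hπc⟩ := exists_measure_of_uniform_limit H.lim hunif
  refine ⟨π, hπ, fun f C hf hd h0 => ?_⟩
  refine (tendsto_nhds_unique (H.tendsto_top hf hd) ?_).symm
  have : Tendsto (fun n => ∫ x, f x ∂(ν n)) atTop (𝓝 (∫ x, f x ∂π)) := by
    rw [tendsto_iff_norm_sub_tendsto_zero]
    refine squeeze_zero (fun _ => norm_nonneg _) (fun n => ?_)
      (by simpa using H.lim.const_mul C : Tendsto (fun n => C * ε n) atTop (𝓝 0))
    exact abs_integral_sub_le_of_real (fun A hA => by rw [hπc A hA]; exact hunif n A hA) hf.meas h0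
      hf.nonneg fun x => (le_abs_self _).trans (hf.bdd x)
  exact this.congr fun n => hνint n f C hf hd

end

/-! ### The limit of the conditioned laws -/

section

variable {b : ℕ} {ρ : Measure ℝ} {M z : ℝ} {φ : ℝ → ℝ} {ε : ℕ → ℝ}

theorem tailProb_one [IsProbabilityMeasure ρ] : tailProb b ρ 1 Set.univ = alive := by
  ext q
  rw [tailProb, alive]
  split_ifs with h
  · have : {y : ℕ → ℝ | (∀ j < 1, 1 ≤ pathQ b q y j) ∧ (fun i : Fin 1 => y (1 - 1 - i)) ∈
        Set.univ} = Set.univ := by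
      ext y; simpa [pathQ] using h
    rw [this, probReal_univ]
  · have : {y : ℕ → ℝ | (∀ j < 1, 1 ≤ pathQ b q y j) ∧ (fun i : Fin 1 => y (1 - 1 - i)) ∈
        Set.univ} = ∅ := by
      ext y; simpa [pathQ] using h
    rw [this, measureReal_empty]

theorem real_revAlive [IsProbabilityMeasure ρ] (hb : 1 < b) (hM : 2 ≤ M)
    (h01 : ∀ᵐ x ∂ρ, x ∈ Set.Icc (0 : ℝ) 1) (m : ℕ) {θ : ℝ} (h1 : 1 ≤ θ) (hθ : θ ≤ M) :
    (Measure.infinitePi fun _ : ℕ => ρ).real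
        {y | ∀ j, 1 ≤ j → j < m + 1 → 1 ≤ revQ b θ (m + 1) j y} =
      (step b ρ M)^[m] alive θ := by
  rw [← tailProb_one (b := b) (ρ := ρ),
    ← revAlive_inter_cylinder hb hM h01 m one_pos MeasurableSet.univ h1 hθ]
  congr 1
  ext y; simp

theorem real_revAlive' [IsProbabilityMeasure ρ] (hb : 1 < b) (hM : 2 ≤ M)
    (h01 : ∀ᵐ x ∂ρ, x ∈ Set.Icc (0 : ℝ) 1) (m : ℕ) {k : ℕ} (hk : 0 < k) {θ : ℝ} (h1 : 1 ≤ θ)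
    (hθ : θ ≤ M) :
    (Measure.infinitePi fun _ : ℕ => ρ).real
        {y | ∀ j, 1 ≤ j → j < m + k → 1 ≤ revQ b θ (m + k) j y} =
      (step b ρ M)^[m] (tailProb b ρ k Set.univ) θ := by
  rw [← revAlive_inter_cylinder hb hM h01 m hk MeasurableSet.univ h1 hθ]
  congr 1
  ext y; simp

theorem HasGap.iterate_alive_pos [IsProbabilityMeasure ρ] (H : HasGap b ρ M z φ ε) (n : ℕ) {θ : ℝ}
    (h1 : 1 ≤ θ) : 0 < (step b ρ M)^[n] alive θ := by
  have h2 := iterate_mono (b := b) (ρ := ρ) (M := M) H.eigen.bdd isBdd_alive H.eigen.le_alive n θ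
  rw [H.eigen.iterate] at h2
  exact (mul_pos (pow_pos H.eigen.pos n) (H.pos_of_le h1)).trans_le h2

theorem HasGap.revAlive_pos [IsProbabilityMeasure ρ] (H : HasGap b ρ M z φ ε) (hb : 1 < b)
    (hM : 2 ≤ M) (h01 : ∀ᵐ x ∂ρ, x ∈ Set.Icc (0 : ℝ) 1) {n : ℕ} (hn : 0 < n) {θ : ℝ} (h1 : 1 ≤ θ)
    (hθ : θ ≤ M) :
    0 < (Measure.infinitePi fun _ : ℕ => ρ).real
        {y | ∀ j, 1 ≤ j → j < n → 1 ≤ revQ b θ n j y} := by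
  obtain ⟨m, rfl⟩ := Nat.exists_eq_succ_of_ne_zero hn.ne'
  rw [Nat.succ_eq_add_one, real_revAlive hb hM h01 m h1 hθ]
  exact H.iterate_alive_pos m h1

theorem HasGap.isProbabilityMeasure_condPathLaw [IsProbabilityMeasure ρ] (H : HasGap b ρ M z φ ε)
    (hb : 1 < b) (hM : 2 ≤ M) (h01 : ∀ᵐ x ∂ρ, x ∈ Set.Icc (0 : ℝ) 1) {n : ℕ} (hn : 0 < n) {θ : ℝ}
    (h1 : 1 ≤ θ) (hθ : θ ≤ M) : IsProbabilityMeasure (condPathLaw b ρ n θ) := by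
  refine cond_isProbabilityMeasure fun h0 => ?_
  have := H.revAlive_pos hb hM h01 hn h1 hθ
  rw [measureReal_def, h0] at this
  simp at this

theorem condPathLaw_real (n : ℕ) (θ : ℝ) (S : Set (ℕ → ℝ)) :
    (condPathLaw b ρ n θ).real S = (Measure.infinitePi fun _ : ℕ => ρ).real
        ({y | ∀ j, 1 ≤ j → j < n → 1 ≤ revQ b θ n j y} ∩ S) /
      (Measure.infinitePi fun _ : ℕ => ρ).real {y | ∀ j, 1 ≤ j → j < n → 1 ≤ revQ b θ n j y} := by
  rw [condPathLaw, measureReal_def, cond_apply (measurableSet_revAlive θ n), ENNReal.toReal_mul,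
    ENNReal.toReal_inv, div_eq_inv_mul]
  rfl

theorem HasGap.limFunctional_tailProb [IsProbabilityMeasure ρ] (H : HasGap b ρ M z φ ε)
    (hb : 1 < b) (hM : 2 ≤ M) (h01 : ∀ᵐ x ∂ρ, x ∈ Set.Icc (0 : ℝ) 1) {k : ℕ} (hk : 0 < k) :
    0 < limFunctional b ρ M z (tailProb b ρ k Set.univ) := by
  have hz := H.eigen.pos
  obtain ⟨l, rfl⟩ := Nat.exists_eq_succ_of_ne_zero hk.ne'
  have h1 := H.tendsto_top (isBdd_tailProb (b := b) (ρ := ρ) (k := l.succ) MeasurableSet.univ)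
    fun x hx => tailProb_of_lt hk _ hx
  have h2 := ((H.tendsto_top isBdd_alive fun _ => alive_of_lt).comp
    (tendsto_add_atTop_nat l)).const_mul (z ^ l)
  -- With no constraint on the increments, both sides iterate to the probability of the same
  -- conditioning event; only the powers of `z` used to normalise it differ.
  have h3 : limFunctional b ρ M z (tailProb b ρ l.succ Set.univ) =
      z ^ l * limFunctional b ρ M z alive := by
    refine tendsto_nhds_unique h1 (h2.congr fun m => ?_)
    simp only [Function.comp_apply]
    have h4 := real_revAlive' hb hM h01 m hk (by linarith : (1 : ℝ) ≤ M) le_rfl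
    have h5 := real_revAlive hb hM h01 (m + l) (by linarith : (1 : ℝ) ≤ M) le_rfl
    rw [← h4, ← h5, pow_add, Nat.succ_eq_add_one, ← add_assoc]
    field_simp
  rw [h3]
  exact mul_pos (pow_pos hz l) (by linarith [H.one_le_limFunctional_alive])

theorem abs_div_sub_div_le {a d a' d' e : ℝ} (ha : 0 ≤ a) (had : a ≤ d) (hd : 0 < d) (hd' : 0 < d')
    (h1 : |a - a'| ≤ e) (h2 : |d - d'| ≤ e) : |a / d - a' / d'| ≤ 2 / d' * e := by
  have h3 : a / d - a' / d' = (a / d * (d' - d) + (a - a')) / d' := by field_simp; ring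
  have h4 : a / d ≤ 1 := (div_le_one hd).2 had
  have h5 : 0 ≤ a / d := by positivity
  have h6 : |a / d * (d' - d)| ≤ e := by
    rw [abs_mul, abs_of_nonneg h5, abs_sub_comm]
    exact (mul_le_of_le_one_left (abs_nonneg _) h4).trans h2
  rw [h3, abs_div, abs_of_pos hd', div_le_iff₀ hd', show 2 / d' * e * d' = 2 * e by field_simp]
  exact (abs_add_le _ _).trans (by linarith)

/-- The error does not involve `A`. This uniformity turns the limits into genuine measures. -/
theorem HasGap.condPathLaw_uniform [IsProbabilityMeasure ρ] (H : HasGap b ρ M z φ ε)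
    (hb : 1 < b) (hM : 2 ≤ M) (h01 : ∀ᵐ x ∂ρ, x ∈ Set.Icc (0 : ℝ) 1) {k : ℕ} (hk : 0 < k) {θ : ℝ}
    (h1 : 1 ≤ θ) (hθ : θ ≤ M) {A : Set (Fin k → ℝ)} (hA : MeasurableSet A) (m : ℕ) :
    |(condPathLaw b ρ (m + k) θ).real {y | (fun i : Fin k => y i) ∈ A} -
        limFunctional b ρ M z (tailProb b ρ k A) /
          limFunctional b ρ M z (tailProb b ρ k Set.univ)| ≤
      2 / (limFunctional b ρ M z (tailProb b ρ k Set.univ) * φ θ) * ε m := by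
  have hφ := H.pos_of_le h1
  have hz := pow_pos H.eigen.pos m
  have hL := H.limFunctional_tailProb hb hM h01 hk
  rw [condPathLaw_real, revAlive_inter_cylinder hb hM h01 m hk hA h1 hθ,
    real_revAlive' hb hM h01 m hk h1 hθ]
  have hbA := isBdd_tailProb (b := b) (ρ := ρ) hA
  have hbu := isBdd_tailProb (b := b) (ρ := ρ) (k := k) MeasurableSet.univ
  have hdA : ∀ x < 1, tailProb b ρ k A x = 0 := fun x hx => tailProb_of_lt hk _ hx
  have hdu : ∀ x < 1, tailProb b ρ k Set.univ x = 0 := fun x hx => tailProb_of_lt hk _ hx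
  have hpos : 0 < (step b ρ M)^[m] (tailProb b ρ k Set.univ) θ := by
    rw [← real_revAlive' hb hM h01 m hk h1 hθ]
    exact H.revAlive_pos hb hM h01 (by omega) h1 hθ
  have e1 := H.conv _ 1 hbA hdA m θ
  have e2 := H.conv _ 1 hbu hdu m θ
  rw [one_mul] at e1 e2
  have hle : (step b ρ M)^[m] (tailProb b ρ k A) θ ≤
      (step b ρ M)^[m] (tailProb b ρ k Set.univ) θ :=
    iterate_mono hbA hbu (fun q => measureReal_mono fun y hy => ⟨hy.1, trivial⟩) m θ
  have := abs_div_sub_div_le (mul_nonneg (inv_pos.2 hz).le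
    (iterate_nonneg (fun q => measureReal_nonneg) m θ))
    (mul_le_mul_of_nonneg_left hle (inv_pos.2 hz).le) (mul_pos (inv_pos.2 hz) hpos)
    (mul_pos hL hφ) e1 e2
  rwa [mul_div_mul_left _ _ (inv_pos.2 hz).ne', mul_div_mul_right _ _ hφ.ne'] at this

theorem HasGap.tendsto_condPathLaw_real [IsProbabilityMeasure ρ] (H : HasGap b ρ M z φ ε)
    (hb : 1 < b) (hM : 2 ≤ M) (h01 : ∀ᵐ x ∂ρ, x ∈ Set.Icc (0 : ℝ) 1) {k : ℕ} (hk : 0 < k) {θ : ℝ}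
    (h1 : 1 ≤ θ) (hθ : θ ≤ M) {A : Set (Fin k → ℝ)} (hA : MeasurableSet A) :
    Tendsto (fun n => (condPathLaw b ρ n θ).real {y | (fun i : Fin k => y i) ∈ A}) atTop
      (𝓝 (limFunctional b ρ M z (tailProb b ρ k A) /
          limFunctional b ρ M z (tailProb b ρ k Set.univ))) := by
  rw [← tendsto_add_atTop_iff_nat k, tendsto_iff_norm_sub_tendsto_zero]
  refine squeeze_zero (fun _ => norm_nonneg _)
    (fun m => H.condPathLaw_uniform hb hM h01 hk h1 hθ hA m) ?_
  simpa using H.lim.const_mul (2 / (limFunctional b ρ M z (tailProb b ρ k Set.univ) * φ θ))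

theorem measurable_cylinderMap (k : ℕ) :
    Measurable fun (y : ℕ → ℝ) (i : Fin k) => y i := by fun_prop

theorem HasGap.exists_marginal [IsProbabilityMeasure ρ] (H : HasGap b ρ M z φ ε)
    (hb : 1 < b) (hM : 2 ≤ M) (h01 : ∀ᵐ x ∂ρ, x ∈ Set.Icc (0 : ℝ) 1) {k : ℕ} (hk : 0 < k) :
    ∃ p : Measure (Fin k → ℝ), IsProbabilityMeasure p ∧
      (∀ A, MeasurableSet A → p.real A = limFunctional b ρ M z (tailProb b ρ k A) /
          limFunctional b ρ M z (tailProb b ρ k Set.univ)) ∧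
      ∀ (f : (Fin k → ℝ) → ℝ) (C : ℝ), Measurable f → (∀ x, 0 ≤ f x) → (∀ x, f x ≤ C) →
        Tendsto (fun n => ∫ y, f (fun i : Fin k => y i) ∂(condPathLaw b ρ n 1)) atTop
          (𝓝 (∫ w, f w ∂p)) := by
  have h1M : (1 : ℝ) ≤ M := by linarith
  set ν : ℕ → Measure (Fin k → ℝ) := fun m =>
    (condPathLaw b ρ (m + k) 1).map fun (y : ℕ → ℝ) (i : Fin k) => y i with hν
  have hνp : ∀ m, IsProbabilityMeasure (ν m) := fun m => by
    have := H.isProbabilityMeasure_condPathLaw hb hM h01 (n := m + k) (by omega) le_rfl h1M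
    exact Measure.isProbabilityMeasure_map (measurable_cylinderMap k).aemeasurable
  set ε' : ℕ → ℝ := fun m =>
    2 / (limFunctional b ρ M z (tailProb b ρ k Set.univ) * φ 1) * ε m with hε'
  have hε'0 : Tendsto ε' atTop (𝓝 0) := by simpa using H.lim.const_mul _
  have hunif : ∀ m A, MeasurableSet A → |(ν m).real A -
      limFunctional b ρ M z (tailProb b ρ k A) /
          limFunctional b ρ M z (tailProb b ρ k Set.univ)| ≤ ε' m := by
    intro m A hA
    rw [hν, measureReal_def, Measure.map_apply (measurable_cylinderMap k) hA]
    exact H.condPathLaw_uniform hb hM h01 hk le_rfl h1M hA m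
  obtain ⟨p, hp, hpc⟩ := exists_measure_of_uniform_limit hε'0 hunif
  refine ⟨p, ⟨?_⟩, hpc, fun f C hf h0 hC => ?_⟩
  · have := hpc Set.univ .univ
    rw [div_self (H.limFunctional_tailProb hb hM h01 hk).ne', measureReal_def] at this
    exact (ENNReal.toReal_eq_one_iff _).1 this
  · rw [← tendsto_add_atTop_iff_nat k, tendsto_iff_norm_sub_tendsto_zero]
    refine squeeze_zero (fun _ => norm_nonneg _) (fun m => ?_)
      (by simpa using hε'0.const_mul C : Tendsto (fun n => C * ε' n) atTop (𝓝 0))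
    have := abs_integral_sub_le_of_real (μ := ν m) (ν := p)
      (fun A hA => by rw [hpc A hA]; exact hunif m A hA) hf h0 ((h0 0).trans (hC 0)) hC
    rw [hν] at this
    simp only at this
    rwa [integral_map (measurable_cylinderMap k).aemeasurable hf.aestronglyMeasurable] at this

/-- The coordinates of a path are almost surely in `[0, 1]`. -/
theorem ae_mem_Icc_infinitePi [IsProbabilityMeasure ρ] (h01 : ∀ᵐ x ∂ρ, x ∈ Set.Icc (0 : ℝ) 1) :
    ∀ᵐ y ∂(Measure.infinitePi fun _ : ℕ => ρ), ∀ i, y i ∈ Set.Icc (0 : ℝ) 1 :=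
  ae_all_iff.2 fun i => (measurePreserving_eval_infinitePi (fun _ : ℕ => ρ) i).quasiMeasurePreserving.ae h01

theorem ae_mem_Icc_condPathLaw [IsProbabilityMeasure ρ] (h01 : ∀ᵐ x ∂ρ, x ∈ Set.Icc (0 : ℝ) 1)
    (n : ℕ) (θ : ℝ) : ∀ᵐ y ∂(condPathLaw b ρ n θ), ∀ i, y i ∈ Set.Icc (0 : ℝ) 1 :=
  cond_absolutelyContinuous.ae_le (ae_mem_Icc_infinitePi h01)

/-- The coordinates lie in `[0, 1]` almost surely, so the conditioned laws can be placed on the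
compact space of sequences in `[0, 1]`. Any ultrafilter limit there has the finite-dimensional
marginals already found, since continuous bounded functions determine them; weak convergence thus
suffices. -/
theorem HasGap.exists_limit [IsProbabilityMeasure ρ] (H : HasGap b ρ M z φ ε)
    (hb : 1 < b) (hM : 2 ≤ M) (h01 : ∀ᵐ x ∂ρ, x ∈ Set.Icc (0 : ℝ) 1) :
    ∃ μ : Measure (ℕ → ℝ), IsProbabilityMeasure μ ∧ ∀ (k : ℕ) (_ : 0 < k) (A : Set (Fin k → ℝ)),
      MeasurableSet A → μ.real {y | (fun i : Fin k => y i) ∈ A} =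
        limFunctional b ρ M z (tailProb b ρ k A) /
          limFunctional b ρ M z (tailProb b ρ k Set.univ) := by
  have h1M : (1 : ℝ) ≤ M := by linarith
  let clamp : (ℕ → ℝ) → ℕ → unitInterval := fun y i => Set.projIcc 0 1 zero_le_one (y i)
  have hclamp : Measurable clamp :=
    measurable_pi_iff.2 fun i => continuous_projIcc.measurable.comp (measurable_pi_apply i)
  have hprob : ∀ n, IsProbabilityMeasure (condPathLaw b ρ (n + 1) 1) := fun n =>
    H.isProbabilityMeasure_condPathLaw hb hM h01 n.succ_pos le_rfl h1M
  let Qn : ℕ → ProbabilityMeasure (ℕ → unitInterval) := fun n =>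
    ⟨(condPathLaw b ρ (n + 1) 1).map clamp,
      Measure.isProbabilityMeasure_map hclamp.aemeasurable⟩
  obtain ⟨Q, -, hQ⟩ := isCompact_univ.ultrafilter_le_nhds ((hyperfilter ℕ).map Qn) (by simp)
  have hQ' : Tendsto Qn (hyperfilter ℕ) (𝓝 Q) := hQ
  let emb : (ℕ → unitInterval) → ℕ → ℝ := fun e i => e i
  have hemb : Measurable emb := by fun_prop
  refine ⟨(Q : Measure (ℕ → unitInterval)).map emb,
    Measure.isProbabilityMeasure_map hemb.aemeasurable, fun k hk A hA => ?_⟩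
  obtain ⟨p, hp, hpc, hpl⟩ := H.exists_marginal hb hM h01 hk
  let r : (ℕ → unitInterval) → Fin k → ℝ := fun e i => e i
  have hr : Continuous r := by fun_prop
  have hmap : (Q : Measure (ℕ → unitInterval)).map r = p := by
    have : IsProbabilityMeasure ((Q : Measure (ℕ → unitInterval)).map r) :=
      Measure.isProbabilityMeasure_map hr.measurable.aemeasurable
    refine ext_of_forall_lintegral_eq_of_IsFiniteMeasure fun f => ?_
    rw [lintegral_map (by fun_prop) hr.measurable]
    have e1 := (ProbabilityMeasure.tendsto_iff_forall_lintegral_tendsto.1 hQ')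
      (f.compContinuous ⟨r, hr⟩)
    have hfm : Measurable fun w => ((f w : NNReal) : ℝ) := by fun_prop
    obtain ⟨C, hC⟩ := f.isBounded_range.bddAbove
    have e2 := hpl (fun w => (f w : ℝ)) C hfm (fun w => (f w).2)
      fun w => by exact_mod_cast hC (Set.mem_range_self w)
    have hcoe : ∀ {X : Type} [MeasurableSpace X] (κ : Measure X) [IsProbabilityMeasure κ]
        (g : X → Fin k → ℝ), Measurable g →
        ∫⁻ x, (f (g x) : ENNReal) ∂κ = ENNReal.ofReal (∫ x, (f (g x) : ℝ) ∂κ) := by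
      intro X _ κ _ g hg
      rw [ofReal_integral_eq_lintegral_ofReal]
      · simp
      · refine Integrable.of_bound (hfm.comp hg).aestronglyMeasurable C (ae_of_all _ fun x => ?_)
        rw [Real.norm_eq_abs, NNReal.abs_eq]
        exact_mod_cast hC (Set.mem_range_self _)
      · exact ae_of_all _ fun x => (f _).2
    have e3 := ENNReal.tendsto_ofReal ((e2.comp (tendsto_add_atTop_nat 1)).mono_left
      Nat.hyperfilter_le_atTop)
    have hid := hcoe p id measurable_id
    simp only [id] at hid
    rw [← hid] at e3
    refine tendsto_nhds_unique e1 (e3.congr fun n => ?_)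
    have hpn := hprob n
    simp only [Function.comp_apply]
    rw [← hcoe (condPathLaw b ρ (n + 1) 1) _ (measurable_cylinderMap k)]
    change _ = ∫⁻ e, (f (r e) : ENNReal) ∂((condPathLaw b ρ (n + 1) 1).map clamp)
    rw [lintegral_map (by fun_prop) hclamp]
    refine lintegral_congr_ae ?_
    filter_upwards [ae_mem_Icc_condPathLaw h01 (n + 1) 1] with y hy
    congr 2
    ext i
    simp only [r, clamp]
    rw [Set.projIcc_of_mem _ (hy i)]
  rw [← hpc A hA, ← hmap, measureReal_def, measureReal_def, Measure.map_apply hemb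
    (measurableSet_cylinder hA), Measure.map_apply hr.measurable hA]
  rfl

end

/-- The standing assumptions, in the form in which they are used. -/
theorem Admissible.basic {b : ℕ} {ρ : Measure ℝ} (h : Admissible b ρ) :
    ρ ≪ volume ∧ (∀ᵐ x ∂ρ, x ∈ Set.Icc (0 : ℝ) 1) ∧
      0 < ρ.real (Set.Icc (1 - 1 / (b : ℝ)) 1) := by
  have := h.isProb
  refine ⟨h.absCont.trans Measure.absolutelyContinuous_restrict |>.trans .rfl,
    h.absCont.ae_le (ae_restrict_mem measurableSet_Icc), ?_⟩
  exact ENNReal.toReal_pos h.mass_pos.ne' (measure_ne_top _ _)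

theorem isLimitLaw_limitLaw {b : ℕ} {ρ : Measure ℝ} (hb : 1 < b) (h : Admissible b ρ) :
    IsLimitLaw b ρ (limitLaw b ρ) := by
  have := h.isProb
  obtain ⟨hac, h01, hp⟩ := h.basic
  refine Classical.epsilon_spec (p := IsLimitLaw b ρ) ?_
  obtain ⟨z₂, φ₂, ε₂, H₂⟩ := exists_hasGap hb hac (one_le_two : (1 : ℝ) ≤ 2) hp
  obtain ⟨μ, hμ, hμc⟩ := H₂.exists_limit hb le_rfl h01
  refine ⟨μ, hμ, fun θ hθ k A hA => ?_⟩
  obtain ⟨z, φ, ε, H⟩ := exists_hasGap hb hac (M := max 2 θ)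
    (one_le_two.trans (le_max_left _ _)) hp
  have hM : (2 : ℝ) ≤ max 2 θ := le_max_left _ _
  have hprob : ∀ᶠ n in atTop, IsProbabilityMeasure (condPathLaw b ρ n θ) := by
    filter_upwards [eventually_gt_atTop 0] with n hn
    exact H.isProbabilityMeasure_condPathLaw hb hM h01 hn hθ (le_max_right _ _)
  have hreal : Tendsto (fun n => (condPathLaw b ρ n θ).real {y | (fun i : Fin k => y i) ∈ A}) atTop
      (𝓝 (μ.real {y | (fun i : Fin k => y i) ∈ A})) := by
    rcases Nat.eq_zero_or_pos k with rfl | hk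
    · have hcase : {y : ℕ → ℝ | (fun i : Fin 0 => y i) ∈ A} = ∅ ∨
          {y : ℕ → ℝ | (fun i : Fin 0 => y i) ∈ A} = Set.univ := by
        by_cases h0 : (fun i : Fin 0 => (0 : ℝ)) ∈ A
        · right; ext y
          simpa [Subsingleton.elim (fun i : Fin 0 => y i) (fun i : Fin 0 => (0 : ℝ))] using h0
        · left; ext y
          simpa [Subsingleton.elim (fun i : Fin 0 => y i) (fun i : Fin 0 => (0 : ℝ))] using h0
      rcases hcase with h0 | h0
      · simp [h0]
      · rw [h0, probReal_univ]
        refine tendsto_const_nhds.congr' ?_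
        filter_upwards [hprob] with n hn
        rw [probReal_univ]
    -- The limit for the cap `max 2 θ` is the same from `θ` and from `1`. From `1` the cap `2` is
    -- admissible as well, so the expressions for both caps agree.
    · have t1 := H.tendsto_condPathLaw_real hb hM h01 hk hθ (le_max_right _ _) hA
      have t2 := H.tendsto_condPathLaw_real hb hM h01 hk le_rfl (one_le_two.trans hM) hA
      have t3 := H₂.tendsto_condPathLaw_real hb le_rfl h01 hk le_rfl one_le_two hA
      rw [hμc k hk A hA, ← tendsto_nhds_unique t2 t3]
      exact t1
  have := ENNReal.tendsto_ofReal hreal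
  rw [ofReal_measureReal] at this
  refine this.congr' ?_
  filter_upwards [hprob] with n hn
  rw [ofReal_measureReal]

/-! ### Truncations of the reversed sums -/

section

variable {b : ℕ} {ρ : Measure ℝ} {M z : ℝ} {φ : ℝ → ℝ} {ε : ℕ → ℝ}

theorem sum_div_pow_le (hb : 1 < b) {y : ℕ → ℝ} (hy : ∀ i, y i ∈ Set.Icc (0 : ℝ) 1) (m : ℕ) :
    ∑ j ∈ Finset.range m, y j / (b : ℝ) ^ j ≤ 2 := by
  have hb2 : (2 : ℝ) ≤ b := by exact_mod_cast hb
  refine le_trans (Finset.sum_le_sum fun j _ => ?_) (sum_geometric_two_le m)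
  rw [div_pow, one_pow]
  exact div_le_div₀ zero_le_one (hy j).2 (by positivity) (by gcongr)

theorem sum_div_pow_add (y : ℕ → ℝ) (k m : ℕ) :
    ∑ j ∈ Finset.range (k + m), y j / (b : ℝ) ^ j = ∑ j ∈ Finset.range k, y j / (b : ℝ) ^ j +
      (∑ j ∈ Finset.range m, y (k + j) / (b : ℝ) ^ j) / (b : ℝ) ^ k := by
  rw [Finset.sum_range_add, Finset.sum_div]
  congr 1
  refine Finset.sum_congr rfl fun j _ => ?_
  rw [div_div, pow_add, mul_comm ((b : ℝ) ^ j)]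

theorem sum_div_pow_nonneg {y : ℕ → ℝ} (hy : ∀ i, y i ∈ Set.Icc (0 : ℝ) 1) (m : ℕ) :
    0 ≤ ∑ j ∈ Finset.range m, y j / (b : ℝ) ^ j :=
  Finset.sum_nonneg fun j _ => div_nonneg (hy j).1 (by positivity)

theorem trunc_bounds (hb : 1 < b) {y : ℕ → ℝ} (hy : ∀ i, y i ∈ Set.Icc (0 : ℝ) 1) (k m : ℕ) :
    ∑ j ∈ Finset.range k, y j / (b : ℝ) ^ j ≤ ∑ j ∈ Finset.range (k + m), y j / (b : ℝ) ^ j ∧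
      ∑ j ∈ Finset.range (k + m), y j / (b : ℝ) ^ j ≤
        ∑ j ∈ Finset.range k, y j / (b : ℝ) ^ j + 2 / (b : ℝ) ^ k := by
  rw [sum_div_pow_add]
  have h1 := sum_div_pow_nonneg (b := b) (y := fun j => y (k + j)) (fun i => hy _) m
  have h2 := sum_div_pow_le hb (y := fun j => y (k + j)) (fun i => hy _) m
  have hbk : (0 : ℝ) < (b : ℝ) ^ k := by positivity
  constructor
  · linarith [div_nonneg h1 hbk.le]
  · gcongr

/-- The `3` is the geometric bound `2` for the omitted increments plus `1` for the starting value.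
-/
theorem revQ_zero_bounds (hb : 1 < b) {y : ℕ → ℝ} (hy : ∀ i, y i ∈ Set.Icc (0 : ℝ) 1) {k n : ℕ}
    (hkn : k ≤ n) :
    ∑ j ∈ Finset.range k, y j / (b : ℝ) ^ j ≤ revQ b 1 n 0 y ∧
      revQ b 1 n 0 y ≤ ∑ j ∈ Finset.range k, y j / (b : ℝ) ^ j + 3 / (b : ℝ) ^ k := by
  obtain ⟨m, rfl⟩ := Nat.exists_eq_add_of_le hkn
  have hb1 : (1 : ℝ) ≤ b := by exact_mod_cast hb.le
  have h := trunc_bounds hb hy k m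
  have hr : revQ b 1 (k + m) 0 y = ∑ j ∈ Finset.range (k + m), y j / (b : ℝ) ^ j +
      1 / (b : ℝ) ^ (k + m) := by
    simp [revQ]
  have h1 : 1 / (b : ℝ) ^ (k + m) ≤ 1 / (b : ℝ) ^ k := by
    gcongr
  have h2 : 0 ≤ 1 / (b : ℝ) ^ (k + m) := by positivity
  have h3 : 3 / (b : ℝ) ^ k = 2 / (b : ℝ) ^ k + 1 / (b : ℝ) ^ k := by ring
  rw [hr, h3]
  constructor <;> linarith [h.1, h.2]

theorem tendsto_trunc (hb : 1 < b) {y : ℕ → ℝ} (hy : ∀ i, y i ∈ Set.Icc (0 : ℝ) 1) :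
    Tendsto (fun k => ∑ j ∈ Finset.range k, y j / (b : ℝ) ^ j) atTop (𝓝 (qInf b y)) := by
  have hs : Summable fun j => y j / (b : ℝ) ^ j :=
    summable_of_sum_range_le (fun j => div_nonneg (hy j).1 (by positivity))
      fun m => sum_div_pow_le hb hy m
  exact hs.hasSum.tendsto_sum_nat

theorem qInf_bounds (hb : 1 < b) {y : ℕ → ℝ} (hy : ∀ i, y i ∈ Set.Icc (0 : ℝ) 1) (k : ℕ) :
    ∑ j ∈ Finset.range k, y j / (b : ℝ) ^ j ≤ qInf b y ∧
      qInf b y ≤ ∑ j ∈ Finset.range k, y j / (b : ℝ) ^ j + 2 / (b : ℝ) ^ k := by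
  have h := (tendsto_trunc hb hy).comp (tendsto_add_atTop_nat k)
  constructor
  · refine ge_of_tendsto' h fun m => ?_
    simp only [Function.comp_apply]
    rw [add_comm m k]
    exact (trunc_bounds hb hy k m).1
  · refine le_of_tendsto' h fun m => ?_
    simp only [Function.comp_apply]
    rw [add_comm m k]
    exact (trunc_bounds hb hy k m).2

/-! ### The law of the infinite reversed sum -/

theorem isBdd_indicator_Ici (a : ℝ) : IsBdd 1 ((Set.Ici a).indicator fun _ => (1 : ℝ)) :=
  ⟨measurable_const.indicator measurableSet_Ici, fun x => by
    rw [Set.indicator_apply]; split_ifs <;> simp⟩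

open Classical in
theorem real_revAlive_inter_ge [IsProbabilityMeasure ρ] (hb : 1 < b) (hM : 2 ≤ M)
    (h01 : ∀ᵐ x ∂ρ, x ∈ Set.Icc (0 : ℝ) 1) (n : ℕ) {θ : ℝ}
    (h1 : 1 ≤ θ) (hθ : θ ≤ M) (a : ℝ) :
    (Measure.infinitePi fun _ : ℕ => ρ).real
        ({y | ∀ j, 1 ≤ j → j < n → 1 ≤ revQ b θ n j y} ∩ {y | a ≤ revQ b θ n 0 y}) =
      (step b ρ M)^[n] ((Set.Ici a).indicator fun _ => 1) θ := by
  have hmp := measurePreserving_reindex ρ (revEquiv n)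
  rw [← hmp.measureReal_preimage ((measurableSet_revAlive θ n).inter
    (measurableSet_le measurable_const (measurable_revQ θ n 0))).nullMeasurableSet]
  have hset : (fun (x : ℕ → ℝ) (i : ℕ) => x ((revEquiv n).symm i)) ⁻¹'
      ({y | ∀ j, 1 ≤ j → j < n → 1 ≤ revQ b θ n j y} ∩ {y | a ≤ revQ b θ n 0 y}) =
      {x | ∀ j < n, 1 ≤ pathQ b θ x j} ∩ {x | a ≤ pathQ b θ x n} := by
    ext x
    have := revQ_reverse hb θ n x le_rfl
    rw [Nat.sub_self] at this
    simp only [Set.mem_preimage, Set.mem_inter_iff, Set.mem_ofPred_eq, this, revAlive_reverse hb h1]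
  rw [hset]
  have hb1 := isBdd_indicator_Ici a
  have h := integral_alive_path (b := b) (ρ := ρ) hb hM h01
    (G := fun p => (Set.Ici a).indicator (fun _ => 1) p.1) (C := 1)
    (hb1.meas.comp measurable_fst) (fun p => hb1.bdd _) n hθ
  simp only [integral_const, probReal_univ, one_smul] at h
  change _ = (step b ρ M)^[n] ((Set.Ici a).indicator fun _ => 1) θ at h
  rw [← h, ← integral_indicator_one]
  · refine integral_congr_ae (ae_of_all _ fun x => ?_)
    simp only [Set.indicator_apply, Set.mem_inter_iff, Set.mem_ofPred_eq, Set.mem_Ici]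
    split_ifs <;> first | rfl | (exfalso; tauto)
  · exact ((measurableSet_alive n).preimage (f := fun x : ℕ → ℝ => (θ, x))
      measurable_prodMk_left).inter
        (measurableSet_le measurable_const (measurable_pathQ_right θ n))

/-- The full reversed sum is the path value at time `n`, whereas only times before `n` are
conditioned on. This leaves one final step without killing at its end, the extra `step` in the
numerator. -/
theorem HasGap.tendsto_condPathLaw_ge [IsProbabilityMeasure ρ] (H : HasGap b ρ M z φ ε)
    (hb : 1 < b) (hM : 2 ≤ M) (h01 : ∀ᵐ x ∂ρ, x ∈ Set.Icc (0 : ℝ) 1) (a : ℝ) :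
    Tendsto (fun n => (condPathLaw b ρ n 1).real {y | a ≤ revQ b 1 n 0 y}) atTop
      (𝓝 (limFunctional b ρ M z (step b ρ M ((Set.Ici a).indicator fun _ => 1)) /
        limFunctional b ρ M z alive)) := by
  have h1M : (1 : ℝ) ≤ M := by linarith
  rw [← tendsto_add_atTop_iff_nat 1]
  have t1 := H.tendsto ((isBdd_indicator_Ici a).step (b := b) (ρ := ρ) (M := M))
    (fun x hx => step_of_lt hx) 1
  have t2 := H.tendsto isBdd_alive (fun _ => alive_of_lt) 1
  have hL := H.one_le_limFunctional_alive
  have hL' : limFunctional b ρ M z alive * φ 1 ≠ 0 := (mul_pos (by linarith) H.one_pos).ne'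
  have t3 := t1.div t2 hL'
  rw [mul_div_mul_right _ _ H.one_pos.ne'] at t3
  refine t3.congr fun n => ?_
  have hz := pow_pos H.eigen.pos n
  simp only [Pi.div_apply]
  rw [condPathLaw_real, real_revAlive_inter_ge hb hM h01 (n + 1) le_rfl h1M a,
    real_revAlive hb hM h01 n le_rfl h1M, mul_div_mul_left _ _ (inv_pos.2 hz).ne',
    Function.iterate_succ_apply]

/-- The law of the value after one step from the normalised left eigenmeasure. -/
theorem HasGap.exists_qLaw [IsProbabilityMeasure ρ] (H : HasGap b ρ M z φ ε) (hb : 1 < b)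
    (hM : 2 ≤ M) (h01 : ∀ᵐ x ∂ρ, x ∈ Set.Icc (0 : ℝ) 1) :
    ∃ L : Measure ℝ, IsFiniteMeasure L ∧ ∀ (f : ℝ → ℝ) (C : ℝ), IsBdd C f → (∀ x, 0 ≤ f x) →
      ∫ x, f x ∂L = limFunctional b ρ M z (step b ρ M f) / limFunctional b ρ M z alive := by
  obtain ⟨π, hπ, hπi⟩ := H.exists_measure hb hM h01
  have hL := H.one_le_limFunctional_alive
  set T : ℝ × ℝ → ℝ := fun p => p.2 + min p.1 M / b with hT
  have hTm : Measurable T := by fun_prop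
  refine ⟨ENNReal.ofReal (limFunctional b ρ M z alive)⁻¹ •
    ((π.restrict (Set.Ici 1)).prod ρ).map T, ?_, fun f C hf h0 => ?_⟩
  · have : IsFiniteMeasure (((π.restrict (Set.Ici 1)).prod ρ).map T) :=
      Measure.isFiniteMeasure_map _ _
    exact Measure.smul_finite _ ENNReal.ofReal_ne_top
  · rw [integral_smul_measure, ENNReal.toReal_ofReal (inv_nonneg.2 (by linarith)), smul_eq_mul,
      integral_map hTm.aemeasurable hf.meas.aestronglyMeasurable, integral_prod, div_eq_inv_mul]
    · congr 1
      rw [← hπi _ C hf.step (fun x hx => step_of_lt hx) (step_nonneg h0),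
        ← setIntegral_eq_integral_of_forall_compl_eq_zero (s := Set.Ici 1)
          fun x hx => step_of_lt (not_le.1 hx)]
      refine setIntegral_congr_fun measurableSet_Ici fun x hx => ?_
      exact (step_of_le hx).symm
    · exact Integrable.of_bound (hf.meas.comp hTm).aestronglyMeasurable C
        (ae_of_all _ fun p => hf.bdd _)

theorem IsLimitLaw.tendsto_real [IsProbabilityMeasure ρ] {μ : Measure (ℕ → ℝ)}
    (hμ : IsLimitLaw b ρ μ) {k : ℕ} {A : Set (Fin k → ℝ)} (hA : MeasurableSet A) :
    Tendsto (fun n => (condPathLaw b ρ n 1).real {y | (fun i : Fin k => y i) ∈ A}) atTop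
      (𝓝 (μ.real {y | (fun i : Fin k => y i) ∈ A})) := by
  have := hμ.1
  exact (ENNReal.tendsto_toReal (measure_ne_top _ _)).comp (hμ.2 1 le_rfl k A hA)

theorem HasGap.ae_mem_Icc_limitLaw [IsProbabilityMeasure ρ] (H : HasGap b ρ M z φ ε) (hb : 1 < b)
    (hM : 2 ≤ M) (h01 : ∀ᵐ x ∂ρ, x ∈ Set.Icc (0 : ℝ) 1) {μ : Measure (ℕ → ℝ)}
    (hμ : IsLimitLaw b ρ μ) : ∀ᵐ y ∂μ, ∀ i, y i ∈ Set.Icc (0 : ℝ) 1 := by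
  have := hμ.1
  refine ae_all_iff.2 fun i => ?_
  set A : Set (Fin (i + 1) → ℝ) := {w | w (Fin.last i) ∈ Set.Icc (0 : ℝ) 1} with hA
  have hAm : MeasurableSet A := measurableSet_Icc.preimage (measurable_pi_apply _)
  have h1 : μ.real {y | (fun j : Fin (i + 1) => y j) ∈ A} = 1 := by
    refine tendsto_nhds_unique (hμ.tendsto_real hAm) (tendsto_const_nhds.congr' ?_)
    filter_upwards [eventually_gt_atTop 0] with n hn
    have := H.isProbabilityMeasure_condPathLaw hb hM h01 hn le_rfl (by linarith)
    rw [measureReal_def, (mem_ae_iff_prob_eq_one (measurableSet_cylinder hAm)).1]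
    · simp
    · filter_upwards [ae_mem_Icc_condPathLaw h01 n 1] with y hy
      exact hy i
  have h2 : μ {y | (fun j : Fin (i + 1) => y j) ∈ A} = 1 := by
    rwa [measureReal_def, ENNReal.toReal_eq_one_iff] at h1
  exact (mem_ae_iff_prob_eq_one (measurableSet_cylinder hAm)).2 h2

theorem aemeasurable_qInf (hb : 1 < b) {μ : Measure (ℕ → ℝ)}
    (h : ∀ᵐ y ∂μ, ∀ i, y i ∈ Set.Icc (0 : ℝ) 1) : AEMeasurable (qInf b) μ := by
  refine aemeasurable_of_tendsto_metrizable_ae atTop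
    (f := fun k (y : ℕ → ℝ) => ∑ j ∈ Finset.range k, y j / (b : ℝ) ^ j)
    (fun k => Measurable.aemeasurable (by fun_prop)) ?_
  filter_upwards [h] with y hy
  exact tendsto_trunc hb hy

theorem tendsto_real_Ici_sub (hb : 1 < b) (L : Measure ℝ) [IsFiniteMeasure L] (a : ℝ) {c : ℝ}
    (hc : 0 ≤ c) :
    Tendsto (fun k : ℕ => L.real (Set.Ici (a - c / (b : ℝ) ^ k))) atTop (𝓝 (L.real (Set.Ici a))) := by
  have hb1 : (1 : ℝ) < b := by exact_mod_cast hb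
  have hlim : Tendsto (fun k : ℕ => a - c / (b : ℝ) ^ k) atTop (𝓝 a) := by
    have := (tendsto_const_nhds (x := c)).div_atTop (tendsto_pow_atTop_atTop_of_one_lt hb1)
    simpa using tendsto_const_nhds.sub this
  have hmeas := tendsto_measure_iInter_atTop (μ := L)
    (s := fun k : ℕ => Set.Ici (a - c / (b : ℝ) ^ k))
    (fun k => measurableSet_Ici.nullMeasurableSet) (fun k l hkl => Set.Ici_subset_Ici.2 (by
      have : c / (b : ℝ) ^ l ≤ c / (b : ℝ) ^ k := by
        gcongr
        exact hb1.le
      linarith)) ⟨0, measure_ne_top _ _⟩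
  have hI : ⋂ k : ℕ, Set.Ici (a - c / (b : ℝ) ^ k) = Set.Ici a := by
    ext x
    simp only [Set.mem_iInter, Set.mem_Ici]
    refine ⟨fun h => le_of_tendsto' hlim h, fun h k => ?_⟩
    have : 0 ≤ c / (b : ℝ) ^ k := by positivity
    linarith
  rw [hI] at hmeas
  exact (ENNReal.tendsto_toReal (measure_ne_top _ _)).comp hmeas

/-- `Q_∞` depends on infinitely many coordinates, so the convergence on cylinder events does not
apply to it directly. Truncations enclose both it and the finite reversed sums up to `O(b ^ (-k))`;
comparing masses of half-lines and using their continuity from the left identifies the law. -/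
theorem HasGap.map_qInf [IsProbabilityMeasure ρ] (H : HasGap b ρ M z φ ε) (hb : 1 < b)
    (hM : 2 ≤ M) (h01 : ∀ᵐ x ∂ρ, x ∈ Set.Icc (0 : ℝ) 1) {μ : Measure (ℕ → ℝ)}
    (hμ : IsLimitLaw b ρ μ) {L : Measure ℝ} [IsFiniteMeasure L]
    (hL : ∀ (f : ℝ → ℝ) (C : ℝ), IsBdd C f → (∀ x, 0 ≤ f x) →
      ∫ x, f x ∂L = limFunctional b ρ M z (step b ρ M f) / limFunctional b ρ M z alive) :
    μ.map (qInf b) = L := by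
  have hμp := hμ.1
  have hae := H.ae_mem_Icc_limitLaw hb hM h01 hμ
  have hq := aemeasurable_qInf hb hae
  set S : ℕ → (ℕ → ℝ) → ℝ := fun k y => ∑ j ∈ Finset.range k, y j / (b : ℝ) ^ j
  have hLr : ∀ a, L.real (Set.Ici a) = limFunctional b ρ M z (step b ρ M
      ((Set.Ici a).indicator fun _ => 1)) / limFunctional b ρ M z alive := fun a => by
    rw [← hL _ 1 (isBdd_indicator_Ici a) fun x => Set.indicator_nonneg (fun _ _ => zero_le_one) x,
      integral_indicator_const _ measurableSet_Ici, smul_eq_mul, mul_one]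
  have hcyl : ∀ k a, Tendsto (fun n => (condPathLaw b ρ n 1).real {y | a ≤ S k y}) atTop
      (𝓝 (μ.real {y | a ≤ S k y})) := by
    intro k a
    have hA : MeasurableSet {w : Fin k → ℝ | a ≤ ∑ j : Fin k, w j / (b : ℝ) ^ (j : ℕ)} :=
      measurableSet_le measurable_const (by fun_prop)
    have := hμ.tendsto_real hA
    have e : {y : ℕ → ℝ | (fun i : Fin k => y i) ∈
        {w : Fin k → ℝ | a ≤ ∑ j : Fin k, w j / (b : ℝ) ^ (j : ℕ)}} = {y | a ≤ S k y} := by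
      ext y
      simp only [Set.mem_ofPred_eq, S]
      rw [Finset.sum_range]
    rwa [e] at this
  have hupper : ∀ k a, μ.real {y | a ≤ S k y} ≤ L.real (Set.Ici a) := by
    intro k a
    rw [hLr]
    refine le_of_tendsto_of_tendsto (hcyl k a) (H.tendsto_condPathLaw_ge hb hM h01 a) ?_
    filter_upwards [eventually_ge_atTop k, eventually_gt_atTop 0] with n hn hn0
    have := H.isProbabilityMeasure_condPathLaw hb hM h01 hn0 le_rfl (by linarith)
    refine ENNReal.toReal_mono (measure_ne_top _ _) (measure_mono_ae ?_)
    filter_upwards [ae_mem_Icc_condPathLaw h01 n 1] with y hy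
    exact fun h : a ≤ S k y => h.trans (revQ_zero_bounds hb hy hn).1
  have hlower : ∀ k a, L.real (Set.Ici a) ≤ μ.real {y | a - 3 / (b : ℝ) ^ k ≤ S k y} := by
    intro k a
    rw [hLr]
    refine le_of_tendsto_of_tendsto (H.tendsto_condPathLaw_ge hb hM h01 a) (hcyl k _) ?_
    filter_upwards [eventually_ge_atTop k, eventually_gt_atTop 0] with n hn hn0
    have := H.isProbabilityMeasure_condPathLaw hb hM h01 hn0 le_rfl (by linarith)
    refine ENNReal.toReal_mono (measure_ne_top _ _) (measure_mono_ae ?_)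
    filter_upwards [ae_mem_Icc_condPathLaw h01 n 1] with y hy
    intro h
    have h' : a ≤ revQ b 1 n 0 y := h
    have h2 := (revQ_zero_bounds hb hy hn).2
    change a - 3 / (b : ℝ) ^ k ≤ S k y
    simp only [S]; linarith
  have hμm : ∀ a, (μ.map (qInf b)).real (Set.Ici a) = μ.real {y | a ≤ qInf b y} := fun a => by
    rw [measureReal_def, Measure.map_apply_of_aemeasurable hq measurableSet_Ici]; rfl
  have hfinm : IsProbabilityMeasure (μ.map (qInf b)) := Measure.isProbabilityMeasure_map hq
  refine Measure.ext_of_Ici _ _ fun a => ?_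
  rw [← measureReal_eq_measureReal_iff]
  refine le_antisymm ?_ ?_
  · refine ge_of_tendsto' (tendsto_real_Ici_sub hb L a zero_le_two) fun k => ?_
    refine le_trans ?_ (hupper k _)
    rw [hμm]
    refine ENNReal.toReal_mono (measure_ne_top _ _) (measure_mono_ae ?_)
    filter_upwards [hae] with y hy
    intro h
    have h' : a ≤ qInf b y := h
    have h2 := (qInf_bounds hb hy k).2
    change a - 2 / (b : ℝ) ^ k ≤ S k y
    simp only [S]; linarith
  · refine ge_of_tendsto' (tendsto_real_Ici_sub hb (μ.map (qInf b)) a zero_le_three) fun k => ?_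
    refine (hlower k a).trans ?_
    rw [hμm]
    refine ENNReal.toReal_mono (measure_ne_top _ _) (measure_mono_ae ?_)
    filter_upwards [hae] with y hy
    exact fun h : a - 3 / (b : ℝ) ^ k ≤ S k y => h.trans (qInf_bounds hb hy k).1

/-- The constant in terms of the eigenfunction and the limit functional. -/
theorem HasGap.invSqConst_eq [IsProbabilityMeasure ρ] (H : HasGap b ρ M z φ ε) (hb : 1 < b)
    (hM : 2 ≤ M) (h01 : ∀ᵐ x ∂ρ, x ∈ Set.Icc (0 : ℝ) 1) (hlim : IsLimitLaw b ρ (limitLaw b ρ)) :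
    invSqConst b ρ = ((b : ℝ) - 1) / 2 * (z ^ 2 * limFunctional b ρ M z alive *
      limFunctional b ρ M z (fun θ => φ θ ^ 2)) := by
  obtain ⟨L, hLf, hL⟩ := H.exists_qLaw hb hM h01
  have hmap := H.map_qInf hb hM h01 hlim hL
  set μ := limitLaw b ρ
  have hμp : IsProbabilityMeasure μ := hlim.1
  have hae := H.ae_mem_Icc_limitLaw hb hM h01 hlim
  have hq := aemeasurable_qInf hb hae
  have hz := H.eigen.pos
  have hl1 := H.one_le_limFunctional_alive
  have hb2 : (2 : ℝ) ≤ b := by exact_mod_cast hb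
  set l1 := limFunctional b ρ M z alive
  set s : Set (ℕ → ℝ) := {y | 1 ≤ qInf b y} with hs
  have hsm : NullMeasurableSet s μ := hq.nullMeasurableSet_preimage measurableSet_Ici
  have hφ2 : IsBdd 1 fun θ => φ θ ^ 2 := ⟨H.eigen.bdd.meas.pow_const 2, fun x => by
    rw [abs_pow]; exact pow_le_one₀ (abs_nonneg _) (H.eigen.bdd.bdd x)⟩
  have hφ2d : ∀ x < 1, φ x ^ 2 = 0 := fun x hx => by rw [H.eigen.dead x hx]; norm_num
  -- One free step from the normalised left eigenmeasure stays alive with probability equal to the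
  -- eigenvalue.
  have hμs : μ.real s = z := by
    have e1 : μ.real s = L.real (Set.Ici 1) := by
      rw [← hmap, measureReal_def, measureReal_def,
        Measure.map_apply_of_aemeasurable hq measurableSet_Ici]
      rfl
    have e2 : ∫ x, alive x ∂L = L.real (Set.Ici 1) := by
      have : alive = (Set.Ici (1 : ℝ)).indicator fun _ => 1 := by
        ext x; simp [alive, Set.indicator_apply]
      rw [this, integral_indicator_const _ measurableSet_Ici, smul_eq_mul, mul_one]
    rw [e1, ← e2, hL _ 1 isBdd_alive alive_nonneg,
      H.limFunctional_step isBdd_alive fun _ => alive_of_lt]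
    exact mul_div_cancel_right₀ _ (by positivity)
  have hint : ∫ y in s, (∫ x, psi b ρ (x + qInf b y / b) ∂ρ) ^ 2 ∂μ =
      (l1 * z) ^ 2 * (z * limFunctional b ρ M z (fun θ => φ θ ^ 2) / l1) := by
    have e1 : ∫ y in s, (∫ x, psi b ρ (x + qInf b y / b) ∂ρ) ^ 2 ∂μ =
        ∫ y in s, (l1 * z) ^ 2 * φ (qInf b y) ^ 2 ∂μ := by
      refine integral_congr_ae ?_
      filter_upwards [ae_restrict_of_ae hae, ae_restrict_mem₀ hsm] with y hy hys
      have hys' : 1 ≤ qInf b y := hys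
      have hq2 : qInf b y ≤ 2 := by simpa using (qInf_bounds hb hy 0).2
      -- As `Q_∞ ≤ 2`, the argument of `psi` is at most `2 ≤ M`; there `psi` is a multiple of `φ`,
      -- and the integral is the eigenvalue equation.
      have e3 : ∫ x, psi b ρ (x + qInf b y / b) ∂ρ = l1 * (z * φ (qInf b y)) := by
        rw [← congrFun H.eigen.eq (qInf b y), step_of_le hys', min_eq_left (hq2.trans hM),
          ← integral_const_mul]
        refine integral_congr_ae ?_
        filter_upwards [h01] with x hx
        refine H.psi_eq hb hM h01 ?_
        have : qInf b y / b ≤ 2 / 2 := div_le_div₀ zero_le_two hq2 zero_lt_two hb2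
        linarith [hx.2]
      rw [e3]; ring
    have e2 : ∫ y in s, (l1 * z) ^ 2 * φ (qInf b y) ^ 2 ∂μ =
        ∫ y, (l1 * z) ^ 2 * φ (qInf b y) ^ 2 ∂μ :=
      setIntegral_eq_integral_of_forall_compl_eq_zero fun y hy => by
        rw [hφ2d _ (not_le.1 hy), mul_zero]
    rw [e1, e2, integral_const_mul]
    congr 1
    rw [← integral_map hq (f := fun q => φ q ^ 2) hφ2.meas.aestronglyMeasurable, hmap,
      hL _ 1 hφ2 fun x => sq_nonneg _, H.limFunctional_step hφ2 hφ2d]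
  have hcond : cond μ s = (μ s)⁻¹ • μ.restrict s := rfl
  rw [invSqConst, hcond, integral_smul_measure, hint, ENNReal.toReal_inv, ← measureReal_def, hμs,
    smul_eq_mul]
  congr 1
  have : l1 ≠ 0 := by positivity
  field_simp

end

/-! ### Polynomial bounds -/

/-- A quadratic bound without a cubic remainder, usable before `u` is known to be small. The sharp
second coefficient enters only through the next two lemmas. -/
theorem le_one_sub_pow {u : ℝ} (h1 : u ≤ 1) {n : ℕ} (hn : 1 ≤ n) :
    1 - n * u + (n - 1) * u ^ 2 ≤ (1 - u) ^ n := by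
  induction n, hn using Nat.le_induction with
  | base => simp
  | succ n hn ih =>
    have hn' : (1 : ℝ) ≤ n := by exact_mod_cast hn
    have h2 := mul_le_mul_of_nonneg_right ih (sub_nonneg.2 h1)
    have h3 : 0 ≤ (n - 1 : ℝ) * u ^ 2 * (1 - u) :=
      mul_nonneg (mul_nonneg (by linarith) (sq_nonneg u)) (by linarith)
    rw [pow_succ (1 - u)]
    push_cast
    nlinarith

theorem one_sub_pow_le {u : ℝ} (h0 : 0 ≤ u) (h1 : u ≤ 1) (n : ℕ) :
    (1 - u) ^ n ≤ 1 - n * u + n * (n - 1) / 2 * u ^ 2 := by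
  induction n with
  | zero => simp
  | succ n ih =>
    have h2 := mul_le_mul_of_nonneg_right ih (sub_nonneg.2 h1)
    have h3 : 0 ≤ (n * (n - 1) / 2 : ℝ) * u ^ 3 := by
      refine mul_nonneg ?_ (by positivity)
      rcases Nat.eq_zero_or_pos n with rfl | hn
      · simp
      · have hn' : (1 : ℝ) ≤ n := by exact_mod_cast hn
        exact div_nonneg (mul_nonneg (by linarith) (by linarith)) zero_le_two
    rw [pow_succ (1 - u)]
    push_cast
    linear_combination h2 + h3

theorem le_one_sub_pow_cubic {u : ℝ} (h0 : 0 ≤ u) (h1 : u ≤ 1) (n : ℕ) :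
    1 - n * u + n * (n - 1) / 2 * u ^ 2 - n ^ 3 * u ^ 3 ≤ (1 - u) ^ n := by
  induction n with
  | zero => simp
  | succ n ih =>
    have h2 := mul_le_mul_of_nonneg_right ih (sub_nonneg.2 h1)
    have hn : (0 : ℝ) ≤ n := Nat.cast_nonneg n
    have h3 : 0 ≤ ((n : ℝ) ^ 3 * u ^ 4 + (5 / 2 * n ^ 2 + 7 / 2 * n + 1) * u ^ 3) := by positivity
    rw [pow_succ (1 - u)]
    push_cast
    linear_combination h2 + h3

/-! ### Test functions -/

/-- Bounded measurable functions that vanish below one. -/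
def IsTest (f : ℝ → ℝ) : Prop := (∃ C, IsBdd C f) ∧ ∀ x < 1, f x = 0

theorem IsTest.add {f g : ℝ → ℝ} (hf : IsTest f) (hg : IsTest g) : IsTest fun x => f x + g x := by
  obtain ⟨⟨C, hC⟩, hf⟩ := hf
  obtain ⟨⟨D, hD⟩, hg⟩ := hg
  exact ⟨⟨_, hC.add hD⟩, fun x hx => by simp only [hf x hx, hg x hx, add_zero]⟩

theorem IsTest.sub {f g : ℝ → ℝ} (hf : IsTest f) (hg : IsTest g) : IsTest fun x => f x - g x := by
  obtain ⟨⟨C, hC⟩, hf⟩ := hf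
  obtain ⟨⟨D, hD⟩, hg⟩ := hg
  exact ⟨⟨_, hC.sub hD⟩, fun x hx => by simp only [hf x hx, hg x hx, sub_zero]⟩

theorem IsTest.const_mul {f : ℝ → ℝ} (hf : IsTest f) (a : ℝ) : IsTest fun x => a * f x := by
  obtain ⟨⟨C, hC⟩, hf⟩ := hf
  exact ⟨⟨_, hC.const_mul a⟩, fun x hx => by simp only [hf x hx, mul_zero]⟩

theorem IsTest.sq {f : ℝ → ℝ} (hf : IsTest f) : IsTest fun x => f x ^ 2 := by
  obtain ⟨⟨C, hC⟩, hf⟩ := hf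
  refine ⟨⟨C ^ 2, hC.meas.pow_const 2, fun x => ?_⟩, fun x hx => by simp only [hf x hx]; norm_num⟩
  rw [abs_pow]
  exact pow_le_pow_left₀ (abs_nonneg _) (hC.bdd x) 2

theorem isTest_alive : IsTest alive := ⟨⟨1, isBdd_alive⟩, fun _ => alive_of_lt⟩

section

variable {b : ℕ} {ρ : Measure ℝ} {M z : ℝ} {φ : ℝ → ℝ} {ε : ℕ → ℝ}

theorem IsTest.step [IsProbabilityMeasure ρ] {f : ℝ → ℝ} (hf : IsTest f) :
    IsTest (step b ρ M f) :=
  ⟨⟨_, hf.1.choose_spec.step⟩, fun _ hx => step_of_lt hx⟩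

theorem HasGap.isTest (H : HasGap b ρ M z φ ε) : IsTest φ := ⟨⟨1, H.eigen.bdd⟩, H.eigen.dead⟩

theorem HasGap.ell_add [IsProbabilityMeasure ρ] (H : HasGap b ρ M z φ ε) {f g : ℝ → ℝ}
    (hf : IsTest f) (hg : IsTest g) : limFunctional b ρ M z (fun x => f x + g x) =
      limFunctional b ρ M z f + limFunctional b ρ M z g :=
  H.limFunctional_add hf.1.choose_spec hf.2 hg.1.choose_spec hg.2

theorem HasGap.ell_sub [IsProbabilityMeasure ρ] (H : HasGap b ρ M z φ ε) {f g : ℝ → ℝ}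
    (hf : IsTest f) (hg : IsTest g) : limFunctional b ρ M z (fun x => f x - g x) =
      limFunctional b ρ M z f - limFunctional b ρ M z g :=
  H.limFunctional_sub hf.1.choose_spec hf.2 hg.1.choose_spec hg.2

theorem HasGap.ell_const_mul (H : HasGap b ρ M z φ ε) {f : ℝ → ℝ}
    (hf : IsTest f) (a : ℝ) : limFunctional b ρ M z (fun x => a * f x) =
      a * limFunctional b ρ M z f :=
  H.limFunctional_const_mul hf.1.choose_spec hf.2 a

theorem HasGap.ell_mono [IsProbabilityMeasure ρ] (H : HasGap b ρ M z φ ε) {f g : ℝ → ℝ}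
    (hf : IsTest f) (hg : IsTest g) (h : ∀ x, f x ≤ g x) :
    limFunctional b ρ M z f ≤ limFunctional b ρ M z g :=
  H.limFunctional_mono hf.1.choose_spec hf.2 hg.1.choose_spec hg.2 h

theorem HasGap.ell_nonneg (H : HasGap b ρ M z φ ε) {f : ℝ → ℝ}
    (hf : IsTest f) (h : ∀ x, 0 ≤ f x) : 0 ≤ limFunctional b ρ M z f :=
  H.limFunctional_nonneg hf.1.choose_spec hf.2 h

theorem HasGap.ell_step [IsProbabilityMeasure ρ] (H : HasGap b ρ M z φ ε) {f : ℝ → ℝ}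
    (hf : IsTest f) : limFunctional b ρ M z (Avalanche.step b ρ M f) =
      z * limFunctional b ρ M z f :=
  H.limFunctional_step hf.1.choose_spec hf.2

theorem HasGap.abs_ell_sub_le [IsProbabilityMeasure ρ] (H : HasGap b ρ M z φ ε) {f g : ℝ → ℝ}
    (hf : IsTest f) (hg : IsTest g) {c : ℝ} (h : ∀ x, 1 ≤ x → |f x - g x| ≤ c) :
    |limFunctional b ρ M z f - limFunctional b ρ M z g| ≤ c * limFunctional b ρ M z alive := by
  have h' : ∀ x, |f x - g x| ≤ c * alive x := fun x => by
    rcases lt_or_ge x 1 with hx | hx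
    · rw [hf.2 x hx, hg.2 x hx, alive_of_lt hx]; simp
    · rw [alive_of_le hx, mul_one]; exact h x hx
  have h1 := H.ell_mono hf (hg.add (isTest_alive.const_mul c)) fun x => by
    linarith [(abs_le.1 (h' x)).2]
  have h2 := H.ell_mono hg (hf.add (isTest_alive.const_mul c)) fun x => by
    linarith [(abs_le.1 (h' x)).1]
  rw [H.ell_add hg (isTest_alive.const_mul c), H.ell_const_mul isTest_alive] at h1
  rw [H.ell_add hf (isTest_alive.const_mul c), H.ell_const_mul isTest_alive] at h2
  rw [abs_le]
  constructor <;> linarith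

theorem HasGap.pow_mul_iterate_alive_le [IsProbabilityMeasure ρ] (H : HasGap b ρ M z φ ε) (n : ℕ)
    (θ : ℝ) : (z ^ n)⁻¹ * (Avalanche.step b ρ M)^[n] alive θ ≤ 1 / φ 1 := by
  have h1 := H.eigen.one_mul_iterate_alive_le n θ
  have hz := pow_pos H.eigen.pos n
  rw [inv_mul_le_iff₀ hz, mul_one_div, le_div_iff₀ H.one_pos]
  have h2 : z ^ n * φ θ ≤ z ^ n * 1 := mul_le_mul_of_nonneg_left (H.eigen.le_one θ) hz.le
  linarith

/-- A function that is almost invariant is close to its normalised iterates. -/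
theorem HasGap.le_iterate_of_le [IsProbabilityMeasure ρ] (H : HasGap b ρ M z φ ε) {f : ℝ → ℝ}
    (hf : IsTest f) {c : ℝ} (hc : 0 ≤ c) (h : ∀ x, f x ≤ z⁻¹ * Avalanche.step b ρ M f x + c * alive x)
    (n : ℕ) (x : ℝ) :
    f x ≤ (z ^ n)⁻¹ * (Avalanche.step b ρ M)^[n] f x + n * (c / φ 1) := by
  obtain ⟨C, hC⟩ := hf.1
  induction n with
  | zero => simp
  | succ n ih =>
    have h1 := iterate_mono (b := b) (ρ := ρ) (M := M) hC
      ((hC.step (b := b) (ρ := ρ) (M := M)).const_mul z⁻¹ |>.add (isBdd_alive.const_mul c)) h n x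
    rw [iterate_add ((hC.step (b := b) (ρ := ρ) (M := M)).const_mul z⁻¹) (isBdd_alive.const_mul c),
      iterate_const_mul, iterate_const_mul, ← Function.iterate_succ_apply] at h1
    have hz := pow_pos H.eigen.pos n
    have h2 := mul_le_mul_of_nonneg_left h1 (inv_pos.2 hz).le
    have h3 := mul_le_mul_of_nonneg_left (H.pow_mul_iterate_alive_le n x) hc
    have h4 : (z ^ (n + 1))⁻¹ * (Avalanche.step b ρ M)^[n + 1] f x =
        (z ^ n)⁻¹ * (z⁻¹ * (Avalanche.step b ρ M)^[n.succ] f x) := by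
      rw [pow_succ, mul_inv, mul_assoc]
    rw [h4]
    push_cast
    have h5 : (z ^ n)⁻¹ * (z⁻¹ * (Avalanche.step b ρ M)^[n.succ] f x +
        c * (Avalanche.step b ρ M)^[n] alive x) =
        (z ^ n)⁻¹ * (z⁻¹ * (Avalanche.step b ρ M)^[n.succ] f x) +
          c * ((z ^ n)⁻¹ * (Avalanche.step b ρ M)^[n] alive x) := by ring
    have h6 : c * (1 / φ 1) = c / φ 1 := by ring
    rw [h5] at h2
    linarith

theorem HasGap.iterate_le_of_le [IsProbabilityMeasure ρ] (H : HasGap b ρ M z φ ε) {f : ℝ → ℝ}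
    (hf : IsTest f) {c : ℝ} (hc : 0 ≤ c) (h : ∀ x, z⁻¹ * Avalanche.step b ρ M f x ≤ f x + c * alive x)
    (n : ℕ) (x : ℝ) :
    (z ^ n)⁻¹ * (Avalanche.step b ρ M)^[n] f x ≤ f x + n * (c / φ 1) := by
  have h1 := H.le_iterate_of_le (hf.const_mul (-1)) hc (fun x => by
    have := h x
    rw [step_const_mul]
    linarith) n x
  rw [iterate_const_mul] at h1
  linarith

end

/-! ### The critical asymptotics of solutions of the recursion -/

/-- `F` solves, on `[1, ∞)`, the equation for the probability that an avalanche meets a green site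
when the sites are green with probability `l`. -/
structure IsHit (b : ℕ) (ρ : Measure ℝ) (M l : ℝ) (F : ℝ → ℝ) : Prop where
  pos : 0 < l
  le_one : l ≤ 1
  meas : Measurable F
  nonneg : ∀ x, 0 ≤ F x
  le_alive : ∀ x, F x ≤ alive x
  eq : ∀ θ, 1 ≤ θ → F θ = 1 - (1 - l) * (1 - (l * (alive θ - step b ρ M alive θ) +
    step b ρ M F θ)) ^ b

/-- The probability that the part of the avalanche in one given branch meets a green site. -/
noncomputable def branchHit (b : ℕ) (ρ : Measure ℝ) (M l : ℝ) (F : ℝ → ℝ) (θ : ℝ) : ℝ :=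
  l * (alive θ - step b ρ M alive θ) + step b ρ M F θ

section

variable {b : ℕ} {ρ : Measure ℝ} {M : ℝ} {φ : ℝ → ℝ} {ε : ℕ → ℝ} {l : ℝ} {F : ℝ → ℝ}

theorem IsHit.isBdd (h : IsHit b ρ M l F) : IsBdd 1 F :=
  ⟨h.meas, fun x => by
    rw [abs_of_nonneg (h.nonneg x)]; exact (h.le_alive x).trans (alive_le_one x)⟩

theorem IsHit.dead (h : IsHit b ρ M l F) : ∀ x < 1, F x = 0 := fun x hx =>
  le_antisymm ((h.le_alive x).trans (alive_of_lt hx).le) (h.nonneg x)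

theorem IsHit.isTest (h : IsHit b ρ M l F) : IsTest F := ⟨⟨1, h.isBdd⟩, h.dead⟩

theorem step_alive_le [IsProbabilityMeasure ρ] (x : ℝ) : step b ρ M alive x ≤ alive x := by
  rcases lt_or_ge x 1 with hx | hx
  · rw [step_of_lt hx, alive_of_lt hx]
  · rw [alive_of_le hx]
    exact (le_abs_self _).trans ((isBdd_alive.step (b := b) (ρ := ρ) (M := M)).bdd x)

theorem IsHit.isTest_branchHit [IsProbabilityMeasure ρ] (h : IsHit b ρ M l F) :
    IsTest (branchHit b ρ M l F) :=
  ((isTest_alive.sub isTest_alive.step).const_mul l).add h.isTest.step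

theorem IsHit.branchHit_nonneg [IsProbabilityMeasure ρ] (h : IsHit b ρ M l F) (x : ℝ) :
    0 ≤ branchHit b ρ M l F x :=
  add_nonneg (mul_nonneg h.pos.le (sub_nonneg.2 (step_alive_le x))) (step_nonneg h.nonneg x)

theorem IsHit.branchHit_le_alive [IsProbabilityMeasure ρ] (h : IsHit b ρ M l F) (x : ℝ) :
    branchHit b ρ M l F x ≤ alive x := by
  have h1 := step_mono (b := b) (ρ := ρ) (M := M) h.isBdd isBdd_alive h.le_alive x
  have h2 := step_alive_le (b := b) (ρ := ρ) (M := M) x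
  have := mul_le_mul_of_nonneg_right h.le_one (sub_nonneg.2 h2)
  rw [branchHit]; linarith

theorem IsHit.branchHit_le_one [IsProbabilityMeasure ρ] (h : IsHit b ρ M l F) (x : ℝ) :
    branchHit b ρ M l F x ≤ 1 :=
  (h.branchHit_le_alive x).trans (alive_le_one x)

theorem IsHit.branchHit_le_add [IsProbabilityMeasure ρ] (h : IsHit b ρ M l F) (x : ℝ) :
    branchHit b ρ M l F x ≤ l * alive x + step b ρ M F x := by
  have h2 := step_nonneg (b := b) (ρ := ρ) (M := M) alive_nonneg x
  rw [branchHit]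
  nlinarith [h.pos]

theorem IsHit.le_sq [IsProbabilityMeasure ρ] (h : IsHit b ρ M l F) (hb : 1 < b) (x : ℝ) :
    F x ≤ l * alive x + b * branchHit b ρ M l F x - (b - 1) * branchHit b ρ M l F x ^ 2 := by
  have hb1 : (1 : ℝ) ≤ b := by exact_mod_cast hb.le
  rcases lt_or_ge x 1 with hx | hx
  · rw [h.dead x hx, h.isTest_branchHit.2 x hx, alive_of_lt hx]; simp
  rw [h.eq x hx, ← branchHit, alive_of_le hx]
  have h0 := h.branchHit_nonneg x
  have h1 := h.branchHit_le_one x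
  set u := branchHit b ρ M l F x
  have h2 := mul_le_mul_of_nonneg_left (le_one_sub_pow h1 hb.le) (sub_nonneg.2 h.le_one)
  have h3 : 0 ≤ b * u - (b - 1) * u ^ 2 := by
    have := mul_nonneg (mul_nonneg (sub_nonneg.2 hb1) h0) (sub_nonneg.2 h1)
    linarith
  have h4 := mul_nonneg h.pos.le h3
  linarith

/-- Here criticality enters: `b` branches times the eigenvalue `1 / b` reproduce `ℓ(F)` exactly, so
it cancels whenever the recursion is integrated. -/
theorem IsHit.limFunctional_branchHit [IsProbabilityMeasure ρ]
    (H : HasGap b ρ M (1 / (b : ℝ)) φ ε) (hb : 1 < b) (h : IsHit b ρ M l F) :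
    b * limFunctional b ρ M (1 / (b : ℝ)) (branchHit b ρ M l F) =
      l * (b - 1) * limFunctional b ρ M (1 / (b : ℝ)) alive +
        limFunctional b ρ M (1 / (b : ℝ)) F := by
  have hb0 : (b : ℝ) ≠ 0 := by positivity
  have e : limFunctional b ρ M (1 / (b : ℝ)) (branchHit b ρ M l F) = _ :=
    H.ell_add ((isTest_alive.sub isTest_alive.step).const_mul l) h.isTest.step
  rw [e, H.ell_const_mul (isTest_alive.sub isTest_alive.step),
    H.ell_sub isTest_alive isTest_alive.step, H.ell_step isTest_alive, H.ell_step h.isTest]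
  field_simp

/-- The order of magnitude of the integrals. -/
theorem IsHit.limFunctional_le [IsProbabilityMeasure ρ]
    (H : HasGap b ρ M (1 / (b : ℝ)) φ ε) (hb : 1 < b) (h : IsHit b ρ M l F) :
    limFunctional b ρ M (1 / (b : ℝ)) F ≤
      3 * b * limFunctional b ρ M (1 / (b : ℝ)) alive * √l := by
  have hb2 : (2 : ℝ) ≤ b := by exact_mod_cast hb
  have hu := h.isTest_branchHit
  have hL := H.one_le_limFunctional_alive
  have hlb := h.limFunctional_branchHit H hb
  set ℓ := limFunctional b ρ M (1 / (b : ℝ))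
  have hs : 0 < √l := Real.sqrt_pos.2 h.pos
  have hss : √l * √l = l := Real.mul_self_sqrt h.pos.le
  have h1 := H.ell_mono h.isTest (((isTest_alive.const_mul l).add (hu.const_mul b)).sub
    (hu.sq.const_mul (b - 1))) (h.le_sq hb)
  rw [H.ell_sub ((isTest_alive.const_mul l).add (hu.const_mul b)) (hu.sq.const_mul (b - 1)),
    H.ell_add (isTest_alive.const_mul l) (hu.const_mul b), H.ell_const_mul isTest_alive,
    H.ell_const_mul hu, H.ell_const_mul hu.sq] at h1
  -- After the cancellation `(b - 1) ℓ(u²) ≤ b ℓ(alive) l` is left, and `b ≤ 2 (b - 1)`.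
  have h2 : ℓ (fun x => branchHit b ρ M l F x ^ 2) ≤ 2 * ℓ alive * l := by
    have h3 : ((b : ℝ) - 1) * ℓ (fun x => branchHit b ρ M l F x ^ 2) ≤
        ((b : ℝ) - 1) * (2 * ℓ alive * l) := by
      have : 0 ≤ ℓ alive * l * (b - 2) :=
        mul_nonneg (mul_nonneg (by linarith) h.pos.le) (by linarith)
      linarith
    exact le_of_mul_le_mul_left h3 (by linarith)
  -- The inequality `u ≤ √l + u² / √l` passes from the second moment to the first.
  have h3 := H.ell_mono hu ((isTest_alive.const_mul (√l)).add (hu.sq.const_mul (√l)⁻¹)) fun x => by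
    rcases lt_or_ge x 1 with hx | hx
    · rw [hu.2 x hx, alive_of_lt hx]; simp
    · rw [alive_of_le hx, mul_one, ← mul_le_mul_iff_right₀ hs, mul_add, ← mul_assoc,
        mul_inv_cancel₀ hs.ne', one_mul]
      nlinarith [sq_nonneg (√l - branchHit b ρ M l F x), h.branchHit_nonneg x]
  rw [H.ell_add (isTest_alive.const_mul (√l)) (hu.sq.const_mul (√l)⁻¹),
    H.ell_const_mul isTest_alive, H.ell_const_mul hu.sq] at h3
  have h4 : (√l)⁻¹ * ℓ (fun x => branchHit b ρ M l F x ^ 2) ≤ 2 * ℓ alive * √l := by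
    rw [inv_mul_le_iff₀ hs]
    rw [show √l * (2 * ℓ alive * √l) = 2 * ℓ alive * (√l * √l) by ring, hss]
    exact h2
  have h5 : ℓ (branchHit b ρ M l F) ≤ 3 * ℓ alive * √l := by
    change ℓ (branchHit b ρ M l F) ≤ _ at h3
    linarith
  have h6 : 0 ≤ l * (b - 1) * ℓ alive :=
    mul_nonneg (mul_nonneg h.pos.le (by linarith)) (by linarith)
  have h7 := mul_le_mul_of_nonneg_left h5 (by linarith : (0 : ℝ) ≤ b)
  linarith

/-- Solutions are uniformly of the order of the square root of the density of green sites. -/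
theorem HasGap.exists_isHit_le [IsProbabilityMeasure ρ]
    (H : HasGap b ρ M (1 / (b : ℝ)) φ ε) (hb : 1 < b) :
    ∃ R > 0, ∀ l F, IsHit b ρ M l F → ∀ x, F x ≤ R * √l := by
  have hb2 : (2 : ℝ) ≤ b := by exact_mod_cast hb
  -- With this fixed `n` the gap error is at most half the current uniform bound on `F`. Each round
  -- halves that bound up to a term `O(√l)`, and iterating leaves only twice this term.
  obtain ⟨n, hn⟩ := (H.lim.eventually (ge_mem_nhds (show (0 : ℝ) < 1 / 2 by norm_num))).exists
  have hL := H.one_le_limFunctional_alive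
  have hφ := H.one_pos
  set L := limFunctional b ρ M (1 / (b : ℝ)) alive
  refine ⟨2 * (3 * b * L + n * ((b + 1) / φ 1)), by positivity, fun l F h => ?_⟩
  have hs0 : 0 ≤ √l := Real.sqrt_nonneg l
  have hls : l ≤ √l := by
    have h1 : √l ≤ 1 := Real.sqrt_le_one.2 h.le_one
    nlinarith [Real.mul_self_sqrt h.pos.le, Real.sqrt_nonneg l]
  have hit : ∀ x, F x ≤ (1 / (b : ℝ))⁻¹ * step b ρ M F x + ((b + 1) * l) * alive x := fun x => by
    have h1 := h.le_sq hb x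
    have h2 := mul_le_mul_of_nonneg_left (h.branchHit_le_add x) (by linarith : (0 : ℝ) ≤ b)
    have h3 : 0 ≤ ((b : ℝ) - 1) * branchHit b ρ M l F x ^ 2 :=
      mul_nonneg (by linarith) (sq_nonneg _)
    rw [one_div, inv_inv]
    linarith
  have h1 := H.le_iterate_of_le h.isTest (by have := h.pos; positivity) hit n
  have h2 := h.limFunctional_le H hb
  have h20 := H.ell_nonneg h.isTest h.nonneg
  have hround : ∀ s, (∀ x, F x ≤ s) → ∀ x, F x ≤ s / 2 + (3 * b * L + n * ((b + 1) / φ 1)) * √l := by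
    intro s hs x
    have hbd : IsBdd s F := ⟨h.meas, fun y => by rw [abs_of_nonneg (h.nonneg y)]; exact hs y⟩
    have h3 := (abs_le.1 (H.conv F s hbd h.dead n x)).2
    have h4 : s * ε n ≤ s * (1 / 2) := mul_le_mul_of_nonneg_left hn hbd.nonneg
    have h5 : limFunctional b ρ M (1 / (b : ℝ)) F * φ x ≤ limFunctional b ρ M (1 / (b : ℝ)) F :=
      mul_le_of_le_one_right h20 (H.eigen.le_one x)
    have h6 : n * ((b + 1) * l / φ 1) ≤ n * ((b + 1) / φ 1) * √l := by
      rw [mul_assoc, div_mul_eq_mul_div]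
      gcongr
    have := h1 x
    linarith
  have hall : ∀ k : ℕ, ∀ x, F x ≤
      (1 / 2) ^ k + 2 * (3 * b * L + n * ((b + 1) / φ 1)) * √l := by
    intro k
    induction k with
    | zero =>
      intro x
      have : 0 ≤ 2 * (3 * b * L + n * ((b + 1) / φ 1)) * √l := by positivity
      linarith [h.le_alive x, alive_le_one x, pow_zero (1 / 2 : ℝ)]
    | succ k ih =>
      intro x
      have := hround _ ih x
      rw [pow_succ]
      linarith
  intro x
  have hlim : Tendsto (fun k : ℕ => (1 / 2 : ℝ) ^ k +
      2 * (3 * b * L + n * ((b + 1) / φ 1)) * √l) atTop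
      (𝓝 (0 + 2 * (3 * b * L + n * ((b + 1) / φ 1)) * √l)) :=
    (tendsto_pow_atTop_nhds_zero_of_lt_one (by norm_num) (by norm_num)).add_const _
  rw [zero_add] at hlim
  exact ge_of_tendsto' hlim fun k => hall k x

theorem IsHit.branchHit_le_sqrt [IsProbabilityMeasure ρ] (h : IsHit b ρ M l F) {R : ℝ}
    (hR : ∀ x, F x ≤ R * √l) (x : ℝ) : branchHit b ρ M l F x ≤ (1 + R) * √l := by
  have hbd : IsBdd (R * √l) F := ⟨h.meas, fun y => by rw [abs_of_nonneg (h.nonneg y)]; exact hR y⟩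
  have h1 := (le_abs_self _).trans ((hbd.step (b := b) (ρ := ρ) (M := M)).bdd x)
  have h2 := h.branchHit_le_add x
  have h3 := mul_le_of_le_one_right h.pos.le (alive_le_one x)
  have h4 : l ≤ √l := by
    have h1 : √l ≤ 1 := Real.sqrt_le_one.2 h.le_one
    nlinarith [Real.mul_self_sqrt h.pos.le, Real.sqrt_nonneg l]
  linarith

/-- Solutions are close to multiples of the eigenfunction. -/
theorem HasGap.exists_isHit_sub_le [IsProbabilityMeasure ρ]
    (H : HasGap b ρ M (1 / (b : ℝ)) φ ε) (hb : 1 < b) {R : ℝ} (hR0 : 0 < R)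
    (hR : ∀ l F, IsHit b ρ M l F → ∀ x, F x ≤ R * √l) :
    ∃ K > 0, ∀ l F, IsHit b ρ M l F → ∀ (n : ℕ) (x : ℝ),
      |F x - limFunctional b ρ M (1 / (b : ℝ)) F * φ x| ≤ n * (K * l) + R * √l * ε n := by
  have hb2 : (2 : ℝ) ≤ b := by exact_mod_cast hb
  have hφ := H.one_pos
  set K : ℝ := (1 + 2 * b + b ^ 2 * (1 + R) ^ 2) with hK
  have hK0 : 0 < K := by positivity
  refine ⟨K / φ 1, by positivity, fun l F h n x => ?_⟩
  have hl := h.pos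
  have hKl : 0 ≤ K * l := by positivity
  have hup : ∀ x, F x ≤ (1 / (b : ℝ))⁻¹ * step b ρ M F x + (K * l) * alive x := fun x => by
    have h1 := h.le_sq hb x
    have h2 := mul_le_mul_of_nonneg_left (h.branchHit_le_add x) (by linarith : (0 : ℝ) ≤ b)
    have h3 : 0 ≤ ((b : ℝ) - 1) * branchHit b ρ M l F x ^ 2 :=
      mul_nonneg (by linarith) (sq_nonneg _)
    have h4 : (1 + b) * l * alive x ≤ K * l * alive x := by
      have := alive_nonneg x
      gcongr
      rw [hK]; nlinarith [sq_nonneg ((b : ℝ) * (1 + R))]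
    rw [one_div, inv_inv]
    linarith
  -- The quadratic loss is `O(l)` since `u = O(√l)`; thus `F` is invariant under `b T` up to `O(l)`
  -- in both directions.
  have hlow : ∀ x, (1 / (b : ℝ))⁻¹ * step b ρ M F x ≤ F x + (K * l) * alive x := fun x => by
    rw [one_div, inv_inv]
    rcases lt_or_ge x 1 with hx | hx
    · rw [step_of_lt hx, h.dead x hx, alive_of_lt hx]; simp
    rw [alive_of_le hx, mul_one, h.eq x hx, ← branchHit]
    have h0 := h.branchHit_nonneg x
    have h1 := h.branchHit_le_one x
    have h2 := h.branchHit_le_sqrt (hR l F h) x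
    have h3 : step b ρ M F x ≤ branchHit b ρ M l F x :=
      le_add_of_nonneg_left (mul_nonneg hl.le (sub_nonneg.2 (step_alive_le x)))
    set u := branchHit b ρ M l F x
    have h4 := mul_le_mul_of_nonneg_left (one_sub_pow_le h0 h1 b) (sub_nonneg.2 h.le_one)
    have h5 : u ^ 2 ≤ (1 + R) ^ 2 * l := by
      have := pow_le_pow_left₀ h0 h2 2
      rwa [mul_pow, Real.sq_sqrt hl.le] at this
    have h6 : (b : ℝ) * (b - 1) / 2 * u ^ 2 ≤ b ^ 2 * ((1 + R) ^ 2 * l) := by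
      have h7 : (b : ℝ) * (b - 1) / 2 ≤ b ^ 2 := by nlinarith
      exact mul_le_mul h7 h5 (sq_nonneg u) (by positivity)
    have h8 : (1 - l) * ((b : ℝ) * (b - 1) / 2 * u ^ 2) ≤ (b : ℝ) * (b - 1) / 2 * u ^ 2 := by
      refine mul_le_of_le_one_left ?_ (by linarith)
      exact mul_nonneg (div_nonneg (mul_nonneg (by linarith) (by linarith)) zero_le_two)
        (sq_nonneg u)
    have h9 : (b : ℝ) * step b ρ M F x ≤ b * u := mul_le_mul_of_nonneg_left h3 (by linarith)
    have h10 : l * (b * u) ≤ l * b := by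
      have : (b : ℝ) * u ≤ b := mul_le_of_le_one_right (by linarith) h1
      exact mul_le_mul_of_nonneg_left this hl.le
    have h11 : K * l = l + 2 * (l * b) + b ^ 2 * ((1 + R) ^ 2 * l) := by rw [hK]; ring
    have h12 : 0 ≤ l * b := by positivity
    rw [h11]
    linarith
  have h1 := H.le_iterate_of_le h.isTest hKl hup n x
  have h2 := H.iterate_le_of_le h.isTest hKl hlow n x
  have hbd : IsBdd (R * √l) F :=
    ⟨h.meas, fun y => by rw [abs_of_nonneg (h.nonneg y)]; exact hR l F h y⟩
  have h3 := abs_le.1 (H.conv F _ hbd h.dead n x)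
  have h4 : K / φ 1 * l = K * l / φ 1 := by ring
  rw [h4, abs_le]
  constructor <;> linarith [h3.1, h3.2]

/-- The balance equation to the second order. -/
theorem HasGap.exists_isHit_balance [IsProbabilityMeasure ρ]
    (H : HasGap b ρ M (1 / (b : ℝ)) φ ε) (hb : 1 < b) {R : ℝ} (hR0 : 0 < R)
    (hR : ∀ l F, IsHit b ρ M l F → ∀ x, F x ≤ R * √l) :
    ∃ K > 0, ∀ l F, IsHit b ρ M l F →
      |b * limFunctional b ρ M (1 / (b : ℝ)) alive * l - b * (b - 1) / 2 *
        limFunctional b ρ M (1 / (b : ℝ)) (fun x => branchHit b ρ M l F x ^ 2)| ≤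
          K * (l * √l) := by
  have hb2 : (2 : ℝ) ≤ b := by exact_mod_cast hb
  have hL := H.one_le_limFunctional_alive
  set ℓ := limFunctional b ρ M (1 / (b : ℝ)) with hℓ
  set K : ℝ := b * (1 + R) + b ^ 2 * (1 + R) ^ 2 + b ^ 3 * (1 + R) ^ 3 with hK
  refine ⟨K * ℓ alive, by positivity, fun l F h => ?_⟩
  have hl := h.pos
  have hu := h.isTest_branchHit
  have hlb := h.limFunctional_branchHit H hb
  have hs0 : 0 ≤ √l := Real.sqrt_nonneg l
  have hss : √l ^ 2 = l := Real.sq_sqrt hl.le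
  have hs1 : √l ≤ 1 := Real.sqrt_le_one.2 h.le_one
  have hT : IsTest fun x => l * alive x + b * branchHit b ρ M l F x -
      b * (b - 1) / 2 * branchHit b ρ M l F x ^ 2 :=
    ((isTest_alive.const_mul l).add (hu.const_mul b)).sub (hu.sq.const_mul _)
  have hmain := H.abs_ell_sub_le h.isTest hT (c := K * (l * √l)) fun x hx => by
    rw [alive_of_le hx, mul_one, h.eq x hx, ← branchHit]
    have h0 := h.branchHit_nonneg x
    have h1 := h.branchHit_le_one x
    have h2 := h.branchHit_le_sqrt (hR l F h) x
    set u := branchHit b ρ M l F x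
    have e1 := one_sub_pow_le h0 h1 b
    have e2 := le_one_sub_pow_cubic h0 h1 b
    set r := (1 - u) ^ b - (1 - b * u + b * (b - 1) / 2 * u ^ 2) with hr
    have e3 : |r| ≤ b ^ 3 * ((1 + R) ^ 3 * (l * √l)) := by
      have h3 : u ^ 3 ≤ (1 + R) ^ 3 * (l * √l) := by
        have := pow_le_pow_left₀ h0 h2 3
        have e : √l ^ 3 = l * √l := by rw [pow_succ, hss]
        rwa [mul_pow, e] at this
      have h4 : (b : ℝ) ^ 3 * u ^ 3 ≤ b ^ 3 * ((1 + R) ^ 3 * (l * √l)) :=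
        mul_le_mul_of_nonneg_left h3 (by positivity)
      rw [abs_le, hr]
      constructor
      · linarith
      · have : 0 ≤ (b : ℝ) ^ 3 * u ^ 3 := by positivity
        linarith
    have e4 : |b * u - b * (b - 1) / 2 * u ^ 2| ≤ (b * (1 + R) + b ^ 2 * (1 + R) ^ 2) * √l := by
      have h3 : (b : ℝ) * u ≤ b * ((1 + R) * √l) := mul_le_mul_of_nonneg_left h2 (by linarith)
      have h5 : u ^ 2 ≤ (1 + R) ^ 2 * √l := by
        have := pow_le_pow_left₀ h0 h2 2
        rw [mul_pow] at this
        refine this.trans (mul_le_mul_of_nonneg_left ?_ (by positivity))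
        nlinarith
      have h6 : (b : ℝ) * (b - 1) / 2 * u ^ 2 ≤ b ^ 2 * ((1 + R) ^ 2 * √l) := by
        have h7 : (b : ℝ) * (b - 1) / 2 ≤ b ^ 2 := by nlinarith
        exact mul_le_mul h7 h5 (sq_nonneg u) (by positivity)
      have h8 : 0 ≤ (b : ℝ) * (b - 1) / 2 * u ^ 2 :=
        mul_nonneg (div_nonneg (mul_nonneg (by linarith) (by linarith)) zero_le_two) (sq_nonneg u)
      have h9 : 0 ≤ (b : ℝ) * u := by positivity
      have h10 : 0 ≤ (b : ℝ) * ((1 + R) * √l) := by positivity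
      have h11 : 0 ≤ (b : ℝ) ^ 2 * ((1 + R) ^ 2 * √l) := by positivity
      rw [abs_le]
      constructor <;> linarith
    have e5 : 1 - (1 - l) * (1 - u) ^ b - (l + b * u - b * (b - 1) / 2 * u ^ 2) =
        -(l * (b * u - b * (b - 1) / 2 * u ^ 2)) - (1 - l) * r := by rw [hr]; ring
    rw [e5]
    have e6 : |l * (b * u - b * (b - 1) / 2 * u ^ 2)| ≤
        l * ((b * (1 + R) + b ^ 2 * (1 + R) ^ 2) * √l) := by
      rw [abs_mul, abs_of_pos hl]; exact mul_le_mul_of_nonneg_left e4 hl.le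
    have e7 : |(1 - l) * r| ≤ |r| := by
      rw [abs_mul, abs_of_nonneg (sub_nonneg.2 h.le_one)]
      exact mul_le_of_le_one_left (abs_nonneg r) (by linarith)
    have e8 := abs_sub (-(l * (b * u - b * (b - 1) / 2 * u ^ 2))) ((1 - l) * r)
    rw [abs_neg] at e8
    have e9 : K * (l * √l) = l * ((b * (1 + R) + b ^ 2 * (1 + R) ^ 2) * √l) +
        b ^ 3 * ((1 + R) ^ 3 * (l * √l)) := by rw [hK]; ring
    rw [e9]
    linarith
  -- Integrating the pointwise expansion and substituting for `b ℓ(u)` cancels `ℓ(F)`. The source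
  -- terms `l` and `l (b - 1)` combine to `b l`.
  rw [H.ell_sub ((isTest_alive.const_mul l).add (hu.const_mul b)) (hu.sq.const_mul _),
    H.ell_add (isTest_alive.const_mul l) (hu.const_mul b), H.ell_const_mul isTest_alive,
    H.ell_const_mul hu, H.ell_const_mul hu.sq, hlb] at hmain
  rw [abs_sub_comm] at hmain
  calc _ = _ := by congr 1; ring
    _ ≤ _ := hmain
    _ = _ := by ring

end

/-! ### The sharp constant in the square-root law. -/

section

variable {b : ℕ} {ρ : Measure ℝ} {M z : ℝ} {φ : ℝ → ℝ} {ε : ℕ → ℝ}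

theorem HasGap.limFunctional_sq_pos [IsProbabilityMeasure ρ] (H : HasGap b ρ M z φ ε) :
    0 < limFunctional b ρ M z fun x => φ x ^ 2 := by
  have h1 := H.ell_mono (isTest_alive.const_mul (φ 1 ^ 2)) H.isTest.sq fun x => by
    rcases lt_or_ge x 1 with hx | hx
    · rw [alive_of_lt hx, mul_zero]; positivity
    · rw [alive_of_le hx, mul_one]
      exact pow_le_pow_left₀ H.one_pos.le (H.eigen.mono hx) 2
  rw [H.ell_const_mul isTest_alive] at h1
  have h2 := H.one_le_limFunctional_alive
  have h3 := H.one_pos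
  exact lt_of_lt_of_le (by positivity) h1

/-- The asymptotics of the solutions, up to an arbitrarily small relative error. -/
theorem HasGap.eventually_isHit [IsProbabilityMeasure ρ]
    (H : HasGap b ρ M (1 / (b : ℝ)) φ ε) (hb : 1 < b) {ι : Type*} {𝓕 : Filter ι} {l : ι → ℝ}
    {F : ι → ℝ → ℝ} (hl : Tendsto l 𝓕 (𝓝 0)) (hF : ∀ᶠ i in 𝓕, IsHit b ρ M (l i) (F i)) {η : ℝ}
    (hη : 0 < η) :
    ∀ᶠ i in 𝓕, ∀ x,
      |F i x / √(l i) - limFunctional b ρ M (1 / (b : ℝ)) (F i) / √(l i) * φ x| ≤ η := by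
  obtain ⟨R, hR0, hR⟩ := H.exists_isHit_le hb
  obtain ⟨K, hK0, hK⟩ := H.exists_isHit_sub_le hb hR0 hR
  have h1 : Tendsto (fun n => R * ε n) atTop (𝓝 0) := by simpa using H.lim.const_mul R
  -- The order of choices matters: first `n` makes the gap error small relative to `√l`, then `l →
  -- 0` removes the accumulated error `n K l`.
  obtain ⟨n, hn⟩ := (h1.eventually (ge_mem_nhds (half_pos hη))).exists
  have h2 : Tendsto (fun i => n * (K * √(l i))) 𝓕 (𝓝 0) := by
    have h : Tendsto (fun i => √(l i)) 𝓕 (𝓝 0) := by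
      simpa [Function.comp_def] using (Real.continuous_sqrt.tendsto 0).comp hl
    simpa using (h.const_mul K).const_mul (n : ℝ)
  filter_upwards [hF, h2.eventually (ge_mem_nhds (half_pos hη))] with i hi h3 x
  have hs : 0 < √(l i) := Real.sqrt_pos.2 hi.pos
  have hss : √(l i) * √(l i) = l i := Real.mul_self_sqrt hi.pos.le
  have h4 := hK (l i) (F i) hi n x
  rw [div_mul_eq_mul_div, ← sub_div, abs_div, abs_of_pos hs, div_le_iff₀ hs]
  have h5 := mul_le_mul_of_nonneg_right (add_le_add h3 hn) hs.le
  have h6 : (n * (K * √(l i)) + R * ε n) * √(l i) = n * (K * (√(l i) * √(l i))) + R * √(l i) * ε n := by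
    ring
  rw [h6, hss] at h5
  linarith

/-- The critical asymptotics of the normalisation. -/
theorem HasGap.tendsto_limFunctional_isHit [IsProbabilityMeasure ρ]
    (H : HasGap b ρ M (1 / (b : ℝ)) φ ε) (hb : 1 < b) {ι : Type*} {𝓕 : Filter ι} {l : ι → ℝ}
    {F : ι → ℝ → ℝ} (hl : Tendsto l 𝓕 (𝓝 0)) (hF : ∀ᶠ i in 𝓕, IsHit b ρ M (l i) (F i)) :
    Tendsto (fun i => limFunctional b ρ M (1 / (b : ℝ)) (F i) / √(l i)) 𝓕
      (𝓝 √(2 * b ^ 2 * limFunctional b ρ M (1 / (b : ℝ)) alive /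
        (((b : ℝ) - 1) * limFunctional b ρ M (1 / (b : ℝ)) fun x => φ x ^ 2))) := by
  obtain ⟨R, hR0, hR⟩ := H.exists_isHit_le hb
  obtain ⟨K, hK0, hK⟩ := H.exists_isHit_balance hb hR0 hR
  have hb2 : (2 : ℝ) ≤ b := by exact_mod_cast hb
  have hL := H.one_le_limFunctional_alive
  have hL2 := H.limFunctional_sq_pos
  set ℓ := limFunctional b ρ M (1 / (b : ℝ))
  set L := ℓ alive
  set L2 := ℓ fun x => φ x ^ 2
  set A : ι → ℝ := fun i => ℓ (F i) / √(l i) with hA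
  set W : ℝ := K + b * (b - 1) / 2 * (2 * (1 + R + 3 * b * L) * L) with hW
  have hW0 : 0 < W := by
    have : 0 ≤ (b : ℝ) * (b - 1) / 2 * (2 * (1 + R + 3 * b * L) * L) :=
      mul_nonneg (div_nonneg (mul_nonneg (by linarith) (by linarith)) zero_le_two) (by positivity)
    linarith
  have hsq : Tendsto (fun i => √(l i)) 𝓕 (𝓝 0) := by
    simpa [Function.comp_def] using (Real.continuous_sqrt.tendsto 0).comp hl
  have hA0 : ∀ᶠ i in 𝓕, 0 ≤ A i := hF.mono fun i hi =>
    div_nonneg (H.ell_nonneg hi.isTest hi.nonneg) (Real.sqrt_nonneg _)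
  have key : ∀ η > 0, ∀ᶠ i in 𝓕, |b * L - ((b : ℝ) - 1) / (2 * b) * L2 * A i ^ 2| ≤ W * η := by
    intro η hη
    filter_upwards [hF, hA0, hsq.eventually (ge_mem_nhds hη), H.eventually_isHit hb hl hF hη] with
      i hi hAi hsη hφ
    have hs : 0 < √(l i) := Real.sqrt_pos.2 hi.pos
    have hss : √(l i) * √(l i) = l i := Real.mul_self_sqrt hi.pos.le
    have hu := hi.isTest_branchHit
    set u := branchHit b ρ M (l i) (F i) with hudef
    have hAle : A i ≤ 3 * b * L := by
      rw [hA]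
      exact (div_le_iff₀ hs).2 (hi.limFunctional_le H hb)
    -- One application of the operator to `F ≈ √l A φ` gives the factor `1 / b`; the source term in
    -- `u` contributes only `O(l)`.
    have h1 : ∀ x, |u x / √(l i) - A i * φ x / b| ≤ 2 * η := by
      intro x
      have hT : IsBdd η fun x => (√(l i))⁻¹ * F i x - A i * φ x :=
        ⟨(hi.meas.const_mul _).sub (H.eigen.bdd.meas.const_mul _), fun x => by
          have := hφ x
          rwa [div_eq_inv_mul] at this⟩
      have h2 := (hT.step (b := b) (ρ := ρ) (M := M)).bdd x
      rw [step_sub (hi.isBdd.const_mul _) (H.eigen.bdd.const_mul _), step_const_mul,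
        step_const_mul, H.eigen.eq] at h2
      have h3 : 0 ≤ alive x - step b ρ M alive x := sub_nonneg.2 (step_alive_le x)
      have h3' : alive x - step b ρ M alive x ≤ 1 := by
        linarith [alive_le_one x, step_nonneg (b := b) (ρ := ρ) (M := M) alive_nonneg x]
      have h4 : u x / √(l i) - A i * φ x / b = √(l i) * (alive x - step b ρ M alive x) +
          ((√(l i))⁻¹ * step b ρ M (F i) x - A i * (1 / (b : ℝ) * φ x)) := by
        rw [hudef, branchHit, add_div, mul_div_right_comm, Real.div_sqrt]
        ring
      rw [h4]
      refine (abs_add_le _ _).trans ?_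
      have h5 : |√(l i) * (alive x - step b ρ M alive x)| ≤ η := by
        rw [abs_of_nonneg (mul_nonneg hs.le h3)]
        exact (mul_le_of_le_one_right hs.le h3').trans hsη
      linarith
    have h2 : ∀ x, |(l i)⁻¹ * u x ^ 2 - (A i ^ 2 / b ^ 2) * φ x ^ 2| ≤
        2 * η * (1 + R + 3 * b * L) := by
      intro x
      have e : (l i)⁻¹ * u x ^ 2 - (A i ^ 2 / b ^ 2) * φ x ^ 2 =
          (u x / √(l i) - A i * φ x / b) * (u x / √(l i) + A i * φ x / b) := by
        have : (l i)⁻¹ = (√(l i))⁻¹ ^ 2 := by rw [inv_pow, Real.sq_sqrt hi.pos.le]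
        rw [this]; ring
      rw [e, abs_mul]
      have h3 : 0 ≤ u x / √(l i) := div_nonneg (hi.branchHit_nonneg x) hs.le
      have h3' : u x / √(l i) ≤ 1 + R := (div_le_iff₀ hs).2 (hi.branchHit_le_sqrt (hR _ _ hi) x)
      have h4 : 0 ≤ A i * φ x / b := div_nonneg (mul_nonneg hAi (H.eigen.nonneg x)) (by positivity)
      have h4' : A i * φ x / b ≤ 3 * b * L := by
        refine le_trans ?_ hAle
        rw [div_le_iff₀ (by positivity)]
        exact mul_le_mul_of_nonneg_left ((H.eigen.le_one x).trans (by linarith)) hAi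
      rw [abs_of_nonneg (add_nonneg h3 h4)]
      exact mul_le_mul (h1 x) (by linarith) (by linarith) (by linarith)
    have h3 := H.abs_ell_sub_le (hu.sq.const_mul (l i)⁻¹) (H.isTest.sq.const_mul (A i ^ 2 / b ^ 2))
      (fun x _ => h2 x)
    rw [H.ell_const_mul hu.sq, H.ell_const_mul H.isTest.sq] at h3
    change |(l i)⁻¹ * ℓ (fun x => u x ^ 2) - A i ^ 2 / b ^ 2 * L2| ≤ _ * L at h3
    have h4 : |b * L - b * (b - 1) / 2 * ((l i)⁻¹ * ℓ (fun x => u x ^ 2))| ≤ K * η := by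
      have h5 := hK (l i) (F i) hi
      rw [← mul_le_mul_iff_right₀ hi.pos]
      have e : l i * |b * L - b * (b - 1) / 2 * ((l i)⁻¹ * ℓ (fun x => u x ^ 2))| =
          |b * L * l i - b * (b - 1) / 2 * ℓ (fun x => u x ^ 2)| := by
        rw [← abs_of_pos hi.pos, ← abs_mul, abs_of_pos hi.pos]
        congr 1
        have := hi.pos.ne'
        field_simp
      rw [e]
      refine h5.trans ?_
      have := mul_le_mul_of_nonneg_left hsη (mul_nonneg hK0.le hi.pos.le)
      linarith
    have hc : 0 ≤ (b : ℝ) * (b - 1) / 2 :=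
      div_nonneg (mul_nonneg (by linarith) (by linarith)) zero_le_two
    have h6 : |(b : ℝ) * (b - 1) / 2 * ((l i)⁻¹ * ℓ (fun x => u x ^ 2) - A i ^ 2 / b ^ 2 * L2)| ≤
        b * (b - 1) / 2 * (2 * η * (1 + R + 3 * b * L) * L) := by
      rw [abs_mul, abs_of_nonneg hc]
      exact mul_le_mul_of_nonneg_left h3 hc
    have e : b * L - ((b : ℝ) - 1) / (2 * b) * L2 * A i ^ 2 =
        (b * L - b * (b - 1) / 2 * ((l i)⁻¹ * ℓ (fun x => u x ^ 2))) +
        b * (b - 1) / 2 * ((l i)⁻¹ * ℓ (fun x => u x ^ 2) - A i ^ 2 / b ^ 2 * L2) := by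
      have : (b : ℝ) ≠ 0 := by positivity
      field_simp
      ring
    rw [e]
    refine (abs_add_le _ _).trans ((add_le_add h4 h6).trans (le_of_eq ?_))
    rw [hW]; ring
  have hlim : Tendsto (fun i => b * L - ((b : ℝ) - 1) / (2 * b) * L2 * A i ^ 2) 𝓕 (𝓝 0) := by
    rw [Metric.tendsto_nhds]
    intro e he
    filter_upwards [key (e / (2 * W)) (by positivity)] with i hi
    rw [Real.dist_eq, sub_zero]
    refine hi.trans_lt ?_
    have : W * (e / (2 * W)) = e / 2 := by field_simp
    linarith
  have hb1 : (0 : ℝ) < b - 1 := by linarith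
  -- The limiting balance is linear in `A²` with a nonzero coefficient. The sign of `A` is known, so
  -- its limit follows by taking a root.
  have hsqA : Tendsto (fun i => A i ^ 2) 𝓕 (𝓝 (2 * b ^ 2 * L / ((b - 1) * L2))) := by
    have h := ((tendsto_const_nhds (x := (b : ℝ) * L)).sub hlim).const_mul
      (2 * b / (((b : ℝ) - 1) * L2))
    have hb0 : (b : ℝ) ≠ 0 := by positivity
    convert h using 2
    · field_simp
      ring
    · field_simp
      ring
  refine ((Real.continuous_sqrt.tendsto _).comp hsqA).congr' ?_
  filter_upwards [hA0] with i hi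
  exact Real.sqrt_sq hi

/-- The critical asymptotics of solutions of the recursion. -/
theorem HasGap.tendsto_isHit [IsProbabilityMeasure ρ]
    (H : HasGap b ρ M (1 / (b : ℝ)) φ ε) (hb : 1 < b) {ι : Type*} {𝓕 : Filter ι} {l : ι → ℝ}
    {F : ι → ℝ → ℝ} (hl : Tendsto l 𝓕 (𝓝 0)) (hF : ∀ᶠ i in 𝓕, IsHit b ρ M (l i) (F i)) (θ : ℝ) :
    Tendsto (fun i => F i θ / √(l i)) 𝓕
      (𝓝 (√(2 * b ^ 2 * limFunctional b ρ M (1 / (b : ℝ)) alive /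
        (((b : ℝ) - 1) * limFunctional b ρ M (1 / (b : ℝ)) fun x => φ x ^ 2)) * φ θ)) := by
  have h1 := (H.tendsto_limFunctional_isHit hb hl hF).mul_const (φ θ)
  have h2 : Tendsto (fun i => F i θ / √(l i) -
      limFunctional b ρ M (1 / (b : ℝ)) (F i) / √(l i) * φ θ) 𝓕 (𝓝 0) := by
    rw [Metric.tendsto_nhds]
    intro e he
    filter_upwards [H.eventually_isHit hb hl hF (half_pos he)] with i hi
    rw [Real.dist_eq, sub_zero]
    linarith [hi θ]
  simpa using h2.add h1

/-- The constant in the critical asymptotics. -/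
theorem HasGap.invSqConst_pos_and_mul_psi [IsProbabilityMeasure ρ]
    (H : HasGap b ρ M (1 / (b : ℝ)) φ ε) (hb : 1 < b) (hM : 2 ≤ M)
    (h01 : ∀ᵐ x ∂ρ, x ∈ Set.Icc (0 : ℝ) 1) (hlim : IsLimitLaw b ρ (limitLaw b ρ)) :
    0 < invSqConst b ρ ∧ ∀ θ ≤ M, cConst b ρ * psi b ρ θ =
      √(2 * b ^ 2 * limFunctional b ρ M (1 / (b : ℝ)) alive /
        (((b : ℝ) - 1) * limFunctional b ρ M (1 / (b : ℝ)) fun x => φ x ^ 2)) * φ θ := by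
  have hb2 : (2 : ℝ) ≤ b := by exact_mod_cast hb
  have hb1 : (0 : ℝ) < b - 1 := by linarith
  have hL := H.one_le_limFunctional_alive
  have hL2 := H.limFunctional_sq_pos
  have he := H.invSqConst_eq hb hM h01 hlim
  refine ⟨by rw [he]; positivity, fun θ hθ => ?_⟩
  rw [H.psi_eq hb hM h01 hθ, cConst, he, ← mul_assoc, ← Real.sqrt_inv]
  congr 1
  set L := limFunctional b ρ M (1 / (b : ℝ)) alive
  set L2 := limFunctional b ρ M (1 / (b : ℝ)) fun x => φ x ^ 2
  have hL0 : 0 < L := by linarith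
  rw [← Real.sqrt_sq hL0.le, ← Real.sqrt_mul (by positivity), Real.sqrt_sq hL0.le]
  congr 1
  field_simp

end

/-! ### The avalanche in closed form -/

/-- The value accumulated along the path from the root, which carries `θ`, to a site. -/
noncomputable def treeQ (b : ℕ) (x : Site b → ℝ) (θ : ℝ) : Site b → ℝ
  | [] => θ
  | i :: σ => x (i :: σ) + treeQ b x θ σ / b

/-- The accumulated values are at least one at all strict ancestors of the site. -/
def Reached (b : ℕ) (x : Site b → ℝ) (θ : ℝ) : Site b → Prop
  | [] => True
  | _ :: σ => Reached b x θ σ ∧ 1 ≤ treeQ b x θ σ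

section

variable {b : ℕ} {x : Site b → ℝ} {θ : ℝ}

open Classical in
-- Topplings form a front moving down one generation per unit of time. A reached site at depth `n`
-- attains its accumulated value at time `n` and, if this is at least one, is emptied at time `n +
-- 1`. All initial values being below one, nothing topples off the front.
theorem process_eq (hx : ∀ σ, x σ < 1) (hθ : 1 ≤ θ) (t : ℕ) (σ : Site b) :
    process b x (θ - x []) t σ = if Reached b x θ σ ∧ σ.length ≤ t then
      (if 1 ≤ treeQ b x θ σ ∧ σ.length < t then 0 else treeQ b x θ σ) else x σ := by
  induction t generalizing σ with
  | zero =>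
    rw [process]
    cases σ with
    | nil => simp [Reached, treeQ]
    | cons i σ => simp
  | succ t ih =>
    rw [process]
    cases σ with
    | nil =>
      rw [topple, ih []]
      rcases Nat.eq_zero_or_pos t with rfl | ht
      · simp [Reached, treeQ, hθ]
      · simp [Reached, treeQ, hθ, ht]
    | cons i σ =>
      -- At time `t` the only sites carrying at least one are at depth exactly `t`: shallower ones
      -- have been emptied and deeper ones still hold their initial values.
      have hm : 1 ≤ process b x (θ - x []) t σ ↔
          Reached b x θ σ ∧ σ.length = t ∧ 1 ≤ treeQ b x θ σ := by
        rw [ih σ]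
        have h1 := hx σ
        constructor
        · intro h
          split_ifs at h with h2 h3
          · linarith
          · refine ⟨h2.1, ?_, h⟩
            by_contra h4
            exact h3 ⟨h, lt_of_le_of_ne h2.2 h4⟩
          · linarith
        · rintro ⟨h2, h3, h4⟩
          rw [if_pos ⟨h2, h3.le⟩, if_neg (by omega)]
          exact h4
      rw [topple, ih (i :: σ)]
      by_cases h : 1 ≤ process b x (θ - x []) t σ
      · obtain ⟨h2, h3, h4⟩ := hm.1 h
        have h5 : process b x (θ - x []) t σ = treeQ b x θ σ := by
          rw [ih σ, if_pos ⟨h2, h3.le⟩, if_neg (by omega)]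
        rw [if_pos h, h5, if_neg (by simp; omega), if_pos ⟨⟨h2, h4⟩, by simp; omega⟩,
          if_neg (by simp; omega), treeQ]
      · rw [if_neg h]
        by_cases h2 : Reached b x θ (i :: σ) ∧ (i :: σ).length ≤ t
        · have h4 : (i :: σ).length < t + 1 := Nat.lt_succ_of_le h2.2
          have h5 : Reached b x θ (i :: σ) ∧ (i :: σ).length ≤ t + 1 := ⟨h2.1, h4.le⟩
          rw [if_pos h2, if_pos h5]
          by_cases h3 : 1 ≤ treeQ b x θ (i :: σ)
          · have h6 : 1 ≤ treeQ b x θ (i :: σ) ∧ (i :: σ).length < t + 1 := ⟨h3, h4⟩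
            rw [if_pos h6]
            split_ifs <;> rfl
          · simp only [h3, false_and, if_false]
        · have h3 : ¬ (Reached b x θ (i :: σ) ∧ (i :: σ).length ≤ t + 1) := by
            rintro ⟨h3, h4⟩
            have h5 : (i :: σ).length = t + 1 := by
              by_contra h6
              exact h2 ⟨h3, by omega⟩
            exact h (hm.2 ⟨h3.1, by simpa using h5, h3.2⟩)
          rw [if_neg h2, if_neg h3, if_neg (by linarith [hx (i :: σ)])]

/-- An avalanched site is recognised by a nonzero value followed by zero, so accumulated values must
be nonzero: otherwise the toppling would go unseen, or an untoppled site would be counted. -/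
theorem treeQ_ne_zero (hb : 1 < b) (hx : ∀ σ, 0 ≤ x σ) (hθ : 1 ≤ θ) {σ : Site b}
    (h : Reached b x θ σ) : treeQ b x θ σ ≠ 0 := by
  cases σ with
  | nil => rw [treeQ]; linarith
  | cons i σ =>
    rw [treeQ]
    have h1 : 0 < treeQ b x θ σ / b := div_pos (by linarith [h.2]) (by positivity)
    linarith [hx (i :: σ)]

theorem avalanche_eq (hb : 1 < b) (hx : ∀ σ, 0 ≤ x σ ∧ x σ < 1) (hθ : 1 ≤ θ) :
    avalanche b x (θ - x []) = {σ | Reached b x θ σ ∧ 1 ≤ treeQ b x θ σ} := by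
  classical
  ext σ
  have hp := process_eq (fun σ => (hx σ).2) hθ
  have hQ : Reached b x θ σ → treeQ b x θ σ ≠ 0 := treeQ_ne_zero hb (fun σ => (hx σ).1) hθ
  simp only [avalanche, avalancheBy, Set.mem_iUnion, Set.mem_ofPred_eq]
  constructor
  · rintro ⟨t, h1, s, hs, h2⟩
    rw [hp] at h1 h2
    by_cases h : Reached b x θ σ ∧ σ.length ≤ t
    · rw [if_pos h] at h1
      split_ifs at h1 with h3
      · exact ⟨h.1, h3.1⟩
      · exact absurd h1 (hQ h.1)
    · rw [if_neg h] at h1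
      rw [if_neg fun h3 => h ⟨h3.1, h3.2.trans hs.le⟩] at h2
      exact absurd h1 h2
  · rintro ⟨h1, h2⟩
    refine ⟨σ.length + 1, ?_, σ.length, Nat.lt_succ_self _, ?_⟩
    · rw [hp, if_pos ⟨h1, Nat.le_succ _⟩, if_pos ⟨h2, Nat.lt_succ_self _⟩]
    · rw [hp, if_pos ⟨h1, le_rfl⟩, if_neg (by omega)]
      exact hQ h1

theorem reached_iff_of_lt (hθ : θ < 1) (σ : Site b) : Reached b x θ σ ↔ σ = [] := by
  induction σ with
  | nil => simp [Reached]
  | cons i σ ih =>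
    simp only [Reached, reduceCtorEq, iff_false, not_and, not_le]
    intro h
    rw [ih.1 h]
    exact hθ

theorem spilled_eq (hb : 1 < b) (hx : ∀ σ, 0 ≤ x σ ∧ x σ < 1) :
    spilled b x θ = {σ | Reached b x θ σ} := by
  ext σ
  rcases lt_or_ge θ 1 with hθ | hθ
  · simp [spilled, rootedAvalanche, hθ.not_ge, reached_iff_of_lt hθ]
  · simp only [spilled, rootedAvalanche, if_pos hθ, avalanche_eq hb hx hθ]
    cases σ with
    | nil => simp [Reached]
    | cons i σ => simp [Reached]

/-! ### Subtrees -/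

/-- Labels are listed most recent first, so the daughter of the root from which a site descends is
the last entry; appending `[i]` embeds the tree as the subtree at that daughter. -/
theorem treeQ_append (σ : Site b) (i : Fin b) : treeQ b x θ (σ ++ [i]) =
    treeQ b (fun τ => x (τ ++ [i])) (x [i] + θ / b) σ := by
  induction σ with
  | nil => rfl
  | cons j σ ih => rw [List.cons_append, treeQ, ih, treeQ]; rfl

theorem reached_append (σ : Site b) (i : Fin b) : Reached b x θ (σ ++ [i]) ↔
    1 ≤ θ ∧ Reached b (fun τ => x (τ ++ [i])) (x [i] + θ / b) σ := by
  induction σ with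
  | nil => simp [Reached, treeQ]
  | cons j σ ih => rw [List.cons_append, Reached, ih, treeQ_append, Reached, and_assoc]

theorem treeQ_congr {y : Site b → ℝ} (h : ∀ σ, σ ≠ [] → x σ = y σ) (σ : Site b) :
    treeQ b x θ σ = treeQ b y θ σ := by
  induction σ with
  | nil => rfl
  | cons i σ ih => rw [treeQ, treeQ, ih, h _ (List.cons_ne_nil _ _)]

theorem reached_congr {y : Site b → ℝ} (h : ∀ σ, σ ≠ [] → x σ = y σ) (σ : Site b) :
    Reached b x θ σ ↔ Reached b y θ σ := by
  induction σ with
  | nil => rfl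
  | cons i σ ih => rw [Reached, Reached, ih, treeQ_congr h]

end

/-- A site is the root or belongs to exactly one of the subtrees at the daughters of the root. -/
def siteEquiv (b : ℕ) : Option (Fin b × Site b) ≃ Site b where
  toFun o := o.elim [] fun p => p.2 ++ [p.1]
  invFun σ := match σ.reverse with
    | [] => none
    | i :: τ => some (i, τ.reverse)
  left_inv o := by
    rcases o with _ | ⟨i, τ⟩ <;> simp
  right_inv σ := by
    cases h : σ.reverse with
    | nil =>
      have : σ = [] := by simpa using h
      subst this
      rfl
    | cons i τ =>
      have : σ = (i :: τ).reverse := by rw [← h, List.reverse_reverse]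
      simp [this]

/-- A family indexed by the sites from its value at the root and its restrictions to the
subtrees at the daughters of the root. -/
def treeJoin {b : ℕ} {E : Type*} (p : E × (Fin b → Site b → E)) : Site b → E :=
  fun σ => optionCons (p.1, fun q : Fin b × Site b => p.2 q.1 q.2) ((siteEquiv b).symm σ)

section

variable {b : ℕ} {E : Type*}

theorem treeJoin_append (p : E × (Fin b → Site b → E)) (σ : Site b) (i : Fin b) :
    treeJoin p (σ ++ [i]) = p.2 i σ := by
  have h : σ ++ [i] = siteEquiv b (some (i, σ)) := rfl
  rw [treeJoin, h, Equiv.symm_apply_apply]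
  rfl

theorem measurePreserving_treeJoin [MeasurableSpace E] (ν : Measure E) [IsProbabilityMeasure ν] :
    MeasurePreserving (treeJoin : E × (Fin b → Site b → E) → Site b → E)
      (ν.prod (Measure.pi fun _ : Fin b => Measure.infinitePi fun _ : Site b => ν))
      (Measure.infinitePi fun _ : Site b => ν) := by
  have h1 : MeasurePreserving (MeasurableEquiv.curry (Fin b) (Site b) E).symm
      (Measure.pi fun _ : Fin b => Measure.infinitePi fun _ : Site b => ν)
      (Measure.infinitePi fun _ : Fin b × Site b => ν) := by
    refine ⟨MeasurableEquiv.measurable _, ?_⟩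
    rw [← Measure.infinitePi_eq_pi]
    exact Measure.infinitePi_map_curry_symm fun _ _ => ν
  exact (measurePreserving_reindex ν (siteEquiv b)).comp
    ((measurePreserving_optionCons ν).comp ((MeasurePreserving.id ν).prod h1))

/-- Resampling one coordinate makes it independent of the rest of the configuration without changing
the law. -/
theorem measurePreserving_update {ι : Type*} [DecidableEq ι] [MeasurableSpace E] (ν : Measure E)
    [IsProbabilityMeasure ν] (j : ι) :
    MeasurePreserving (fun p : E × (ι → E) => Function.update p.2 j p.1)
      (ν.prod (Measure.infinitePi fun _ : ι => ν)) (Measure.infinitePi fun _ : ι => ν) := by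
  have hm : Measurable fun p : E × (ι → E) => Function.update p.2 j p.1 := by
    refine measurable_pi_iff.2 fun i => ?_
    rcases eq_or_ne i j with rfl | h
    · simpa using measurable_fst
    · simpa [h] using measurable_snd.eval (a := i)
  refine ⟨hm, Measure.eq_infinitePi _ fun s t ht => ?_⟩
  have hpre : (fun p : E × (ι → E) => Function.update p.2 j p.1) ⁻¹' (Set.pi s t) =
      (if j ∈ s then t j else Set.univ) ×ˢ Set.pi (s.erase j) t := by
    ext p
    simp only [Set.mem_preimage, Set.mem_pi, Set.mem_prod, SetLike.mem_coe, Finset.mem_erase]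
    refine ⟨fun h => ⟨?_, fun i hi => ?_⟩, fun h i hi => ?_⟩
    · split_ifs with hs
      · simpa using h j hs
      · trivial
    · simpa [hi.1] using h i hi.2
    · rcases eq_or_ne i j with rfl | hij
      · simpa [hi] using h.1
      · simpa [hij] using h.2 i ⟨hij, hi⟩
  rw [Measure.map_apply hm (.pi s.countable_toSet fun _ _ => ht _), hpre,
    Measure.prod_prod, Measure.infinitePi_pi _ fun a _ => ht _]
  by_cases hs : j ∈ s
  · rw [if_pos hs, ← Finset.mul_prod_erase s _ hs]
  · rw [if_neg hs, measure_univ, one_mul, Finset.erase_eq_of_notMem hs]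

end

/-! ### The recursion at the root -/

/-- Some site that is reached, when the root carries `θ`, is green. -/
def hitSet (b : ℕ) (θ : ℝ) : Set ((Site b → ℝ) × (Site b → Bool)) :=
  {p | ∃ σ, Reached b p.1 θ σ ∧ p.2 σ = true}

section

variable {b : ℕ} {ρ : Measure ℝ}

instance (l : unitInterval) [IsProbabilityMeasure ρ] : IsProbabilityMeasure (jointLaw b ρ l) := by
  unfold jointLaw; infer_instance

theorem measurable_treeQ (σ : Site b) :
    Measurable fun p : ℝ × (Site b → ℝ) => treeQ b p.2 p.1 σ := by
  induction σ with
  | nil => exact measurable_fst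
  | cons i σ ih => simp only [treeQ]; fun_prop

theorem measurableSet_reached (σ : Site b) :
    MeasurableSet {p : ℝ × (Site b → ℝ) | Reached b p.2 p.1 σ} := by
  induction σ with
  | nil => simp [Reached]
  | cons i σ ih =>
    exact ih.inter (measurableSet_le measurable_const (measurable_treeQ σ))

theorem measurableSet_hit : MeasurableSet
    {p : ℝ × ((Site b → ℝ) × (Site b → Bool)) | p.2 ∈ hitSet b p.1} := by
  have h : {p : ℝ × ((Site b → ℝ) × (Site b → Bool)) | p.2 ∈ hitSet b p.1} =
      ⋃ σ : Site b, {p | Reached b p.2.1 p.1 σ} ∩ {p | p.2.2 σ = true} := by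
    ext p; simp [hitSet]
  rw [h]
  refine .iUnion fun σ => .inter ?_ ?_
  · have hm : Measurable fun p : ℝ × ((Site b → ℝ) × (Site b → Bool)) => (p.1, p.2.1) := by fun_prop
    exact hm (measurableSet_reached σ)
  · have hm : Measurable fun p : ℝ × ((Site b → ℝ) × (Site b → Bool)) => p.2.2 σ := by fun_prop
    exact hm (measurableSet_singleton true)

theorem measurableSet_hitSet (θ : ℝ) : MeasurableSet (hitSet b θ) :=
  measurable_prodMk_left (x := θ) measurableSet_hit

theorem measurable_hit [IsProbabilityMeasure ρ] (l : unitInterval) :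
    Measurable fun θ => (jointLaw b ρ l).real (hitSet b θ) :=
  (measurable_measure_prodMk_left measurableSet_hit).ennreal_toReal

theorem ae_site [IsProbabilityMeasure ρ] {p : ℝ → Prop} (h : ∀ᵐ x ∂ρ, p x) (l : unitInterval) :
    ∀ᵐ q ∂(jointLaw b ρ l), ∀ σ, p (q.1 σ) := by
  refine ae_all_iff.2 fun σ => ?_
  have h1 : MeasurePreserving (fun q : (Site b → ℝ) × (Site b → Bool) => q.1 σ)
      (jointLaw b ρ l) ρ :=
    (measurePreserving_eval_infinitePi (fun _ : Site b => ρ) σ).comp measurePreserving_fst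
  exact h1.quasiMeasurePreserving.ae h

/-- The event of a hit, in terms of the paths from the root. -/
theorem hitProb_eq [IsProbabilityMeasure ρ] (hb : 1 < b) (hac : ρ ≪ volume)
    (h01 : ∀ᵐ x ∂ρ, x ∈ Set.Icc (0 : ℝ) 1) (θ : ℝ) (l : unitInterval) :
    hitProb b ρ θ l = (jointLaw b ρ l).real (hitSet b θ) := by
  -- The closed form of the avalanche needs initial values strictly below one; the value one has
  -- probability zero.
  have h1 : ∀ᵐ x ∂ρ, x ≠ 1 := hac.ae_le (Measure.ae_ne volume 1)
  refine measureReal_congr ?_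
  filter_upwards [ae_site (h01.and h1) l] with q hq
  have hs := spilled_eq (θ := θ) hb fun σ => ⟨(hq σ).1.1, lt_of_le_of_ne (hq σ).1.2 (hq σ).2⟩
  refine propext ?_
  change (spilled b q.1 θ ∩ {σ | q.2 σ = true}).Nonempty ↔ _
  rw [hs]
  rfl

theorem bernoulli_real_true (l : unitInterval) :
    (bernoulliMeasure true false l).real {true} = l := by
  classical
  rw [bernoulliMeasure_real_apply _ (measurableSet_singleton _)]
  simp

theorem bernoulli_real_false (l : unitInterval) :
    (bernoulliMeasure true false l).real {false} = 1 - l := by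
  classical
  rw [bernoulliMeasure_real_apply _ (measurableSet_singleton _)]
  simp

theorem hit_of_lt [IsProbabilityMeasure ρ] {θ : ℝ} (hθ : θ < 1) (l : unitInterval) :
    (jointLaw b ρ l).real (hitSet b θ) = l := by
  have h1 : MeasurePreserving (fun q : (Site b → ℝ) × (Site b → Bool) => q.2 [])
      (jointLaw b ρ l) (bernoulliMeasure true false l) :=
    (measurePreserving_eval_infinitePi (fun _ : Site b => bernoulliMeasure true false l) []).comp
      measurePreserving_snd
  have h2 : hitSet b θ = (fun q : (Site b → ℝ) × (Site b → Bool) => q.2 []) ⁻¹' {true} := by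
    ext q
    simp [hitSet, reached_iff_of_lt hθ]
  rw [h2, h1.measureReal_preimage (measurableSet_singleton _).nullMeasurableSet,
    bernoulli_real_true]

/-- The event of a hit in a subtree to whose root `θ / b` is passed on. -/
def branchSet (b : ℕ) (θ : ℝ) : Set ((Site b → ℝ) × (Site b → Bool)) :=
  {p | p ∈ hitSet b (p.1 [] + θ / b)}

theorem measurableSet_branchSet (θ : ℝ) : MeasurableSet (branchSet b θ) := by
  have hm : Measurable fun p : (Site b → ℝ) × (Site b → Bool) => (p.1 [] + θ / b, p) := by fun_prop
  exact hm measurableSet_hit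

theorem prod_real_eq_integral {α β : Type*} [MeasurableSpace α] [MeasurableSpace β]
    (μ : Measure α) (ν : Measure β) [IsProbabilityMeasure μ] [IsProbabilityMeasure ν]
    {s : Set (α × β)} (hs : MeasurableSet s) :
    (μ.prod ν).real s = ∫ x, ν.real (Prod.mk x ⁻¹' s) ∂μ := by
  rw [measureReal_def, Measure.prod_apply hs]
  exact (integral_toReal (measurable_measure_prodMk_left hs).aemeasurable
    (.of_forall fun _ => measure_lt_top _ _)).symm

/-- Reaching a site depends on the configuration at the subtree's root only through the value passed
to `hitSet`. Resampling that coordinate therefore decouples the value from the rest and allows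
conditioning on it. -/
theorem branch_real [IsProbabilityMeasure ρ] (θ : ℝ) (l : unitInterval) :
    (jointLaw b ρ l).real (branchSet b θ) =
      ∫ x, (jointLaw b ρ l).real (hitSet b (x + θ / b)) ∂ρ := by
  classical
  have h1 : MeasurePreserving
      (fun p : ℝ × ((Site b → ℝ) × (Site b → Bool)) => (Function.update p.2.1 [] p.1, p.2.2))
      (ρ.prod (jointLaw b ρ l)) (jointLaw b ρ l) :=
    ((measurePreserving_update ρ ([] : Site b)).prod (MeasurePreserving.id _)).comp
      (measurePreserving_prodAssoc ρ _ _).symm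
  rw [← h1.measureReal_preimage (measurableSet_branchSet θ).nullMeasurableSet,
    prod_real_eq_integral _ _ (h1.measurable (measurableSet_branchSet θ))]
  congr 1
  ext x
  congr 1
  ext q
  simp only [Set.mem_preimage, branchSet, hitSet, Set.mem_ofPred_eq, Function.update_self]
  refine exists_congr fun σ => and_congr_left fun _ => reached_congr (fun τ hτ => ?_) σ
  exact Function.update_of_ne hτ _ _

/-- A miss decomposes into events of disjoint sets of sites, namely the root and the `b` subtrees;
independence will turn this into a product. -/
theorem miss_iff {θ : ℝ} (hθ : 1 ≤ θ) (p : ℝ × (Fin b → Site b → ℝ))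
    (q : Bool × (Fin b → Site b → Bool)) : (treeJoin p, treeJoin q) ∉ hitSet b θ ↔
      q.1 = false ∧ ∀ i, (p.2 i, q.2 i) ∉ branchSet b θ := by
  have hsub : ∀ (σ : Site b) (i : Fin b), Reached b (treeJoin p) θ (σ ++ [i]) ↔
      Reached b (p.2 i) (p.2 i [] + θ / b) σ := fun σ i => by
    rw [reached_append, and_iff_right hθ]
    simp only [treeJoin_append]
    rw [← treeJoin_append p [] i]
    rfl
  simp only [hitSet, branchSet, Set.mem_ofPred_eq, not_exists, not_and, Bool.not_eq_true]
  constructor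
  · intro h
    refine ⟨h [] trivial, fun i σ hσ => ?_⟩
    rw [← treeJoin_append q]
    exact h _ ((hsub σ i).2 hσ)
  · rintro ⟨h1, h2⟩ σ hσ
    rcases List.eq_nil_or_concat σ with rfl | ⟨τ, i, rfl⟩
    · exact h1
    · rw [List.concat_eq_append] at hσ ⊢
      rw [treeJoin_append]
      exact h2 i τ ((hsub τ i).1 hσ)

/-- The recursion for the probability of a hit. -/
theorem hit_of_le [IsProbabilityMeasure ρ] {θ : ℝ} (hθ : 1 ≤ θ) (l : unitInterval) :
    (jointLaw b ρ l).real (hitSet b θ) =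
      1 - (1 - l) * (1 - ∫ x, (jointLaw b ρ l).real (hitSet b (x + θ / b)) ∂ρ) ^ b := by
  set β : Measure Bool := bernoulliMeasure true false l
  set P : Measure (Site b → ℝ) := Measure.infinitePi fun _ : Site b => ρ
  set G : Measure (Site b → Bool) := Measure.infinitePi fun _ : Site b => β
  have hJ : jointLaw b ρ l = P.prod G := rfl
  have h1 : MeasurePreserving
      (fun p : (ℝ × (Fin b → Site b → ℝ)) × (Bool × (Fin b → Site b → Bool)) =>
        (treeJoin p.1, treeJoin p.2))
      ((ρ.prod (Measure.pi fun _ : Fin b => P)).prod (β.prod (Measure.pi fun _ : Fin b => G)))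
      (P.prod G) := (measurePreserving_treeJoin ρ).prod (measurePreserving_treeJoin β)
  have h2 : MeasurePreserving
      (fun p : (ℝ × (Fin b → Site b → ℝ)) × (Bool × (Fin b → Site b → Bool)) =>
        (p.2.1, (p.1.2, p.2.2)))
      ((ρ.prod (Measure.pi fun _ : Fin b => P)).prod (β.prod (Measure.pi fun _ : Fin b => G)))
      (β.prod ((Measure.pi fun _ : Fin b => P).prod (Measure.pi fun _ : Fin b => G))) :=
    (measurePreserving_prodAssoc _ _ _).comp ((Measure.measurePreserving_swap.prod (.id _)).comp
      ((measurePreserving_prodAssoc _ _ _).symm.comp (measurePreserving_snd.prod (.id _))))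
  have h3 := measurePreserving_arrowProdEquivProdArrow (Site b → ℝ) (Site b → Bool) (Fin b)
    (fun _ => P) fun _ => G
  set B : Set ((Fin b → Site b → ℝ) × (Fin b → Site b → Bool)) :=
    {r | ∀ i, (r.1 i, r.2 i) ∉ branchSet b θ} with hB
  have hBm : MeasurableSet B := by
    have : B = ⋂ i, (fun r : (Fin b → Site b → ℝ) × (Fin b → Site b → Bool) =>
        (r.1 i, r.2 i)) ⁻¹' (branchSet b θ)ᶜ := by
      ext r; simp [hB]
    rw [this]
    exact .iInter fun i => (by fun_prop : Measurable fun r : (Fin b → Site b → ℝ) ×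
      (Fin b → Site b → Bool) => (r.1 i, r.2 i)) (measurableSet_branchSet θ).compl
  have hpre : (fun p : (ℝ × (Fin b → Site b → ℝ)) × (Bool × (Fin b → Site b → Bool)) =>
        (treeJoin p.1, treeJoin p.2)) ⁻¹' (hitSet b θ)ᶜ =
      (fun p : (ℝ × (Fin b → Site b → ℝ)) × (Bool × (Fin b → Site b → Bool)) =>
        (p.2.1, (p.1.2, p.2.2))) ⁻¹' ({false} ×ˢ B) := by
    ext p
    exact miss_iff hθ p.1 p.2
  have hpre2 : (MeasurableEquiv.arrowProdEquivProdArrow (Site b → ℝ) (Site b → Bool) (Fin b)) ⁻¹' B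
      = Set.univ.pi fun _ => (branchSet b θ)ᶜ := by
    ext r
    simp only [hB, Set.mem_preimage, Set.mem_ofPred_eq, Set.mem_pi, Set.mem_univ, true_imp_iff,
      Set.mem_compl_iff]
    rfl
  have hB2 : ((Measure.pi fun _ : Fin b => P).prod (Measure.pi fun _ : Fin b => G)).real B =
      (1 - (P.prod G).real (branchSet b θ)) ^ b := by
    rw [← h3.measureReal_preimage hBm.nullMeasurableSet, hpre2, measureReal_def,
      Measure.pi_pi, Finset.prod_const, Finset.card_univ, Fintype.card_fin, ENNReal.toReal_pow,
      ← measureReal_def, probReal_compl_eq_one_sub (measurableSet_branchSet θ)]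
  have hmiss : (P.prod G).real (hitSet b θ)ᶜ =
      (1 - l) * (1 - (P.prod G).real (branchSet b θ)) ^ b := by
    rw [← h1.measureReal_preimage (measurableSet_hitSet θ).compl.nullMeasurableSet, hpre,
      h2.measureReal_preimage ((measurableSet_singleton _).prod hBm).nullMeasurableSet,
      measureReal_prod_prod, hB2, bernoulli_real_false]
  rw [← branch_real, hJ, ← hmiss, probReal_compl_eq_one_sub (measurableSet_hitSet θ)]
  ring

/-- The probability of a hit solves the equation of the critical asymptotics. -/
theorem isHit_hit [IsProbabilityMeasure ρ] (hb : 1 < b) (h01 : ∀ᵐ x ∂ρ, x ∈ Set.Icc (0 : ℝ) 1)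
    {M : ℝ} (hM : 2 ≤ M) {l : unitInterval} (hl : 0 < l) :
    IsHit b ρ M l fun θ => alive θ * (jointLaw b ρ l).real (hitSet b (min θ M)) where
  pos := hl
  le_one := l.2.2
  meas := measurable_alive.mul ((measurable_hit l).comp (measurable_id.min measurable_const))
  nonneg x := mul_nonneg (alive_nonneg x) measureReal_nonneg
  le_alive x := mul_le_of_le_one_right (alive_nonneg x) measureReal_le_one
  eq θ hθ := by
    have hb2 : (2 : ℝ) ≤ b := by exact_mod_cast hb
    have h1 : 1 ≤ min θ M := le_min hθ (by linarith)
    rw [alive_of_le hθ, one_mul, hit_of_le h1, step_of_le hθ, step_of_le hθ]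
    congr 4
    -- A daughter left below one is still in the boundary and is green with probability `l`; this is
    -- the source term of `branchHit`.
    have hm : ∀ᵐ x ∂ρ, (jointLaw b ρ l).real (hitSet b (x + min θ M / b)) =
        l * (1 - alive (x + min θ M / b)) + alive (x + min θ M / b) *
          (jointLaw b ρ l).real (hitSet b (min (x + min θ M / b) M)) := by
      filter_upwards [h01] with x hx
      have h2 : x + min θ M / b ≤ M := by
        have h3 : min θ M / b ≤ M / 2 := by
          have := min_le_right θ M
          gcongr
        linarith [hx.2]
      rw [min_eq_left h2]
      rcases lt_or_ge (x + min θ M / b) 1 with h | h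
      · rw [alive_of_lt h, hit_of_lt h]; ring
      · rw [alive_of_le h]; ring
    rw [integral_congr_ae hm]
    have i1 : Integrable (fun x => alive (x + min θ M / b)) ρ := isBdd_alive.integrable _
    have hF : IsBdd 1 fun θ => alive θ * (jointLaw b ρ l).real (hitSet b (min θ M)) :=
      ⟨measurable_alive.mul ((measurable_hit l).comp (measurable_id.min measurable_const)),
        fun x => by
          rw [abs_of_nonneg (mul_nonneg (alive_nonneg x) measureReal_nonneg)]
          exact mul_le_one₀ (alive_le_one x) measureReal_nonneg measureReal_le_one⟩
    have i2 := hF.integrable (ρ := ρ) (min θ M / b)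
    have i3 : Integrable (fun x => 1 - alive (x + min θ M / b)) ρ := (integrable_const 1).sub i1
    rw [integral_add (i3.const_mul _) i2, integral_const_mul,
      integral_sub (integrable_const 1) i1]
    simp

end

end Avalanche

/-! ### Assembly for a critical law. -/

open Avalanche in
theorem proposition4p2 (b : ℕ) (hb : 1 < b) (ρ : Measure ℝ) (hρ : Avalanche.Admissible b ρ)
    (hcrit : Avalanche.rate b ρ = 1 / (b : ℝ)) :
    -- the objects that enter the limit are well defined
    (∀ θ : ℝ, 1 ≤ θ →
      Tendsto (fun n : ℕ => Avalanche.survival b ρ n θ ^ (1 / (n : ℝ))) atTop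
        (𝓝 (Avalanche.rate b ρ))) ∧
    (∀ θ : ℝ, 0 ≤ θ →
      Tendsto (fun n : ℕ => Avalanche.survival b ρ n θ / Avalanche.rate b ρ ^ n) atTop
        (𝓝 (Avalanche.psi b ρ θ))) ∧
    Avalanche.IsLimitLaw b ρ (Avalanche.limitLaw b ρ) ∧
    (0 < Avalanche.cConst b ρ ∧
      1 / Avalanche.cConst b ρ ^ 2 = Avalanche.invSqConst b ρ) ∧
    -- the critical asymptotics
    ∀ θ : ℝ, 0 < θ →
      Tendsto (fun l : unitInterval => Avalanche.hitProb b ρ θ l / √(l : ℝ)) (𝓝[>] 0)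
        (𝓝 (Avalanche.cConst b ρ * Avalanche.psi b ρ θ)) := by
  have := hρ.isProb
  obtain ⟨hac, h01, hp⟩ := hρ.basic
  have hlim := isLimitLaw_limitLaw hb hρ
  -- The cap will be adapted to `θ`; criticality fixes the eigenvalue as `1 / b` for every cap.
  have gap : ∀ M : ℝ, 2 ≤ M → ∃ φ ε, HasGap b ρ M (1 / (b : ℝ)) φ ε := fun M hM => by
    obtain ⟨z, φ, ε, H⟩ := exists_hasGap hb hac (by linarith : 1 ≤ M) hp
    have hz := H.rate_eq hb hM h01
    rw [hcrit] at hz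
    exact ⟨φ, ε, hz ▸ H⟩
  refine ⟨fun θ hθ => ?_, fun θ _ => ?_, hlim, ?_, fun θ _ => ?_⟩
  · obtain ⟨φ, ε, H⟩ := gap (max 2 θ) (le_max_left _ _)
    rw [hcrit]
    exact H.tendsto_survival_root hb (le_max_left _ _) h01 hθ (le_max_right _ _)
  · obtain ⟨φ, ε, H⟩ := gap (max 2 θ) (le_max_left _ _)
    rw [hcrit, H.psi_eq hb (le_max_left _ _) h01 (le_max_right _ _)]
    exact H.tendsto_survival hb (le_max_left _ _) h01 (le_max_right _ _)
  · obtain ⟨φ, ε, H⟩ := gap 2 le_rfl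
    have h1 := (H.invSqConst_pos_and_mul_psi hb le_rfl h01 hlim).1
    refine ⟨inv_pos.2 (Real.sqrt_pos.2 h1), ?_⟩
    rw [cConst, inv_pow, Real.sq_sqrt h1.le, one_div, inv_inv]
  · have hM : (2 : ℝ) ≤ max 2 θ := le_max_left _ _
    have hθM : θ ≤ max 2 θ := le_max_right _ _
    obtain ⟨φ, ε, H⟩ := gap _ hM
    have hl : Tendsto (fun l : unitInterval => (l : ℝ)) (𝓝[>] 0) (𝓝 0) :=
      (continuous_subtype_val.tendsto (0 : unitInterval)).mono_left nhdsWithin_le_nhds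
    have h1 := H.tendsto_isHit hb hl (F := fun l θ' => alive θ' *
      (jointLaw b ρ l).real (hitSet b (min θ' (max 2 θ))))
      (eventually_nhdsWithin_of_forall fun l hl => isHit_hit hb h01 hM hl) θ
    rw [(H.invSqConst_pos_and_mul_psi hb hM h01 hlim).2 θ hθM]
    rcases lt_or_ge θ 1 with hθ | hθ
    -- Below one only the root can be green, so the quotient is `l / √l = √l`, in accordance with
    -- the vanishing of `ψ`.
    · rw [H.eigen.dead θ hθ, mul_zero]
      have h2 : Tendsto (fun l : unitInterval => √(l : ℝ)) (𝓝[>] 0) (𝓝 0) := by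
        simpa [Function.comp_def] using (Real.continuous_sqrt.tendsto 0).comp hl
      refine h2.congr fun l => ?_
      rw [hitProb_eq hb hac h01, hit_of_lt hθ, Real.div_sqrt]
    · refine h1.congr fun l => ?_
      rw [hitProb_eq hb hac h01, alive_of_le hθ, one_mul, min_eq_left hθM]
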